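/- Let $M$ be a smooth connected Riemannian manifold without boundary (Hausdorff and second countable), with volume measure $\mathrm{vol}$, and let $p\in[1,\infty)$. All functions and $1$-forms are complex-valued; $(\cdot,\cdot)_x$ and $|\cdot|_x$ denote the Hermitian product (antilinear in the first argument) and norm induced by the metric on the complexified cotangent spaces, and $d^\dagger$ is the formal adjoint of the exterior derivative $d$ on functions with respect to $\langle \alpha,\beta\rangle=\int_M(\alpha,\beta)_x\,\mathrm{vol}(dx)$. For $f\in L^1_{\mathrm{loc}}(M)$, a locally integrable $1$-form $\beta$ is the distributional differential $df$ of $f$ if $$\int_M(\beta(x),\alpha(x))_x\,\mathrm{vol}(dx)=\int_M\overline{f(x)}\,d^\dagger\alpha(x)\,\mathrm{vol}(dx)$$ for all smooth compactly supported $1$-forms $\alpha$. Let $W^{1,p}(M)$ be the space of all $f\in L^p(M)$ whose distributional differential $df$ is a $1$-form in $L^p$, with norm $\|f\|_{1,p}=\|f\|_p+\|df\|_p$, and let $H^{1,p}(M)\subset W^{1,p}(M)$ be the closure with respect to $\|\cdot\|_{1,p}$ of the set of all $f\in L^p(M)\cap C^\infty(M)$ with $df\in L^p$. If $M$ is geodesically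 complete (every geodesic defined on an open interval extends to a geodesic defined on all of $\mathbb{R}$), then the space $C_c^\infty(M)$ of smooth compactly supported functions is contained and dense in $W^{1,p}(M)$ with respect to $\|\cdot\|_{1,p}$. In particular, $W^{1,p}(M)=H^{1,p}(M)$. -/

import Mathlib

open MeasureTheory Set Filter Bundle
open scoped Manifold ContDiff Topology ENNReal Matrix ComplexConjugate

noncomputable section

namespace RiemannianSobolev

/-! ### Complex-valued covectors on a Euclidean vector space -/

section Covector

variable {V : Type*} [NormedAddCommGroup V] [InnerProductSpace ℝ V] [FiniteDimensional ℝ V]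

/-- The Hermitian product `(β, α)` of complex covectors (elements of the complexified dual `V* ⊗ ℂ`,
seen as real-linear maps `V → ℂ`) induced by the scalar product of `V`. It is antilinear in the
first argument. -/
def covectorInner (β α : V →L[ℝ] ℂ) : ℂ :=
  ∑ i, conj (β (stdOrthonormalBasis ℝ V i)) * α (stdOrthonormalBasis ℝ V i)

/-- The Hermitian norm `|β| = (β, β)^{1/2}` of a complex covector. -/
def covectorNorm (β : V →L[ℝ] ℂ) : ℝ :=
  √ (∑ i, ‖β (stdOrthonormalBasis ℝ V i)‖ ^ 2)

end Covector

section Manifold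

variable {m : ℕ} {M : Type*} [TopologicalSpace M] [ChartedSpace (EuclideanSpace ℝ (Fin m)) M]

instance finiteDimensionalTangentSpace (x : M) : FiniteDimensional ℝ (TangentSpace (𝓡 m) x) :=
  inferInstanceAs (FiniteDimensional ℝ (EuclideanSpace ℝ (Fin m)))

variable [RiemannianBundle (fun x : M ↦ TangentSpace (𝓡 m) x)]

/-! ### The metric in charts, the volume measure, geodesics -/

variable (m) in
/-- The coordinate vector fields of the chart around `x`: `chartFrame m x y v` is the tangent vector
`∂_v`, the derivative of the inverse chart in the direction `v`, at the point with coordinates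
`y`. -/
def chartFrame (x : M) (y : EuclideanSpace ℝ (Fin m)) :
    EuclideanSpace ℝ (Fin m) →L[ℝ] TangentSpace (𝓡 m) ((extChartAt (𝓡 m) x).symm y) :=
  (mfderiv (𝓡 m) (𝓡 m) (extChartAt (𝓡 m) x).symm y) ∘L
    (NormedSpace.fromTangentSpace (𝕜 := ℝ) y).symm.toContinuousLinearMap

variable (m) in
/-- The Riemannian metric in the chart around `x`: for `y` in the target of the chart,
`chartMetric m x y v w = g (∂_v, ∂_w)` at the point with coordinates `y`. -/
def chartMetric (x : M) (y v w : EuclideanSpace ℝ (Fin m)) : ℝ :=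
  inner ℝ (chartFrame m x y v) (chartFrame m x y w)

variable (m) in
/-- The matrix `(g_ij)` of the metric in the chart around `x`. -/
def chartGram (x : M) (y : EuclideanSpace ℝ (Fin m)) : Matrix (Fin m) (Fin m) ℝ :=
  Matrix.of fun i j ↦ chartMetric m x y (EuclideanSpace.single i 1) (EuclideanSpace.single j 1)

variable (m) in
/-- The volume measure of the domain of the chart around `x`, as a measure on `M`: the image under
the inverse chart of the measure `√(det g) dy` on the target of the chart. -/
def chartVolume [MeasurableSpace M] (x : M) : Measure M :=
  (((volume : Measure (EuclideanSpace ℝ (Fin m))).restrict (extChartAt (𝓡 m) x).target).withDensity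
    fun y ↦ ENNReal.ofReal √ (chartGram m x y).det).map (extChartAt (𝓡 m) x).symm

variable (m M) in
/-- The Riemannian volume measure `vol`. By the change of variables formula the measures
`chartVolume` agree on overlaps of chart domains; `vol` is the measure that restricts to
`chartVolume m x` on the domain of the chart around `x`, for every `x`, that is, the least measure
that dominates all of them. -/
def riemannianVolume [MeasurableSpace M] : Measure M :=
  ⨆ x : M, chartVolume m x

variable (m) in
/-- The Christoffel symbol of the first kind of the Levi-Civita connection in the chart around `x`,
`Γ(u, v; w) = g (∇_{∂_u} ∂_v, ∂_w) = (∂_u g(v, w) + ∂_v g(u, w) - ∂_w g(u, v)) / 2`. -/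
def christoffel (x : M) (y u v w : EuclideanSpace ℝ (Fin m)) : ℝ :=
  (fderiv ℝ (fun z ↦ chartMetric m x z v w) y u + fderiv ℝ (fun z ↦ chartMetric m x z u w) y v
    - fderiv ℝ (fun z ↦ chartMetric m x z u v) y w) / 2

variable (m) in
/-- `γ` is a geodesic on the open set `J ⊆ ℝ`: it is twice continuously differentiable there and
satisfies the geodesic equation `∇_{γ'} γ' = 0`. At time `t` the equation is written in the chart
around `γ t`, with `c` the coordinate expression of `γ`, and tested against all vectors `w`:
`g (c'', w) + Γ(c', c'; w) = 0`. -/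
def IsGeodesicOn (γ : ℝ → M) (J : Set ℝ) : Prop :=
  ContMDiffOn 𝓘(ℝ, ℝ) (𝓡 m) 2 γ J ∧
  ∀ t ∈ J, ∀ c : ℝ → EuclideanSpace ℝ (Fin m), (c = fun s ↦ extChartAt (𝓡 m) (γ t) (γ s)) →
    ∀ w : EuclideanSpace ℝ (Fin m),
      chartMetric m (γ t) (c t) (deriv (deriv c) t) w
        + christoffel m (γ t) (c t) (deriv c t) (deriv c t) w = 0

variable (m M) in
/-- Geodesic completeness: every geodesic defined on an open interval is the restriction of a
geodesic defined on all of `ℝ`. -/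
def GeodesicallyComplete : Prop :=
  ∀ (J : Set ℝ) (γ : ℝ → M), IsOpen J → J.OrdConnected → IsGeodesicOn m γ J →
    ∃ γ' : ℝ → M, IsGeodesicOn m γ' univ ∧ EqOn γ' γ J

/-! ### Complex one-forms -/

/-- The complexified cotangent space at `x`. -/
abbrev Covector (m : ℕ) {M : Type*} [TopologicalSpace M]
    [ChartedSpace (EuclideanSpace ℝ (Fin m)) M] (x : M) : Type :=
  TangentSpace (𝓡 m) x →L[ℝ] ℂ

variable (m) in
/-- The differential `dφ` of a function `φ : M → ℂ`. -/
def differential (φ : M → ℂ) (x : M) : Covector m x :=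
  mvfderiv (𝓡 m) φ x

variable (m) in
/-- `φ` belongs to `C_c^∞(M)`. -/
def IsTestFunction (φ : M → ℂ) : Prop :=
  ContMDiff (𝓡 m) 𝓘(ℝ, ℂ) ∞ φ ∧ HasCompactSupport φ

/-- `α` is a smooth compactly supported complex one-form. -/
def IsTestForm [IsManifold (𝓡 m) ∞ M] (α : (x : M) → Covector m x) : Prop :=
  ContMDiff (𝓡 m) ((𝓡 m).prod 𝓘(ℝ, EuclideanSpace ℝ (Fin m) →L[ℝ] ℂ)) ∞
    (fun x ↦ TotalSpace.mk' (EuclideanSpace ℝ (Fin m) →L[ℝ] ℂ)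
      (E := fun x : M ↦ TangentSpace (𝓡 m) x →L[ℝ] Bundle.Trivial M ℂ x) x (α x)) ∧
  IsCompact (closure {x | α x ≠ 0})

/-- A (not necessarily continuous) complex one-form is measurable if its coefficients in every chart
are (Lebesgue) measurable. -/
def AEMeasurableForm (β : (x : M) → Covector m x) : Prop :=
  ∀ (x : M) (v : EuclideanSpace ℝ (Fin m)),
    AEStronglyMeasurable
      (fun y ↦ β ((extChartAt (𝓡 m) x).symm y) (chartFrame m x y v))
      (volume.restrict (extChartAt (𝓡 m) x).target)

variable [MeasurableSpace M]

/-- The `L^p`-norm of a one-form. -/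
def formENorm (β : (x : M) → Covector m x) (p : ℝ≥0∞) : ℝ≥0∞ :=
  eLpNorm (fun x ↦ covectorNorm (β x)) p (riemannianVolume m M)

/-- `β` is an `L^p` one-form. -/
def MemLpForm (β : (x : M) → Covector m x) (p : ℝ≥0∞) : Prop :=
  AEMeasurableForm β ∧ formENorm β p < ⊤

/-- `h = d†α`, where `d†` is the formal adjoint of `d`: the smooth function `h` satisfies
`⟨dφ, α⟩ = ⟨φ, h⟩` for all `φ ∈ C_c^∞(M)`. -/
def IsCodifferential (α : (x : M) → Covector m x) (h : M → ℂ) : Prop :=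
  ContMDiff (𝓡 m) 𝓘(ℝ, ℂ) ∞ h ∧
  ∀ φ : M → ℂ, IsTestFunction m φ →
    ∫ x, covectorInner (differential m φ x) (α x) ∂(riemannianVolume m M) =
      ∫ x, conj (φ x) * h x ∂(riemannianVolume m M)

/-- The locally integrable one-form `β` is the distributional differential `df` of the locally
integrable function `f`: `∫ (β, α) dvol = ∫ conj f d†α dvol` for all smooth compactly supported
one-forms `α`. -/
def IsWeakDifferential [IsManifold (𝓡 m) ∞ M] (f : M → ℂ) (β : (x : M) → Covector m x) : Prop :=
  LocallyIntegrable f (riemannianVolume m M) ∧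
  AEMeasurableForm β ∧
  LocallyIntegrable (fun x ↦ covectorNorm (β x)) (riemannianVolume m M) ∧
  ∀ (α : (x : M) → Covector m x) (h : M → ℂ), IsTestForm α → IsCodifferential α h →
    ∫ x, covectorInner (β x) (α x) ∂(riemannianVolume m M) =
      ∫ x, conj (f x) * h x ∂(riemannianVolume m M)

/-! ### Sobolev spaces -/

variable (m M) in
/-- The Sobolev space `W^{1,p}(M)`: functions in `L^p` whose distributional differential is an `L^p`
one-form. Its elements are represented by functions, functions that agree almost everywhere
representing the same element. -/
def sobolevW [IsManifold (𝓡 m) ∞ M] (p : ℝ≥0∞) : Set (M → ℂ) :=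
  {f | MemLp f p (riemannianVolume m M) ∧
    ∃ β : (x : M) → Covector m x, MemLpForm β p ∧ IsWeakDifferential f β}

variable (m) in
/-- The Sobolev norm `‖f‖_p + ‖df‖_p`. The distributional differential is unique up to null sets, so
the infimum is over forms of one and the same norm; it is `∞` if there is no such form. -/
def sobolevENorm [IsManifold (𝓡 m) ∞ M] (f : M → ℂ) (p : ℝ≥0∞) : ℝ≥0∞ :=
  eLpNorm f p (riemannianVolume m M) +
    ⨅ (β : (x : M) → Covector m x) (_ : IsWeakDifferential f β), formENorm β p

variable (m) in
/-- The closure in `W^{1,p}(M)`, with respect to the Sobolev norm, of a set `S` of functions. -/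
def sobolevClosure [IsManifold (𝓡 m) ∞ M] (p : ℝ≥0∞) (S : Set (M → ℂ)) : Set (M → ℂ) :=
  {f | f ∈ sobolevW m M p ∧ ∀ ε : ℝ≥0∞, 0 < ε → ∃ u ∈ S, sobolevENorm m (f - u) p < ε}

variable (m M) in
/-- The Sobolev space `H^{1,p}(M)`: the closure in `W^{1,p}(M)` of the smooth functions `u ∈ L^p`
with `du ∈ L^p`. -/
def sobolevH [IsManifold (𝓡 m) ∞ M] (p : ℝ≥0∞) : Set (M → ℂ) :=
  sobolevClosure m p {u | ContMDiff (𝓡 m) 𝓘(ℝ, ℂ) ∞ u ∧ MemLp u p (riemannianVolume m M) ∧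
    MemLpForm (differential m u) p}

end Manifold

end RiemannianSobolev

end

/-! Completeness supplies cutoff functions with arbitrarily small gradient, and these reduce density
to a local statement. Let $f\in W^{1,p}(M)$. If $u$ is compactly supported, $c$-Lipschitz, takes
values in $[0,1]$ and equals $1$ on a large compact set, then formally $d(uf)=u\,df+f\,du$ with
$|du|\le c$. Hence $f-uf$ and $df-d(uf)$ are small in $L^p$ once the compact set is large and
$c\,\|f\|_p$ is small. This is `IsWeakDifferential.exists_isTestFunction_sub_le`. The product $uf$
is cut by a partition of unity into pieces supported in charts, and each piece is mollified
(`IsWeakDifferential.exists_isTestFunction_lipschitz_mul_approx`,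
`IsWeakDifferential.exists_isTestFunction_approx`).

The cutoffs are functions of the Riemannian distance to a point, so their supports are compact only
if closed balls are. This is Hopf–Rinow, `properSpace_of_geodesicallyComplete`, proved here without
the exponential map. A Riemannian manifold is a locally compact length space. At the smallest radius
$R$ where compactness of balls could fail, limits of almost minimizing chains give curves on $(0,R)$
with $d(\gamma(s),\gamma(t))=|s-t|$, and balls stay compact if such curves have a limit at $R$
(`HasIntermediatePoints.properSpace`). Such a curve is a geodesic (`isGeodesicOn_of_dist_eq`), so
completeness extends it continuously beyond $R$.

That metrically minimizing curves are geodesics rests on two facts. In a chart the distance is given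
to first order by the metric tensor (`isMetricChart_extChartAt`), so a minimizing curve is
Lipschitz, has unit speed almost everywhere and minimizes energy. The vanishing first variation and
the lemma of du Bois-Reymond then give $C^2$ regularity and the Euler–Lagrange equation
(`IsMetricChart.geodesic_of_minimizing`).

On the analytic side, weak differentials are defined by testing against forms and their
codifferentials. Testing with forms supported in a chart, whose codifferential is explicit, turns
them into ordinary weak derivatives on open subsets of Euclidean space
(`IsWeakDifferential.hasWeakDeriv`). The cutoffs are merely Lipschitz, which is why the product rule
`HasWeakDeriv.lipschitz_smul` is needed in that generality. The equality $W=H$ follows since test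
functions are among the smooth functions whose closure is $H$. -/

noncomputable section

namespace RiemannianSobolev

set_option linter.unusedSectionVars false

/-! ### The metric tensor in chart coordinates -/

section ChartMetric

variable {m : ℕ} {M : Type*} [TopologicalSpace M] [ChartedSpace (EuclideanSpace ℝ (Fin m)) M]

local notation "𝔼" => EuclideanSpace ℝ (Fin m)

lemma isOpen_target (x : M) : IsOpen (extChartAt (𝓡 m) x).target :=
  isOpen_extChartAt_target x

variable (m) in
/-- The vector field on the domain of the chart around `x` with constant coordinates `v`. -/
def frameField (x : M) [IsManifold (𝓡 m) 1 M] (v : 𝔼) (p : M) : TangentSpace (𝓡 m) p :=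
  (trivializationAt 𝔼 (TangentSpace (𝓡 m)) x).symmL ℝ p v

lemma chartFrame_eq_mfderiv (x : M) (y v : 𝔼) :
    chartFrame m x y v = mfderiv (𝓡 m) (𝓡 m) (extChartAt (𝓡 m) x).symm y v := rfl

variable [IsManifold (𝓡 m) ∞ M]

/-- The trivialization of the tangent bundle over a chart is the derivative of that chart, so
inverting it amounts to differentiating the inverse chart. Smoothness is available on the bundle
side, while computations take place in coordinates; this identity passes between them. -/
lemma chartFrame_eq_frameField (x : M) {y : 𝔼} (hy : y ∈ (extChartAt (𝓡 m) x).target) (v : 𝔼) :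
    chartFrame m x y v = frameField m x v ((extChartAt (𝓡 m) x).symm y) := by
  have hs : (extChartAt (𝓡 m) x).symm y ∈ (chartAt 𝔼 x).source := by
    simpa [extChartAt_source] using (extChartAt (𝓡 m) x).map_target hy
  rw [chartFrame_eq_mfderiv, frameField, TangentBundle.symmL_trivializationAt hs]
  have := (extChartAt (𝓡 m) x).right_inv hy
  rw [this]
  simp only [modelWithCornersSelf_coe, range_id, mfderivWithin_univ]
  rfl

lemma mfderiv_extChartAt_chartFrame (x : M) {y : 𝔼} (hy : y ∈ (extChartAt (𝓡 m) x).target)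
    (v : 𝔼) :
    mfderiv (𝓡 m) (𝓡 m) (extChartAt (𝓡 m) x) ((extChartAt (𝓡 m) x).symm y)
      (chartFrame m x y v) = v := by
  have := mfderiv_extChartAt_comp_mfderivWithin_extChartAt_symm (I := 𝓡 m) hy
  simp only [modelWithCornersSelf_coe, range_id, mfderivWithin_univ] at this
  exact DFunLike.congr_fun this v

lemma chartFrame_mfderiv_extChartAt (x : M) {y : 𝔼} (hy : y ∈ (extChartAt (𝓡 m) x).target)
    (v : TangentSpace (𝓡 m) ((extChartAt (𝓡 m) x).symm y)) :
    chartFrame m x y (mfderiv (𝓡 m) (𝓡 m) (extChartAt (𝓡 m) x)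
      ((extChartAt (𝓡 m) x).symm y) v) = v := by
  have := mfderivWithin_extChartAt_symm_comp_mfderiv_extChartAt (I := 𝓡 m) hy
  simp only [modelWithCornersSelf_coe, range_id, mfderivWithin_univ] at this
  exact DFunLike.congr_fun this v

lemma chartFrame_injective (x : M) {y : 𝔼} (hy : y ∈ (extChartAt (𝓡 m) x).target) :
    Function.Injective (chartFrame m x y) := fun v w h ↦ by
  rw [← mfderiv_extChartAt_chartFrame x hy v, h, mfderiv_extChartAt_chartFrame x hy w]

/-- The field is the smooth inverse trivialization applied to a constant section of the trivial
bundle. -/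
lemma contMDiffOn_frameField (x : M) (v : 𝔼) :
    ContMDiffOn (𝓡 m) ((𝓡 m).prod 𝓘(ℝ, 𝔼)) ∞
      (fun p ↦ TotalSpace.mk' 𝔼 (E := fun p : M ↦ TangentSpace (𝓡 m) p) p (frameField m x v p))
      (chartAt 𝔼 x).source := by
  have h := (trivializationAt 𝔼 (TangentSpace (𝓡 m) (M := M)) x).contMDiffOn_symmL (𝕜 := ℝ)
    (n := ∞) (IB := 𝓡 m)
  have h2 : ContMDiffOn (𝓡 m) ((𝓡 m).prod 𝓘(ℝ, 𝔼)) ∞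
      (fun p ↦ TotalSpace.mk' 𝔼 (E := Bundle.Trivial M 𝔼) p v) (chartAt 𝔼 x).source := by
    intro p _
    rw [contMDiffWithinAt_totalSpace]
    exact ⟨contMDiffWithinAt_id, contMDiffWithinAt_const⟩
  exact ContMDiffOn.clm_bundle_apply (F₁ := 𝔼) (E₁ := Bundle.Trivial M 𝔼) (n := ∞) h h2

variable [RiemannianBundle (fun x : M ↦ TangentSpace (𝓡 m) x)]
  [IsContMDiffRiemannianBundle (𝓡 m) ∞ (EuclideanSpace ℝ (Fin m))
      (fun x : M ↦ TangentSpace (𝓡 m) x)]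

lemma contMDiffOn_inner_frameField (x : M) (v w : 𝔼) :
    ContMDiffOn (𝓡 m) 𝓘(ℝ, ℝ) ∞
      (fun p ↦ inner ℝ (frameField m x v p) (frameField m x w p)) (chartAt 𝔼 x).source :=
  ContMDiffOn.inner_bundle (contMDiffOn_frameField x v) (contMDiffOn_frameField x w)

lemma contDiffOn_chartMetric (x : M) (v w : 𝔼) :
    ContDiffOn ℝ ∞ (fun y ↦ chartMetric m x y v w) (extChartAt (𝓡 m) x).target := by
  rw [← contMDiffOn_iff_contDiffOn]
  have h := (contMDiffOn_inner_frameField x v w).comp (contMDiffOn_extChartAt_symm (I := 𝓡 m) x)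
    (t := (chartAt 𝔼 x).source) (fun y hy ↦ by
      simpa [extChartAt_source] using (extChartAt (𝓡 m) x).map_target hy)
  refine h.congr fun y hy ↦ ?_
  simp only [chartMetric, chartFrame_eq_frameField x hy, Function.comp_apply]

omit [IsManifold (𝓡 m) ∞ M]
  [IsContMDiffRiemannianBundle (𝓡 m) ∞ (EuclideanSpace ℝ (Fin m))
      (fun x : M ↦ TangentSpace (𝓡 m) x)] in
lemma chartMetric_comm (x : M) (y v w : 𝔼) :
    chartMetric m x y v w = chartMetric m x y w v := real_inner_comm _ _

omit [IsManifold (𝓡 m) ∞ M]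
  [IsContMDiffRiemannianBundle (𝓡 m) ∞ (EuclideanSpace ℝ (Fin m))
      (fun x : M ↦ TangentSpace (𝓡 m) x)] in
lemma chartMetric_self_nonneg (x : M) (y v : 𝔼) : 0 ≤ chartMetric m x y v v :=
  real_inner_self_nonneg

omit [IsContMDiffRiemannianBundle (𝓡 m) ∞ (EuclideanSpace ℝ (Fin m))
      (fun x : M ↦ TangentSpace (𝓡 m) x)] in
lemma chartMetric_self_pos (x : M) {y : 𝔼} (hy : y ∈ (extChartAt (𝓡 m) x).target) {v : 𝔼}
    (hv : v ≠ 0) : 0 < chartMetric m x y v v := by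
  refine real_inner_self_pos.2 fun h ↦ hv (chartFrame_injective x hy ?_)
  rw [h, map_zero]

omit [IsManifold (𝓡 m) ∞ M]
  [IsContMDiffRiemannianBundle (𝓡 m) ∞ (EuclideanSpace ℝ (Fin m))
      (fun x : M ↦ TangentSpace (𝓡 m) x)] in
lemma chartMetric_self_eq_norm (x : M) (y v : 𝔼) :
    chartMetric m x y v v = ‖chartFrame m x y v‖ ^ 2 :=
  real_inner_self_eq_norm_sq _

variable (m) in
/-- The metric in the chart around `x`, as a bilinear form on the model space. -/
def chartForm (x : M) (y : 𝔼) : 𝔼 →L[ℝ] 𝔼 →L[ℝ] ℝ :=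
  (innerSL ℝ (E := TangentSpace (𝓡 m) ((extChartAt (𝓡 m) x).symm y))).bilinearComp
    (chartFrame m x y) (chartFrame m x y)

omit [IsManifold (𝓡 m) ∞ M]
  [IsContMDiffRiemannianBundle (𝓡 m) ∞ (EuclideanSpace ℝ (Fin m))
      (fun x : M ↦ TangentSpace (𝓡 m) x)] in
lemma chartForm_apply (x : M) (y v w : 𝔼) :
    chartForm m x y v w = chartMetric m x y v w := rfl

lemma contDiffOn_chartForm (x : M) :
    ContDiffOn ℝ ∞ (chartForm m x) (extChartAt (𝓡 m) x).target := by
  rw [contDiffOn_clm_apply]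
  intro v
  rw [contDiffOn_clm_apply]
  exact fun w ↦ contDiffOn_chartMetric x v w

end ChartMetric

/-! ### Hermitian linear algebra of complex covectors -/

section CovectorAlgebra

variable {V : Type*} [NormedAddCommGroup V] [InnerProductSpace ℝ V] [FiniteDimensional ℝ V]

lemma transpose_mul_gram_inv_mul {ι : Type*} [Fintype ι] [DecidableEq ι] {P : Matrix ι ι ℝ}
    (hP : IsUnit P.det) : Pᵀ * (P * Pᵀ)⁻¹ * P = 1 := by
  have hPt : IsUnit Pᵀ.det := by rwa [Matrix.det_transpose]
  rw [Matrix.mul_inv_rev, ← Matrix.mul_assoc, Matrix.mul_nonsing_inv _ hPt, Matrix.one_mul,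
    Matrix.nonsing_inv_mul _ hP]

/-- The Hermitian product of covectors in terms of the inverse Gram matrix of a basis. -/
lemma covectorInner_eq_sum_gram_inv {ι : Type*} [Fintype ι] [DecidableEq ι] (b : Module.Basis ι ℝ V)
    (β α : V →L[ℝ] ℂ) :
    covectorInner β α = ∑ j, ∑ k,
      (((Matrix.of fun i j ↦ inner ℝ (b i) (b j))⁻¹ : Matrix ι ι ℝ) j k : ℂ) *
        (conj (β (b j)) * α (b k)) := by
  classical
  -- The orthonormal basis in the definition is indexed by `Fin (finrank)`; reindexing it by `ι`
  -- makes the change of basis matrix square.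
  obtain ⟨σ⟩ : Nonempty (Fin (Module.finrank ℝ V) ≃ ι) := by
    refine Fintype.card_eq.1 ?_
    rw [Fintype.card_fin, Module.finrank_eq_card_basis b]
  set e : OrthonormalBasis ι ℝ V := (stdOrthonormalBasis ℝ V).reindex σ with he
  set P : Matrix ι ι ℝ := Matrix.of fun j i ↦ inner ℝ (e i) (b j) with hP
  have hb : ∀ j, b j = ∑ i, P j i • e i := fun j ↦ (e.sum_repr' (b j)).symm
  have hG : (Matrix.of fun i j ↦ inner ℝ (b i) (b j)) = P * Pᵀ := by
    ext i j
    rw [Matrix.mul_apply, Matrix.of_apply, ← e.sum_inner_mul_inner (b i) (b j)]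
    exact Finset.sum_congr rfl fun k _ ↦ by
      rw [Matrix.transpose_apply, hP, Matrix.of_apply, Matrix.of_apply, real_inner_comm]
  have hdet : IsUnit P.det := by
    have : P = (e.toBasis.toMatrix b)ᵀ := by
      ext i j
      simp [hP, Module.Basis.toMatrix_apply, OrthonormalBasis.repr_apply_apply]
    rw [this, Matrix.det_transpose, ← Module.Basis.det_apply]
    exact e.toBasis.isUnit_det b
  have hK := transpose_mul_gram_inv_mul hdet
  rw [hG]
  set Q := (P * Pᵀ)⁻¹ with hQ
  have hβ : ∀ j, conj (β (b j)) = ∑ i, (P j i : ℂ) * conj (β (e i)) := fun j ↦ by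
    rw [hb j]; simp
  have hα : ∀ j, α (b j) = ∑ i, (P j i : ℂ) * α (e i) := fun j ↦ by
    rw [hb j]; simp
  have hsum : covectorInner β α = ∑ i, conj (β (e i)) * α (e i) := by
    rw [covectorInner, ← σ.sum_comp]
    simp [he]
  have hKe : ∀ i l, ∑ j, ∑ k, (P j i : ℂ) * (Q j k : ℂ) * (P k l : ℂ) = if i = l then 1 else 0 := by
    intro i l
    have h := congrFun (congrFun hK i) l
    rw [Matrix.mul_apply, Matrix.one_apply] at h
    simp only [Matrix.mul_apply, Finset.sum_mul, Matrix.transpose_apply] at h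
    rw [Finset.sum_comm] at h
    have h2 := congrArg (fun r : ℝ ↦ (r : ℂ)) h
    push_cast at h2
    rw [h2]
    split_ifs <;> simp
  rw [hsum]
  -- The identity matrix is inserted in the form $P^T(PP^T)^{-1}P$, and the outer factors $P$ are
  -- absorbed to turn coefficients with respect to `e` into coefficients with respect to `b`.
  calc ∑ i, conj (β (e i)) * α (e i)
      = ∑ i, ∑ l, (∑ j, ∑ k, (P j i : ℂ) * (Q j k : ℂ) * (P k l : ℂ)) *
          (conj (β (e i)) * α (e l)) := by simp [hKe]
    _ = ∑ i, ∑ l, ∑ j, ∑ k, (P j i : ℂ) * (Q j k : ℂ) * (P k l : ℂ) *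
          (conj (β (e i)) * α (e l)) := by simp only [Finset.sum_mul]
    _ = ∑ j, ∑ k, ∑ i, ∑ l, (P j i : ℂ) * (Q j k : ℂ) * (P k l : ℂ) *
          (conj (β (e i)) * α (e l)) := by
        rw [Finset.sum_congr rfl fun i _ ↦ Finset.sum_comm, Finset.sum_comm]
        refine Finset.sum_congr rfl fun j _ ↦ ?_
        rw [Finset.sum_congr rfl fun i _ ↦ Finset.sum_comm, Finset.sum_comm]
    _ = _ := by
        refine Finset.sum_congr rfl fun j _ ↦ Finset.sum_congr rfl fun k _ ↦ ?_
        rw [hβ, hα, Finset.sum_mul_sum, Finset.mul_sum]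
        refine Finset.sum_congr rfl fun i _ ↦ ?_
        rw [Finset.mul_sum]
        exact Finset.sum_congr rfl fun l _ ↦ by ring

/-- Identifies a covector with its coefficient vector in $\mathbb{C}^n$, so that the triangle
inequality, homogeneity and Cauchy–Schwarz carry over. -/
lemma covectorNorm_eq_norm (β : V →L[ℝ] ℂ) :
    covectorNorm β = ‖WithLp.toLp 2 (fun i ↦ β (stdOrthonormalBasis ℝ V i))‖ := by
  rw [EuclideanSpace.norm_eq]; rfl

lemma covectorNorm_nonneg (β : V →L[ℝ] ℂ) : 0 ≤ covectorNorm β := Real.sqrt_nonneg _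

lemma covectorNorm_add_le (β α : V →L[ℝ] ℂ) :
    covectorNorm (β + α) ≤ covectorNorm β + covectorNorm α := by
  simp only [covectorNorm_eq_norm]
  exact norm_add_le (WithLp.toLp 2 (fun i ↦ β (stdOrthonormalBasis ℝ V i)))
    (WithLp.toLp 2 (fun i ↦ α (stdOrthonormalBasis ℝ V i)))

lemma covectorNorm_smul (c : ℂ) (β : V →L[ℝ] ℂ) :
    covectorNorm (c • β) = ‖c‖ * covectorNorm β := by
  simp only [covectorNorm_eq_norm]
  exact norm_smul c (WithLp.toLp 2 (fun i ↦ β (stdOrthonormalBasis ℝ V i)))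

lemma covectorNorm_neg (β : V →L[ℝ] ℂ) : covectorNorm (-β) = covectorNorm β := by
  have h := covectorNorm_smul (-1) β
  have h2 : (-1 : ℂ) • β = -β := neg_one_smul ℂ β
  rw [h2] at h
  simpa using h

lemma covectorNorm_sub_le (β α : V →L[ℝ] ℂ) :
    covectorNorm (β - α) ≤ covectorNorm β + covectorNorm α := by
  rw [sub_eq_add_neg, ← covectorNorm_neg α]
  exact covectorNorm_add_le _ _

lemma covectorNorm_zero : covectorNorm (0 : V →L[ℝ] ℂ) = 0 := by
  simp [covectorNorm]

lemma covectorInner_eq_inner (β α : V →L[ℝ] ℂ) :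
    covectorInner β α = inner ℂ (WithLp.toLp 2 (fun i ↦ β (stdOrthonormalBasis ℝ V i)))
      (WithLp.toLp 2 (fun i ↦ α (stdOrthonormalBasis ℝ V i))) := by
  simp [covectorInner, PiLp.inner_apply, mul_comm]

lemma norm_covectorInner_le (β α : V →L[ℝ] ℂ) :
    ‖covectorInner β α‖ ≤ covectorNorm β * covectorNorm α := by
  rw [covectorInner_eq_inner, covectorNorm_eq_norm, covectorNorm_eq_norm]
  exact norm_inner_le_norm _ _

lemma covectorNorm_sq (β : V →L[ℝ] ℂ) : covectorNorm β ^ 2 = (covectorInner β β).re := by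
  rw [covectorInner_eq_inner, covectorNorm_eq_norm, norm_sq_eq_re_inner (𝕜 := ℂ)]; rfl

lemma covectorInner_sub_left (β β' α : V →L[ℝ] ℂ) :
    covectorInner (β - β') α = covectorInner β α - covectorInner β' α := by
  simp [covectorInner, sub_mul, Finset.sum_sub_distrib]

lemma covectorInner_zero_right (β : V →L[ℝ] ℂ) : covectorInner β 0 = 0 := by
  simp [covectorInner]

/-- The Hermitian product with a multiple of the covector `⟪u, ·⟫`. -/
lemma covectorInner_flat (β : V →L[ℝ] ℂ) (c : ℝ) (u : V) :
    covectorInner β (c • (Complex.ofRealCLM ∘L innerSL ℝ u)) = c * conj (β u) := by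
  have h : β u = ∑ i, ((inner ℝ u (stdOrthonormalBasis ℝ V i) : ℝ) : ℂ) *
      β (stdOrthonormalBasis ℝ V i) := by
    conv_lhs => rw [← (stdOrthonormalBasis ℝ V).sum_repr' u]
    simp [real_inner_comm]
  rw [h, covectorInner]
  simp only [map_sum, map_mul, Complex.conj_ofReal, Finset.mul_sum]
  refine Finset.sum_congr rfl fun i _ ↦ ?_
  simp
  ring

/-- A covector is bounded by its Hermitian norm. -/
lemma norm_apply_le_covectorNorm (β : V →L[ℝ] ℂ) (u : V) : ‖β u‖ ≤ covectorNorm β * ‖u‖ := by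
  -- Cauchy–Schwarz against the covector dual to `u`, which has the same norm as `u`.
  have h := norm_covectorInner_le β ((1 : ℝ) • (Complex.ofRealCLM ∘L innerSL ℝ u))
  have h2 : covectorNorm ((1 : ℝ) • (Complex.ofRealCLM ∘L innerSL ℝ u)) = ‖u‖ := by
    rw [← Real.sqrt_sq (norm_nonneg u), ← (stdOrthonormalBasis ℝ V).sum_sq_norm_inner_right u,
      covectorNorm]
    simp [real_inner_comm]
  rw [covectorInner_flat, h2] at h
  simpa using h

/-- The Hermitian norm of a real covector bounded by `C` is at most `C`. -/
lemma covectorNorm_ofReal_le {C : ℝ} (hC : 0 ≤ C) (l : V →L[ℝ] ℝ) (hl : ∀ v, |l v| ≤ C * ‖v‖) :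
    covectorNorm (Complex.ofRealCLM ∘L l) ≤ C := by
  set u := (InnerProductSpace.toDual ℝ V).symm l
  have hu : l = innerSL ℝ u := by
    ext v; simp [u]
  have hn : ‖u‖ ≤ C := by
    -- Testing the bound on `u` itself gives $\|u\|^2\le C\|u\|$.
    by_contra! h
    have := hl u
    rw [hu] at this
    simp only [innerSL_apply_apply, real_inner_self_eq_norm_sq, abs_pow, abs_norm] at this
    nlinarith
  rw [hu]
  refine le_trans (le_of_eq ?_) hn
  rw [← Real.sqrt_sq (norm_nonneg u), ← (stdOrthonormalBasis ℝ V).sum_sq_norm_inner_right u,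
    covectorNorm]
  simp [real_inner_comm]

end CovectorAlgebra

/-! ### Change of coordinates and the Gram determinant -/

section ChartTransition

variable {m : ℕ} {M : Type*} [TopologicalSpace M] [ChartedSpace (EuclideanSpace ℝ (Fin m)) M]
  [IsManifold (𝓡 m) ∞ M]

local notation "𝔼" => EuclideanSpace ℝ (Fin m)

lemma frameField_mfderiv_extChartAt (x : M) {p : M} (hp : p ∈ (chartAt 𝔼 x).source)
    (u : TangentSpace (𝓡 m) p) :
    frameField m x (mfderiv (𝓡 m) (𝓡 m) (extChartAt (𝓡 m) x) p u) p = u := by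
  have h := TangentBundle.continuousLinearMapAt_trivializationAt (I := 𝓡 m) (x₀ := x) hp
  have h2 : mfderiv (𝓡 m) (𝓡 m) (extChartAt (𝓡 m) x) p u =
    (trivializationAt 𝔼 (TangentSpace (𝓡 m)) x).continuousLinearMapAt ℝ p u := DFunLike.congr_fun h.symm u
  rw [h2, frameField]
  exact (trivializationAt 𝔼 (TangentSpace (𝓡 m)) x).symmL_continuousLinearMapAt
    (by simpa using hp) u

/-- The coordinate transition map from the chart around `x` to the chart around `x'`. -/
def transition (x x' : M) : 𝔼 → 𝔼 := extChartAt (𝓡 m) x' ∘ (extChartAt (𝓡 m) x).symm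

/-- The chain rule: the second chart composed with the first inverse chart is the transition map,
and `frameField` undoes the derivative of the second chart. -/
lemma chartFrame_eq_frameField_transition (x x' : M) {y : 𝔼}
    (hy : y ∈ (extChartAt (𝓡 m) x).target)
    (hy' : (extChartAt (𝓡 m) x).symm y ∈ (chartAt 𝔼 x').source) (v : 𝔼) :
    chartFrame m x y v =
      frameField m x' (fderiv ℝ (transition x x') y v) ((extChartAt (𝓡 m) x).symm y) := by
  have h1 : MDifferentiableAt (𝓡 m) (𝓡 m) (extChartAt (𝓡 m) x')
      ((extChartAt (𝓡 m) x).symm y) := mdifferentiableAt_extChartAt hy'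
  have h2 : MDifferentiableAt (𝓡 m) (𝓡 m) (extChartAt (𝓡 m) x).symm y :=
    ((contMDiffOn_extChartAt_symm (I := 𝓡 m) (n := 1) x).contMDiffAt
      ((isOpen_target x).mem_nhds hy)).mdifferentiableAt one_ne_zero
  have h3 : fderiv ℝ (transition x x') y v =
      mfderiv (𝓡 m) (𝓡 m) (extChartAt (𝓡 m) x') ((extChartAt (𝓡 m) x).symm y)
        (chartFrame m x y v) := by
    have := mfderiv_comp y h1 h2
    rw [mfderiv_eq_fderiv] at this
    exact DFunLike.congr_fun this v
  rw [h3, frameField_mfderiv_extChartAt x' hy']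

lemma hasFDerivAt_comp_chart {F : Type*} [NormedAddCommGroup F] [NormedSpace ℝ F] {φ : M → F}
    (x : M) {y : 𝔼} (hy : y ∈ (extChartAt (𝓡 m) x).target)
    (hφ : MDifferentiableAt (𝓡 m) 𝓘(ℝ, F) φ ((extChartAt (𝓡 m) x).symm y)) :
    HasFDerivAt (φ ∘ (extChartAt (𝓡 m) x).symm)
      (mvfderiv (𝓡 m) φ ((extChartAt (𝓡 m) x).symm y) ∘L chartFrame m x y) y := by
  have h2 : MDifferentiableAt (𝓡 m) (𝓡 m) (extChartAt (𝓡 m) x).symm y :=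
    ((contMDiffOn_extChartAt_symm (I := 𝓡 m) (n := 1) x).contMDiffAt
      ((isOpen_target x).mem_nhds hy)).mdifferentiableAt one_ne_zero
  exact (hφ.hasMFDerivAt.comp y h2.hasMFDerivAt).hasFDerivAt

lemma differential_chartFrame {φ : M → ℂ} (x : M) {y : 𝔼} (hy : y ∈ (extChartAt (𝓡 m) x).target)
    (hφ : MDifferentiableAt (𝓡 m) 𝓘(ℝ, ℂ) φ ((extChartAt (𝓡 m) x).symm y)) (v : 𝔼) :
    differential m φ ((extChartAt (𝓡 m) x).symm y) (chartFrame m x y v) =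
      fderiv ℝ (φ ∘ (extChartAt (𝓡 m) x).symm) y v := by
  rw [(hasFDerivAt_comp_chart x hy hφ).fderiv]; rfl

/-- The basis of coordinate vectors of the chart around `x`. -/
def chartBasis (x : M) {y : 𝔼} (hy : y ∈ (extChartAt (𝓡 m) x).target) :
    Module.Basis (Fin m) ℝ (TangentSpace (𝓡 m) ((extChartAt (𝓡 m) x).symm y)) :=
  (EuclideanSpace.basisFun (Fin m) ℝ).toBasis.map
    (LinearEquiv.ofBijective (chartFrame m x y).toLinearMap
      ⟨chartFrame_injective x hy, fun u ↦ ⟨_, chartFrame_mfderiv_extChartAt x hy u⟩⟩)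

lemma chartBasis_apply (x : M) {y : 𝔼} (hy : y ∈ (extChartAt (𝓡 m) x).target) (i : Fin m) :
    chartBasis x hy i = chartFrame m x y (EuclideanSpace.single i 1) := by
  rw [chartBasis, Module.Basis.map_apply]
  simp only [OrthonormalBasis.coe_toBasis, EuclideanSpace.basisFun_apply]
  rfl

variable [RiemannianBundle (fun x : M ↦ TangentSpace (𝓡 m) x)]

lemma chartMetric_extChartAt (x : M) {p : M} (hp : p ∈ (chartAt 𝔼 x).source) (v w : 𝔼) :
    chartMetric m x (extChartAt (𝓡 m) x p) v w =
      inner ℝ (frameField m x v p) (frameField m x w p) := by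
  have hp' : p ∈ (extChartAt (𝓡 m) x).source := by rwa [extChartAt_source]
  rw [chartMetric, chartFrame_eq_frameField x ((extChartAt (𝓡 m) x).map_source hp'),
    chartFrame_eq_frameField x ((extChartAt (𝓡 m) x).map_source hp'),
    (extChartAt (𝓡 m) x).left_inv hp']

lemma chartMetric_transition (x x' : M) {y : 𝔼} (hy : y ∈ (extChartAt (𝓡 m) x).target)
    (hy' : (extChartAt (𝓡 m) x).symm y ∈ (chartAt 𝔼 x').source) (v w : 𝔼) :
    chartMetric m x y v w = chartMetric m x' (transition x x' y)
      (fderiv ℝ (transition x x') y v) (fderiv ℝ (transition x x') y w) := by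
  have h : transition x x' y = extChartAt (𝓡 m) x' ((extChartAt (𝓡 m) x).symm y) := rfl
  rw [h, chartMetric_extChartAt x' hy', chartMetric,
    chartFrame_eq_frameField_transition x x' hy hy', chartFrame_eq_frameField_transition x x' hy hy']

lemma chartGram_eq (x : M) {y : 𝔼} (hy : y ∈ (extChartAt (𝓡 m) x).target) :
    chartGram m x y = Matrix.of fun i j ↦ inner ℝ (chartBasis x hy i) (chartBasis x hy j) := by
  ext i j
  simp only [chartGram, Matrix.of_apply, chartBasis_apply, chartMetric]

/-- The Hermitian product of covectors in coordinates. -/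
lemma covectorInner_chart (x : M) {y : 𝔼} (hy : y ∈ (extChartAt (𝓡 m) x).target)
    (β α : TangentSpace (𝓡 m) ((extChartAt (𝓡 m) x).symm y) →L[ℝ] ℂ) :
    covectorInner β α = ∑ j, ∑ k, (((chartGram m x y)⁻¹ j k : ℝ) : ℂ) *
      (conj (β (chartFrame m x y (EuclideanSpace.single j 1))) *
        α (chartFrame m x y (EuclideanSpace.single k 1))) := by
  rw [covectorInner_eq_sum_gram_inv (chartBasis x hy), ← chartGram_eq x hy]
  simp only [chartBasis_apply]

omit [IsManifold (𝓡 m) ∞ M] in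
lemma chartForm_eq_sum (x : M) (y v w : 𝔼) :
    chartForm m x y v w = ∑ i, ∑ j, v i * (chartGram m x y i j * w j) := by
  have hv : v = ∑ i, v i • EuclideanSpace.single i (1 : ℝ) := by
    simpa using ((EuclideanSpace.basisFun (Fin m) ℝ).sum_repr v).symm
  have hw : w = ∑ i, w i • EuclideanSpace.single i (1 : ℝ) := by
    simpa using ((EuclideanSpace.basisFun (Fin m) ℝ).sum_repr w).symm
  conv_lhs => rw [hv, hw]
  simp only [map_sum, sum_apply, map_smul, smul_apply,
    smul_eq_mul, chartForm_apply, chartGram, Matrix.of_apply, Finset.mul_sum]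
  rw [Finset.sum_comm]
  exact Finset.sum_congr rfl fun i _ ↦ Finset.sum_congr rfl fun j _ ↦ by ring

lemma posDef_chartGram (x : M) {y : 𝔼} (hy : y ∈ (extChartAt (𝓡 m) x).target) :
    (chartGram m x y).PosDef := by
  refine Matrix.PosDef.of_dotProduct_mulVec_pos ?_ fun v hv ↦ ?_
  · ext i j
    simp [chartGram, chartMetric_comm x y (EuclideanSpace.single j 1)]
  · have h : 0 < chartForm m x y (WithLp.toLp 2 v) (WithLp.toLp 2 v) := by
      rw [chartForm_apply]
      exact chartMetric_self_pos x hy (by simpa using hv)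
    rw [chartForm_eq_sum] at h
    simpa [dotProduct, Matrix.mulVec, Finset.mul_sum] using h

lemma det_chartGram_pos (x : M) {y : 𝔼} (hy : y ∈ (extChartAt (𝓡 m) x).target) :
    0 < (chartGram m x y).det := (posDef_chartGram x hy).det_pos

/-- The Gram matrix transforms by congruence with the Jacobian, so its determinant picks up the
square of the Jacobian determinant. The square root therefore transforms as a density. -/
lemma det_chartGram_transition (x x' : M) {y : 𝔼} (hy : y ∈ (extChartAt (𝓡 m) x).target)
    (hy' : (extChartAt (𝓡 m) x).symm y ∈ (chartAt 𝔼 x').source) :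
    (chartGram m x y).det = (fderiv ℝ (transition x x') y).det ^ 2 *
      (chartGram m x' (transition x x' y)).det := by
  set D := fderiv ℝ (transition x x') y
  set b := (EuclideanSpace.basisFun (Fin m) ℝ).toBasis
  set A := LinearMap.toMatrix b b (D : 𝔼 →ₗ[ℝ] 𝔼) with hA
  have hAe : ∀ i j, A i j = D (EuclideanSpace.single j 1) i := fun i j ↦ by
    simp [hA, LinearMap.toMatrix_apply, b]
  have h : chartGram m x y = Aᵀ * chartGram m x' (transition x x' y) * A := by
    ext i j
    rw [Matrix.mul_assoc, Matrix.mul_apply]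
    simp only [Matrix.mul_apply, Matrix.transpose_apply, hAe, Finset.mul_sum]
    rw [← chartForm_eq_sum, chartForm_apply, chartGram, Matrix.of_apply,
      chartMetric_transition x x' hy hy']
  rw [h, Matrix.det_mul, Matrix.det_mul, Matrix.det_transpose, hA, LinearMap.det_toMatrix,
    ContinuousLinearMap.det]
  ring

variable [IsContMDiffRiemannianBundle (𝓡 m) ∞ (EuclideanSpace ℝ (Fin m))
      (fun x : M ↦ TangentSpace (𝓡 m) x)]

lemma contDiffOn_det_chartGram (x : M) :
    ContDiffOn ℝ ∞ (fun y ↦ (chartGram m x y).det) (extChartAt (𝓡 m) x).target := by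
  simp only [Matrix.det_apply]
  refine ContDiffOn.sum fun σ _ ↦ ContDiffOn.const_smul _ (contDiffOn_prod fun i _ ↦ ?_)
  exact contDiffOn_chartMetric x _ _

lemma contDiffOn_chartDensity (x : M) :
    ContDiffOn ℝ ∞ (fun y ↦ √(chartGram m x y).det) (extChartAt (𝓡 m) x).target :=
  (contDiffOn_det_chartGram x).sqrt fun _ hy ↦ (det_chartGram_pos x hy).ne'

/-- By Cramer's rule the inverse is the adjugate divided by a determinant that is positive on the
target of the chart. -/
lemma continuousOn_chartGram_inv (x : M) (j k : Fin m) :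
    ContinuousOn (fun y ↦ (chartGram m x y)⁻¹ j k) (extChartAt (𝓡 m) x).target := by
  have hG : ContinuousOn (fun y ↦ chartGram m x y) (extChartAt (𝓡 m) x).target :=
    continuousOn_pi.2 fun i ↦ continuousOn_pi.2 fun l ↦
      (contDiffOn_chartMetric x _ _).continuousOn
  have hadj : ContinuousOn (fun y ↦ (chartGram m x y).adjugate j k) (extChartAt (𝓡 m) x).target :=
    ((continuous_id.matrix_adjugate.matrix_elem j k).comp_continuousOn hG)
  simp only [Matrix.inv_def, Matrix.smul_apply, Ring.inverse_eq_inv', smul_eq_mul]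
  exact ((contDiffOn_det_chartGram x).continuousOn.inv₀
    fun y hy ↦ (det_chartGram_pos x hy).ne').mul hadj

end ChartTransition

/-! ### Hopf–Rinow in locally compact length spaces -/

section HopfRinow

variable {X : Type*} [MetricSpace X]

/-- Approximate existence of intermediate points; it characterizes length spaces among complete
metric spaces. -/
def HasIntermediatePoints (X : Type*) [MetricSpace X] : Prop :=
  ∀ (x y : X) (r s : ℝ), 0 < r → 0 < s → dist x y < r + s → ∃ z, dist x z < r ∧ dist z y < s

/-- Induction on the number of steps: the strict inequality leaves room to split off one step of
length less than `h` and keep a strict inequality for the rest. -/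
lemma HasIntermediatePoints.exists_chain (hX : HasIntermediatePoints X) {h : ℝ} (hh : 0 < h)
    (N : ℕ) : ∀ x y : X, dist x y < (N + 1 : ℕ) * h →
      ∃ z : ℕ → X, z 0 = x ∧ z (N + 1) = y ∧ ∀ i, dist (z i) (z (i + 1)) ≤ h := by
  induction N with
  | zero =>
    intro x y hxy
    refine ⟨fun i ↦ if i = 0 then x else y, by simp, by simp, fun i ↦ ?_⟩
    rcases i with _ | i
    · simpa using hxy.le
    · simpa using hh.le
  | succ N ih =>
    intro x y hxy
    obtain ⟨w, hw, hw'⟩ := hX x y h ((N + 1 : ℕ) * h) hh (by positivity) (by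
      push_cast at hxy ⊢; linarith)
    obtain ⟨z, hz0, hz1, hz⟩ := ih w y hw'
    refine ⟨fun i ↦ if i = 0 then x else z (i - 1), by simp, by simp [hz1], fun i ↦ ?_⟩
    rcases i with _ | i
    · simpa [hz0] using hw.le
    · simpa using hz i

/-- A chain from `x` to `y` of total length at most `dist x y + ε` is almost minimizing on each of
its parts, since any larger shortcut would bring `x` and `y` closer together. The curve is a step
function running along the chain: one `ε` is the excess length, the other accounts for rounding the
time. -/
lemma HasIntermediatePoints.exists_approx_geodesic (hX : HasIntermediatePoints X) (x y : X)
    {ε : ℝ} (hε : 0 < ε) :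
    ∃ c : ℝ → X, c 0 = x ∧ dist (c (dist x y)) y ≤ 2 * ε ∧
      ∀ s ∈ Icc 0 (dist x y), ∀ t ∈ Icc 0 (dist x y), |dist (c s) (c t) - (|s - t|)| ≤ 2 * ε := by
  set r := dist x y with hr
  have hr0 : 0 ≤ r := dist_nonneg
  -- This `N` makes the step length $h=(r+\varepsilon)/(N+1)$ at most $\varepsilon$.
  obtain ⟨N, hN⟩ := exists_nat_gt ((r + ε) / ε)
  set L : ℝ := ((N + 1 : ℕ) : ℝ) with hL
  have hLpos : 0 < L := by positivity
  set h := (r + ε) / L with hh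
  have hhpos : 0 < h := by positivity
  have hhε : h ≤ ε := by
    rw [hh, div_le_iff₀ hLpos]
    rw [div_lt_iff₀ hε] at hN
    rw [hL]; push_cast; nlinarith
  have hLh : L * h = r + ε := by rw [hh]; field_simp
  obtain ⟨z, hz0, hz1, hz⟩ := hX.exists_chain hhpos N x y (by rw [← hL, hLh]; linarith)
  have hzd : ∀ i j : ℕ, i ≤ j → dist (z i) (z j) ≤ ((j : ℝ) - i) * h := by
    intro i j hij
    induction j, hij using Nat.le_induction with
    | base => simp
    | succ j hj ih =>
      refine (dist_triangle _ (z j) _).trans ?_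
      push_cast
      linarith [hz j]
  have hfl : ∀ t, 0 ≤ t → (⌊t / h⌋₊ : ℝ) * h ≤ t ∧ t ≤ (⌊t / h⌋₊ : ℝ) * h + h := by
    intro t ht
    have h1 := Nat.floor_le (show 0 ≤ t / h by positivity)
    have h2 := Nat.lt_floor_add_one (t / h)
    rw [le_div_iff₀ hhpos] at h1
    rw [div_lt_iff₀ hhpos] at h2
    constructor <;> linarith
  have hle : ∀ t, 0 ≤ t → t ≤ r → ⌊t / h⌋₊ ≤ N + 1 := by
    intro t ht htr
    have h1 := (hfl t ht).1
    have : (⌊t / h⌋₊ : ℝ) * h < L * h := by linarith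
    have := lt_of_mul_lt_mul_right this hhpos.le
    rw [hL] at this
    exact_mod_cast this.le
  -- The upper bound counts steps; the lower bound subtracts the lengths of the two outer parts of
  -- the chain from $r$.
  have key : ∀ s t, 0 ≤ s → s ≤ t → t ≤ r →
      |dist (z ⌊s / h⌋₊) (z ⌊t / h⌋₊) - (|s - t|)| ≤ 2 * ε := by
    intro s t hs hst ht
    have hs' := hfl s hs
    have ht' := hfl t (hs.trans hst)
    have hij : ⌊s / h⌋₊ ≤ ⌊t / h⌋₊ := Nat.floor_le_floor (by gcongr)
    have hjL := hle t (hs.trans hst) ht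
    have d1 := hzd _ _ hij
    have d2 := hzd 0 _ (Nat.zero_le ⌊s / h⌋₊)
    have d3 := hzd _ _ hjL
    rw [hz0] at d2
    rw [hz1, ← hL] at d3
    have d4 : r ≤ dist x (z ⌊s / h⌋₊) + dist (z ⌊s / h⌋₊) (z ⌊t / h⌋₊) +
      dist (z ⌊t / h⌋₊) y := dist_triangle4 _ _ _ _
    rw [abs_sub_comm s t, abs_of_nonneg (sub_nonneg.2 hst), abs_le]
    push_cast at d2
    constructor <;> nlinarith
  refine ⟨fun t ↦ z ⌊t / h⌋₊, by simp [hz0], ?_, ?_⟩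
  · have d3 := hzd _ _ (hle r hr0 le_rfl)
    rw [hz1, ← hL] at d3
    have := hfl r hr0
    nlinarith
  · intro s hs t ht
    rcases le_total s t with hst | hst
    · exact key s t hs.1 hst ht.2
    · simpa only [dist_comm, abs_sub_comm] using key t s ht.1 hst hs.2

/-- If all smaller balls are compact and minimizing curves extend, then the closed ball is
compact. -/
lemma HasIntermediatePoints.isCompact_closedBall (hX : HasIntermediatePoints X)
    (hext : ∀ (R : ℝ) (γ : ℝ → X), 0 < R →
      (∀ s ∈ Ioo 0 R, ∀ t ∈ Ioo 0 R, dist (γ s) (γ t) = |s - t|) →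
      ∃ q, Tendsto γ (𝓝[<] R) (𝓝 q))
    (o : X) {R : ℝ} (hR : 0 < R) (hcpt : ∀ r < R, IsCompact (Metric.closedBall o r)) :
    IsCompact (Metric.closedBall o R) := by
  rw [isCompact_iff_isSeqCompact]
  intro x hx
  -- A limit along a fixed free ultrafilter yields a convergent subsequence. Ultrafilter limits
  -- exist at all times simultaneously, which replaces a diagonal argument for the curves below.
  suffices H : ∃ q ∈ Metric.closedBall o R, Tendsto x (hyperfilter ℕ : Filter ℕ) (𝓝 q) by
    obtain ⟨q, hq, hlim⟩ := H
    have hcl : MapClusterPt q atTop x := hlim.mapClusterPt.mono Nat.hyperfilter_le_atTop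
    obtain ⟨φ, hφ, hφ'⟩ := hcl.tendsto_subseq
    exact ⟨q, hq, φ, hφ, hφ'⟩
  set U := hyperfilter ℕ with hU
  suffices H : ∃ q, Tendsto x (U : Filter ℕ) (𝓝 q) by
    obtain ⟨q, hq⟩ := H
    exact ⟨q, Metric.isClosed_closedBall.mem_of_tendsto hq (Eventually.of_forall hx), hq⟩
  have hlimcpt : ∀ (K : Set X) (u : ℕ → X), IsCompact K → (∀ᶠ n in (U : Filter ℕ), u n ∈ K) →
      ∃ q, Tendsto u (U : Filter ℕ) (𝓝 q) := by
    intro K u hK hu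
    obtain ⟨q, -, hq⟩ := hK.ultrafilter_le_nhds (U.map u) (Filter.le_principal_iff.2 hu)
    exact ⟨q, hq⟩
  -- Either the sequence lies in a smaller, compact ball for almost all indices, or, the filter
  -- being an ultrafilter, it leaves each smaller ball for almost all indices.
  by_cases hcase : ∃ r < R, ∀ᶠ n in (U : Filter ℕ), x n ∈ Metric.closedBall o r
  · obtain ⟨r, hr, hxr⟩ := hcase
    exact hlimcpt _ x (hcpt r hr) hxr
  push Not at hcase
  have hfar : ∀ r < R, ∀ᶠ n in (U : Filter ℕ), r < dist o (x n) := by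
    intro r hr
    filter_upwards [hcase r hr] with n hn
    simpa [dist_comm] using hn
  have hle : ∀ n, dist o (x n) ≤ R := fun n ↦ by simpa [dist_comm] using hx n
  set ε : ℕ → ℝ := fun n ↦ 1 / ((n : ℝ) + 1) with hε
  have hεpos : ∀ n, 0 < ε n := fun n ↦ by positivity
  have hεlim : Tendsto ε (U : Filter ℕ) (𝓝 0) :=
    tendsto_one_div_add_atTop_nhds_zero_nat.mono_left Nat.hyperfilter_le_atTop
  choose c hc0 hc1 hc using fun n ↦ hX.exists_approx_geodesic o (x n) (hεpos n)
  -- At a time `t < R` the almost minimizing curves are at distance about `t` from `o`, hence in the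
  -- compact ball of radius `(t + R) / 2`.
  have hγ : ∀ t ∈ Ioo 0 R, ∃ q, Tendsto (fun n ↦ c n t) (U : Filter ℕ) (𝓝 q) := by
    intro t ht
    refine hlimcpt (Metric.closedBall o ((t + R) / 2)) _ (hcpt _ (by linarith [ht.2])) ?_
    filter_upwards [hfar t ht.2, hεlim.eventually (gt_mem_nhds
      (show (0 : ℝ) < (R - t) / 4 by linarith [ht.2]))] with n hn hn'
    have := hc n 0 ⟨le_rfl, dist_nonneg⟩ t ⟨ht.1.le, hn.le⟩
    rw [hc0, zero_sub, abs_neg, abs_of_pos ht.1] at this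
    rw [Metric.mem_closedBall, dist_comm]
    linarith [(abs_le.1 this).2]
  have : Nonempty X := ⟨o⟩
  choose! γ hγlim using hγ
  -- The errors of the approximate geodesics tend to zero, so the limit curve is exactly minimizing
  -- and the hypothesis on extensions applies to it.
  have hiso : ∀ s ∈ Ioo 0 R, ∀ t ∈ Ioo 0 R, dist (γ s) (γ t) = |s - t| := by
    intro s hs t ht
    have h1 : Tendsto (fun n ↦ dist (c n s) (c n t)) (U : Filter ℕ) (𝓝 (dist (γ s) (γ t))) :=
      (hγlim s hs).dist (hγlim t ht)
    have h2 : Tendsto (fun n ↦ dist (c n s) (c n t)) (U : Filter ℕ) (𝓝 |s - t|) := by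
      rw [tendsto_iff_dist_tendsto_zero]
      refine squeeze_zero' (Eventually.of_forall fun _ ↦ dist_nonneg) ?_
        (by simpa using hεlim.const_mul 2)
      filter_upwards [hfar s hs.2, hfar t ht.2] with n h3 h4
      exact hc n s ⟨hs.1.le, h3.le⟩ t ⟨ht.1.le, h4.le⟩
    exact tendsto_nhds_unique h1 h2
  obtain ⟨q, hq⟩ := hext R γ hR hiso
  refine ⟨q, Metric.tendsto_nhds.2 fun η hη ↦ ?_⟩
  -- The path from `x n` to `q` goes through the end of the approximate geodesic, its value at `t`,
  -- and `γ t`. Four contributions of `η / 5` suffice, one of them being twice the error `2 * (η /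
  -- 20)`.
  obtain ⟨t, htR, ht0, htq, htη⟩ : ∃ t, t < R ∧ 0 < t ∧ dist (γ t) q < η / 5 ∧ R - t < η / 5 := by
    have h1 : ∀ᶠ t in 𝓝[<] R, dist (γ t) q < η / 5 :=
      Metric.tendsto_nhds.1 hq _ (by positivity)
    have h2 : ∀ᶠ t in 𝓝[<] R, t ∈ Ioo (max 0 (R - η / 5)) R :=
      Ioo_mem_nhdsLT (max_lt hR (by linarith))
    obtain ⟨t, h3, h4⟩ := (h1.and h2).exists
    have h5 := max_lt_iff.1 h4.1
    exact ⟨t, h4.2, h5.1, h3, by linarith [h5.2]⟩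
  filter_upwards [hfar t htR, hεlim.eventually (gt_mem_nhds (show (0 : ℝ) < η / 20 by linarith)),
    Metric.tendsto_nhds.1 (hγlim t ⟨ht0, htR⟩) (η / 5) (by positivity)] with n h1 h2 h3
  have h4 := hc n (dist o (x n)) ⟨dist_nonneg, le_rfl⟩ t ⟨ht0.le, h1.le⟩
  have h5 : |dist o (x n) - t| ≤ R - t := by
    rw [abs_of_pos (by linarith)]; linarith [hle n]
  have h6 := (abs_le.1 h4).2
  have h7 := hc1 n
  have h8 := dist_triangle4 (x n) (c n (dist o (x n))) (c n t) q
  have h9 := dist_triangle (c n t) (γ t) q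
  rw [dist_comm (x n) (c n _)] at h8
  linarith

/-- **Hopf–Rinow** for length spaces: a locally compact length space in which minimizing curves
extend to the end points of their intervals of definition is proper. -/
theorem HasIntermediatePoints.properSpace [LocallyCompactSpace X] (hX : HasIntermediatePoints X)
    (hext : ∀ (R : ℝ) (γ : ℝ → X), 0 < R →
      (∀ s ∈ Ioo 0 R, ∀ t ∈ Ioo 0 R, dist (γ s) (γ t) = |s - t|) →
      ∃ q, Tendsto γ (𝓝[<] R) (𝓝 q)) : ProperSpace X := by
  refine ⟨fun o r₀ ↦ ?_⟩
  by_contra hr₀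
  -- Compactness of balls is continued past the infimum `R` of the bad radii: the ball of radius `R`
  -- is compact, and so is some thickening of it.
  set S := {r : ℝ | ¬ IsCompact (Metric.closedBall o r)} with hS
  have hSne : S.Nonempty := ⟨r₀, hr₀⟩
  have hS0 : ∀ r ∈ S, 0 ≤ r := by
    intro r hr
    by_contra! h
    exact hr (by rw [Metric.closedBall_eq_empty.2 h]; exact isCompact_empty)
  have hSbdd : BddBelow S := ⟨0, hS0⟩
  set R := sInf S with hR
  have hlt : ∀ r < R, IsCompact (Metric.closedBall o r) := fun r hr ↦ by
    by_contra h
    exact absurd (csInf_le hSbdd h) (not_le.2 hr)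
  have hRc : IsCompact (Metric.closedBall o R) := by
    rcases (le_csInf hSne hS0 : 0 ≤ R).eq_or_lt with h | h
    · rw [hR, ← h, Metric.closedBall_zero]; exact isCompact_singleton
    · exact hX.isCompact_closedBall hext o h hlt
  obtain ⟨δ, hδ, hδc⟩ := hRc.exists_isCompact_cthickening
  obtain ⟨r, hrS, hr⟩ := exists_lt_of_csInf_lt hSne (show sInf S < R + δ by linarith)
  refine hrS (hδc.of_isClosed_subset Metric.isClosed_closedBall fun y hy ↦ ?_)
  have hR0 : 0 ≤ R := le_csInf hSne hS0
  -- Intermediate points are only available for positive radii, so `R = 0` is separate.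
  rcases hR0.eq_or_lt with h | h
  · refine Metric.mem_cthickening_of_dist_le y o δ _ (by simp [hR0]) ?_
    rw [Metric.mem_closedBall] at hy
    linarith
  obtain ⟨z, hz, hz'⟩ := hX o y R δ h hδ (by
    rw [Metric.mem_closedBall, dist_comm] at hy; linarith)
  exact Metric.mem_cthickening_of_dist_le y z δ _
    (by rw [Metric.mem_closedBall, dist_comm]; exact hz.le) (by rw [dist_comm]; exact hz'.le)

end HopfRinow

/-! ### The fundamental lemma of the calculus of variations -/

section DuBoisReymond

lemma locallyIntegrable_of_bounded {f : ℝ → ℝ} {C : ℝ} (hf : Measurable f) (hC : ∀ t, |f t| ≤ C) :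
    LocallyIntegrable f volume :=
  (locallyIntegrable_const C).mono hf.aestronglyMeasurable
    (Eventually.of_forall fun t ↦ (hC t).trans (le_abs_self C))

lemma intervalIntegrable_of_bounded {f : ℝ → ℝ} {C : ℝ} (hf : Measurable f) (hC : ∀ t, |f t| ≤ C)
    (a b : ℝ) : IntervalIntegrable f volume a b :=
  intervalIntegrable_iff.mpr <| (LocallyIntegrable.integrableOn_isCompact
    (locallyIntegrable_of_bounded hf hC) isCompact_uIcc).mono_set uIoc_subset_uIcc

lemma lipschitzWith_integral_of_bounded {f : ℝ → ℝ} {C : ℝ} (hf : Measurable f)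
    (hC : ∀ t, |f t| ≤ C) (a : ℝ) : LipschitzWith C.toNNReal fun t ↦ ∫ s in a..t, f s := by
  have hC0 : 0 ≤ C := (abs_nonneg _).trans (hC 0)
  refine LipschitzWith.of_dist_le_mul fun s t ↦ ?_
  rw [Real.dist_eq, intervalIntegral.integral_interval_sub_left
    (intervalIntegrable_of_bounded hf hC _ _) (intervalIntegrable_of_bounded hf hC _ _),
    Real.dist_eq, Real.coe_toNNReal _ hC0, ← Real.norm_eq_abs]
  exact intervalIntegral.norm_integral_le_of_norm_le_const fun u _ ↦ hC u

lemma ae_deriv_integral_of_bounded {f : ℝ → ℝ} {C : ℝ} (hf : Measurable f)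
    (hC : ∀ t, |f t| ≤ C) (a : ℝ) :
    ∀ᵐ t, HasDerivAt (fun t ↦ ∫ s in a..t, f s) (f t) t := by
  filter_upwards [LocallyIntegrable.ae_hasDerivAt_integral (locallyIntegrable_of_bounded hf hC)] with t ht using ht a

/-- The lemma of du Bois-Reymond, with Lipschitz test functions. -/
theorem ae_eq_const_add_integral_of_forall_integral_eq_zero {P B : ℝ → ℝ} {a b C : ℝ} (hab : a < b)
    (hP : Measurable P) (hB : Measurable B) (hPC : ∀ t, |P t| ≤ C) (hBC : ∀ t, |B t| ≤ C)
    (H : ∀ (h : ℝ → ℝ) (K : NNReal), LipschitzWith K h → h a = 0 → h b = 0 →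
      ∫ t in a..b, (h t * B t + deriv h t * P t) = 0) :
    ∃ κ, ∀ᵐ t, t ∈ Ioc a b → P t = κ + ∫ s in a..t, B s := by
  have hC0 : 0 ≤ C := (abs_nonneg _).trans (hPC 0)
  set Φ : ℝ → ℝ := fun t ↦ ∫ s in a..t, B s with hΦ
  have hΦlip := lipschitzWith_integral_of_bounded hB hBC a
  have hΦc : Continuous Φ := hΦlip.continuous
  have hint : IntervalIntegrable (fun t ↦ P t - Φ t) volume a b :=
    (intervalIntegrable_of_bounded hP hPC a b).sub (hΦc.intervalIntegrable a b)
  -- The mean value of $P-\Phi$: it makes the primitive of $P-\Phi-\kappa$ vanish at `b`, hence an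
  -- admissible test function.
  set κ : ℝ := (∫ t in a..b, (P t - Φ t)) / (b - a) with hκ
  refine ⟨κ, ?_⟩
  -- Cutting off outside the interval makes `q` bounded on the whole line, so its primitive is
  -- globally Lipschitz as the hypothesis demands.
  set q : ℝ → ℝ := (Ioc a b).indicator fun t ↦ P t - Φ t - κ with hq
  have hqm : Measurable q := ((hP.sub hΦc.measurable).sub measurable_const).indicator
    measurableSet_Ioc
  have hqeq : ∀ t ∈ Ioc a b, q t = P t - Φ t - κ := fun t ht ↦ indicator_of_mem ht _
  set D : ℝ := C + C * (b - a) + |κ| with hD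
  have hΦle : ∀ t ∈ Ioc a b, |Φ t| ≤ C * (b - a) := by
    intro t ht
    have h1 : |Φ t| ≤ C * |t - a| := by
      rw [← Real.norm_eq_abs]
      exact intervalIntegral.norm_integral_le_of_norm_le_const fun u _ ↦ hBC u
    rw [abs_of_pos (sub_pos.2 ht.1)] at h1
    exact h1.trans (mul_le_mul_of_nonneg_left (by linarith [ht.2]) hC0)
  have hqD : ∀ t, |q t| ≤ D := by
    intro t
    by_cases ht : t ∈ Ioc a b
    · rw [hqeq t ht]
      have h1 := abs_sub (P t - Φ t) κ
      have h2 := abs_sub (P t) (Φ t)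
      linarith [hPC t, hΦle t ht]
    · rw [hq, indicator_of_notMem ht, abs_zero]
      have : 0 ≤ C * (b - a) := mul_nonneg hC0 (by linarith)
      positivity
  set h : ℝ → ℝ := fun t ↦ ∫ s in a..t, q s with hh
  have hhlip := lipschitzWith_integral_of_bounded hqm hqD a
  have hqint : ∫ t in a..b, q t = 0 := by
    have : ∫ t in a..b, q t = ∫ t in a..b, (P t - Φ t - κ) := by
      refine intervalIntegral.integral_congr_ae (Eventually.of_forall fun t ht ↦ ?_)
      rw [uIoc_of_le hab.le] at ht
      exact hqeq t ht
    rw [this, intervalIntegral.integral_sub hint intervalIntegrable_const,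
      intervalIntegral.integral_const, hκ, smul_eq_mul, mul_div_cancel₀ _ (by linarith : b - a ≠ 0),
      sub_self]
  have hzero := H h _ hhlip (by simp [hh]) hqint
  have hderiv : ∀ᵐ t, deriv h t = q t :=
    (ae_deriv_integral_of_bounded hqm hqD a).mono fun t ht ↦ ht.deriv
  have hΦderiv : ∀ᵐ t, deriv Φ t = B t :=
    (ae_deriv_integral_of_bounded hB hBC a).mono fun t ht ↦ ht.deriv
  have hhc : Continuous h := hhlip.continuous
  have iq := intervalIntegrable_of_bounded hqm hqD a b
  have ihB : IntervalIntegrable (fun t ↦ h t * B t) volume a b :=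
    (intervalIntegrable_of_bounded hB hBC a b).continuousOn_mul hhc.continuousOn
  have iqP : IntervalIntegrable (fun t ↦ q t * P t) volume a b := by
    refine intervalIntegrable_of_bounded (hqm.mul hP) (C := D * C) (fun t ↦ ?_) a b
    rw [Pi.mul_apply, abs_mul]
    exact mul_le_mul (hqD t) (hPC t) (abs_nonneg _) ((abs_nonneg _).trans (hqD 0))
  have iqΦ : IntervalIntegrable (fun t ↦ q t * Φ t) volume a b :=
    iq.mul_continuousOn hΦc.continuousOn
  -- Integration by parts for absolutely continuous functions; the boundary terms vanish because `h`
  -- does.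
  have h1 : ∫ t in a..b, h t * B t = - ∫ t in a..b, q t * Φ t := by
    have hac1 : AbsolutelyContinuousOnInterval h a b :=
      (hhlip.lipschitzOnWith (s := uIcc a b)).absolutelyContinuousOnInterval
    have hac2 : AbsolutelyContinuousOnInterval Φ a b :=
      (hΦlip.lipschitzOnWith (s := uIcc a b)).absolutelyContinuousOnInterval
    have := hac1.integral_mul_deriv_eq_deriv_mul hac2
    rw [show h b = 0 from hqint, show h a = 0 by simp [hh]] at this
    have e1 : ∫ t in a..b, h t * deriv Φ t = ∫ t in a..b, h t * B t :=
      intervalIntegral.integral_congr_ae (hΦderiv.mono fun t ht _ ↦ by rw [ht])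
    have e2 : ∫ t in a..b, deriv h t * Φ t = ∫ t in a..b, q t * Φ t :=
      intervalIntegral.integral_congr_ae (hderiv.mono fun t ht _ ↦ by rw [ht])
    rw [e1, e2] at this
    simpa using this
  -- With this test function the hypothesis says that $q$ is orthogonal to $P-\Phi$. It is also
  -- orthogonal to constants, hence to itself.
  have h2 : ∫ t in a..b, q t * q t = 0 := by
    have e0 : ∫ t in a..b, (h t * B t + deriv h t * P t) = ∫ t in a..b, (h t * B t + q t * P t) :=
      intervalIntegral.integral_congr_ae (hderiv.mono fun t ht _ ↦ by rw [ht])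
    rw [e0, intervalIntegral.integral_add ihB iqP, h1] at hzero
    have e1 : ∫ t in a..b, q t * q t = ∫ t in a..b, (q t * P t - q t * Φ t - q t * κ) := by
      refine intervalIntegral.integral_congr_ae (Eventually.of_forall fun t ht ↦ ?_)
      rw [uIoc_of_le hab.le] at ht
      nth_rewrite 2 [hqeq t ht]
      ring
    rw [e1, intervalIntegral.integral_sub (iqP.sub iqΦ) (iq.mul_const κ),
      intervalIntegral.integral_sub iqP iqΦ, intervalIntegral.integral_mul_const, hqint]
    linarith
  have h3 : (fun t ↦ q t * q t) =ᵐ[volume.restrict (Ioc a b)] 0 := by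
    refine (intervalIntegral.integral_eq_zero_iff_of_le_of_nonneg_ae hab.le
      (Eventually.of_forall fun t ↦ mul_self_nonneg _) ?_).1 h2
    refine intervalIntegrable_of_bounded (hqm.mul hqm) (C := D * D) (fun t ↦ ?_) a b
    rw [Pi.mul_apply, abs_mul]
    exact mul_le_mul (hqD t) (hqD t) (abs_nonneg _) ((abs_nonneg _).trans (hqD 0))
  rw [Filter.EventuallyEq, ae_restrict_iff' measurableSet_Ioc] at h3
  filter_upwards [h3] with t ht htI
  have h4 := mul_self_eq_zero.1 (ht htI)
  rw [hqeq t htI] at h4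
  linarith

end DuBoisReymond

/-! ### Metrics that are infinitesimally Riemannian -/

section StrictMetric

open Asymptotics

variable {E : Type*} [NormedAddCommGroup E] [NormedSpace ℝ E]
  {X : Type*} [MetricSpace X]

/-- A parametrization `ψ` of (a part of) a metric space by an open subset `U` of a vector space in
which the distance is given infinitesimally by the smooth Riemannian metric `g`. -/
structure IsMetricChart (U : Set E) (g : E → E →L[ℝ] E →L[ℝ] ℝ) (ψ : E → X) : Prop where
  isOpen : IsOpen U
  contDiffOn : ContDiffOn ℝ ∞ g U
  symm : ∀ y v w, g y v w = g y w v
  pos : ∀ y ∈ U, ∀ v, v ≠ 0 → 0 < g y v v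
  strict : ∀ y ∈ U, (fun q : E × E ↦ dist (ψ q.1) (ψ q.2) - √(g y (q.1 - q.2) (q.1 - q.2)))
    =o[𝓝 (y, y)] fun q ↦ q.1 - q.2

/-- Compactness of the unit sphere gives a positive minimum. In dimension zero the sphere is empty
and any constant works. -/
lemma exists_pos_le_bilin [FiniteDimensional ℝ E] (G : E →L[ℝ] E →L[ℝ] ℝ)
    (hG : ∀ v, v ≠ 0 → 0 < G v v) : ∃ l > 0, ∀ v, l * ‖v‖ ≤ √(G v v) := by
  have hc : Continuous fun v ↦ √(G v v) :=
    (G.continuous.clm_apply continuous_id).sqrt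
  rcases (Metric.sphere (0 : E) 1).eq_empty_or_nonempty with h | h
  · refine ⟨1, one_pos, fun v ↦ ?_⟩
    by_cases hv : v = 0
    · simp [hv]
    · have : (‖v‖⁻¹ • v) ∈ Metric.sphere (0 : E) 1 := by simp [norm_smul, hv]
      simp [h] at this
  · obtain ⟨u, hu, hmin⟩ := (isCompact_sphere (0 : E) 1).exists_isMinOn h hc.continuousOn
    have hu0 : u ≠ 0 := by rintro rfl; simp at hu
    refine ⟨√(G u u), Real.sqrt_pos.2 (hG u hu0), fun v ↦ ?_⟩
    by_cases hv : v = 0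
    · simp [hv]
    · have hvn : 0 < ‖v‖ := norm_pos_iff.2 hv
      have h1 : √(G u u) ≤ √(G (‖v‖⁻¹ • v) (‖v‖⁻¹ • v)) :=
        hmin (show (‖v‖⁻¹ • v) ∈ Metric.sphere (0 : E) 1 by simp [norm_smul, hv])
      have h2 : G (‖v‖⁻¹ • v) (‖v‖⁻¹ • v) = (‖v‖⁻¹) ^ 2 * G v v := by
        simp only [map_smul, smul_apply, smul_eq_mul]; ring
      rw [h2, Real.sqrt_mul (by positivity), Real.sqrt_sq (by positivity)] at h1
      calc √(G u u) * ‖v‖ ≤ ‖v‖⁻¹ * √(G v v) * ‖v‖ := by gcongr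
        _ = √(G v v) := by field_simp

set_option synthInstance.maxHeartbeats 100000 in
lemma sqrt_bilin_le (G : E →L[ℝ] E →L[ℝ] ℝ) (v : E) : √(G v v) ≤ √‖G‖ * ‖v‖ := by
  have h1 : G v v ≤ ‖G‖ * ‖v‖ ^ 2 := by
    refine (le_abs_self _).trans ((G.le_opNorm₂ v v).trans (by rw [pow_two, mul_assoc]))
  refine (Real.sqrt_le_sqrt h1).trans (le_of_eq ?_)
  rw [Real.sqrt_mul' _ (sq_nonneg _), Real.sqrt_sq (norm_nonneg v)]

namespace IsMetricChart

variable {U : Set E} {g : E → E →L[ℝ] E →L[ℝ] ℝ} {ψ : E → X}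

set_option synthInstance.maxHeartbeats 100000 in
lemma locallyLipschitzOn (h : IsMetricChart U g ψ) : LocallyLipschitzOn U ψ := by
  intro y hy
  have h1 := (h.strict y hy).bound (show (0 : ℝ) < 1 by norm_num)
  obtain ⟨V, hV, hVs⟩ := mem_nhds_prod_iff.1 h1
  obtain ⟨W, hW, hWs⟩ := hVs
  refine ⟨(√‖g y‖ + 1).toNNReal, V ∩ W, mem_nhdsWithin_of_mem_nhds (inter_mem hV hW), ?_⟩
  refine LipschitzOnWith.of_dist_le_mul fun p hp q hq ↦ ?_
  have h2 : ‖dist (ψ p) (ψ q) - √(g y (p - q) (p - q))‖ ≤ 1 * ‖p - q‖ :=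
    hWs (show (p, q) ∈ V ×ˢ W from ⟨hp.1, hq.2⟩)
  have h3 := sqrt_bilin_le (g y) (p - q)
  rw [Real.norm_eq_abs] at h2
  rw [Real.coe_toNNReal _ (by positivity), dist_eq_norm p q]
  linarith [(abs_le.1 h2).2]

/-- The form at `y` dominates a multiple of the norm, and half of that multiple absorbs the
first-order error. It is used to show that minimizing curves are Lipschitz in coordinates. -/
lemma eventually_norm_sub_le [FiniteDimensional ℝ E] (h : IsMetricChart U g ψ) {y : E}
    (hy : y ∈ U) :
    ∃ C > 0, ∀ᶠ q : E × E in 𝓝 (y, y), ‖q.1 - q.2‖ ≤ C * dist (ψ q.1) (ψ q.2) := by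
  obtain ⟨l, hl, hlv⟩ := exists_pos_le_bilin (g y) (h.pos y hy)
  refine ⟨2 / l, by positivity, ?_⟩
  filter_upwards [(h.strict y hy).bound (show (0 : ℝ) < l / 2 by positivity)] with q hq
  rw [Real.norm_eq_abs] at hq
  have h1 := hlv (q.1 - q.2)
  have h2 := (abs_le.1 hq).1
  rw [div_mul_eq_mul_div, le_div_iff₀ hl]
  nlinarith

/-- The metric derivative of a curve. -/
lemma tendsto_dist_div (h : IsMetricChart U g ψ) {σ : ℝ → E} {v : E} {t : ℝ}
    (hσ : HasDerivAt σ v t) (ht : σ t ∈ U) :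
    Tendsto (fun s ↦ dist (ψ (σ s)) (ψ (σ t)) / |s - t|) (𝓝[≠] t) (𝓝 √(g (σ t) v v)) := by
  set N : E → ℝ := fun v ↦ √(g (σ t) v v) with hN
  have hNc : Continuous N := ((g (σ t)).continuous.clm_apply continuous_id).sqrt
  have hslope : Tendsto (slope σ t) (𝓝[≠] t) (𝓝 v) := hasDerivAt_iff_tendsto_slope.1 hσ
  have h1 : Tendsto (fun s ↦ N (slope σ t s)) (𝓝[≠] t) (𝓝 (N v)) :=
    (hNc.tendsto v).comp hslope
  have h2 : (fun s ↦ dist (ψ (σ s)) (ψ (σ t)) - N (σ s - σ t)) =o[𝓝 t] fun s ↦ s - t := by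
    have hlim : Tendsto (fun s ↦ (σ s, σ t)) (𝓝 t) (𝓝 (σ t, σ t)) :=
      hσ.continuousAt.tendsto.prodMk_nhds tendsto_const_nhds
    exact ((h.strict _ ht).comp_tendsto hlim).trans_isBigO hσ.isBigO_sub
  have h3 : Tendsto (fun s ↦ (dist (ψ (σ s)) (ψ (σ t)) - N (σ s - σ t)) / |s - t|) (𝓝[≠] t)
      (𝓝 0) := by
    have := (h2.mono (nhdsWithin_le_nhds (s := {t}ᶜ))).norm_right.tendsto_div_nhds_zero
    simpa [Real.norm_eq_abs] using this
  have h4 := h3.add h1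
  rw [zero_add] at h4
  refine h4.congr' ?_
  filter_upwards [self_mem_nhdsWithin] with s hs
  have hst : s - t ≠ 0 := sub_ne_zero.2 hs
  have h5 : N (slope σ t s) = N (σ s - σ t) / |s - t| := by
    simp only [hN, slope_def_module, map_smul, smul_apply, smul_eq_mul]
    rw [← mul_assoc, Real.sqrt_mul (mul_self_nonneg _), Real.sqrt_mul_self_eq_abs, abs_inv]
    field_simp
  rw [h5]
  field_simp
  ring

/-- The distance of the end points of a Lipschitz curve is bounded by its energy. -/
lemma two_mul_dist_le_energy [FiniteDimensional ℝ E] (h : IsMetricChart U g ψ) {σ : ℝ → E}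
    {a b : ℝ} (hab : a ≤ b) {K : NNReal} (hσ : LipschitzWith K σ) (hU : ∀ t ∈ Icc a b, σ t ∈ U) {L : NNReal}
    (hL : LipschitzOnWith L (ψ ∘ σ) (Icc a b))
    (hint : IntervalIntegrable (fun t ↦ g (σ t) (deriv σ t) (deriv σ t)) volume a b) :
    2 * dist (ψ (σ a)) (ψ (σ b)) ≤ (b - a) + ∫ t in a..b, g (σ t) (deriv σ t) (deriv σ t) := by
  -- The distance from the starting point is absolutely continuous along the curve, and its
  -- derivative is bounded by the metric derivative.
  set u : ℝ → ℝ := fun t ↦ dist (ψ (σ t)) (ψ (σ a)) with hu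
  have hudist : ∀ s t, |u s - u t| ≤ dist (ψ (σ s)) (ψ (σ t)) := fun s t ↦
    abs_dist_sub_le _ _ _
  have hulip : LipschitzOnWith L u (uIcc a b) := by
    rw [uIcc_of_le hab]
    refine LipschitzOnWith.of_dist_le_mul fun s hs t ht ↦ ?_
    exact (hudist s t).trans (hL.dist_le_mul s hs t ht)
  have hac := hulip.absolutelyContinuousOnInterval
  have hftc := hac.integral_deriv_eq_sub
  have hua : u a = 0 := by simp [hu]
  rw [hua, sub_zero] at hftc
  have hbound : ∀ᵐ t, t ∈ Ioo a b →
      2 * deriv u t ≤ 1 + g (σ t) (deriv σ t) (deriv σ t) := by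
    filter_upwards [hσ.ae_differentiableAt_real] with t hσt ht
    set Q := g (σ t) (deriv σ t) (deriv σ t) with hQ
    have hUt := hU t (Ioo_subset_Icc_self ht)
    have hQ0 : 0 ≤ Q := by
      by_cases hv : deriv σ t = 0
      · simp [hQ, hv]
      · exact (h.pos _ hUt _ hv).le
    -- From $2\sqrt Q\le 1+Q$. Energy is used instead of length because it is differentiable under
    -- variations, and the inequality is sharp at unit speed.
    suffices deriv u t ≤ √Q by nlinarith [Real.sq_sqrt hQ0, sq_nonneg (√Q - 1)]
    by_cases hut : DifferentiableAt ℝ u t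
    · refine le_of_tendsto_of_tendsto (hasDerivAt_iff_tendsto_slope.1 hut.hasDerivAt)
        (h.tendsto_dist_div hσt.hasDerivAt hUt) ?_
      filter_upwards [self_mem_nhdsWithin] with s hs
      rw [slope_def_field]
      refine (le_abs_self _).trans ?_
      rw [abs_div]
      gcongr
      exact hudist s t
    -- The default value `0` of the derivative respects the bound.
    · rw [deriv_zero_of_not_differentiableAt hut]
      exact Real.sqrt_nonneg _
  have hmono : ∫ t in a..b, 2 * deriv u t ≤
      ∫ t in a..b, (1 + g (σ t) (deriv σ t) (deriv σ t)) := by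
    refine intervalIntegral.integral_mono_ae_restrict hab (hac.intervalIntegrable_deriv.const_mul 2)
      (intervalIntegrable_const.add hint) ?_
    rw [Filter.EventuallyLE, ← restrict_Ioo_eq_restrict_Icc, ae_restrict_iff' measurableSet_Ioo]
    exact hbound
  rw [intervalIntegral.integral_const_mul, hftc,
    intervalIntegral.integral_add intervalIntegrable_const hint,
    intervalIntegral.integral_const, smul_eq_mul, mul_one] at hmono
  rwa [dist_comm]

end IsMetricChart

end StrictMetric

/-! ### First variation of the energy -/

section FirstVariation

variable {E : Type*} [NormedAddCommGroup E] [NormedSpace ℝ E]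
  {X : Type*} [MetricSpace X]

lemma exists_norm_le_of_isCompact {Y F : Type*} [TopologicalSpace Y] [NormedAddCommGroup F]
    {s : Set Y} (hs : IsCompact s) {f : Y → F} (hf : ContinuousOn f s) :
    ∃ C, ∀ y ∈ s, ‖f y‖ ≤ C := hs.exists_bound_of_continuousOn hf

lemma norm_clm_apply_le {F : Type*} [NormedAddCommGroup F] [NormedSpace ℝ F] (T : E →L[ℝ] F)
    (v : E) : ‖T v‖ ≤ ‖T‖ * ‖v‖ := T.le_opNorm v

lemma hasDerivAt_comp_of_differentiableAt {F : Type*} [NormedAddCommGroup F] [NormedSpace ℝ F]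
    {f : E → F} {y : ℝ → E} {y' : E} {t : ℝ} (hf : DifferentiableAt ℝ f (y t))
    (hy : HasDerivAt y y' t) : HasDerivAt (fun s ↦ f (y s)) (fderiv ℝ f (y t) y') t :=
  hf.hasFDerivAt.comp_hasDerivAt t hy

lemma continuousOn_clm_apply_apply {F : Type*} [NormedAddCommGroup F] [NormedSpace ℝ F] {s : Set ℝ}
    {T : ℝ → E →L[ℝ] F} {v : ℝ → E} (hT : ContinuousOn T s) (hv : ContinuousOn v s) :
    ContinuousOn (fun t ↦ T t (v t)) s := hT.clm_apply hv

lemma continuous_bilin_apply : Continuous fun p : (E →L[ℝ] E →L[ℝ] ℝ) × E × E ↦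
    p.1 p.2.1 p.2.2 :=
  (continuous_fst.clm_apply continuous_snd.fst).clm_apply continuous_snd.snd

lemma aestronglyMeasurable_bilin {μ : Measure ℝ} {G : ℝ → E →L[ℝ] E →L[ℝ] ℝ} {v w : ℝ → E}
    (hG : AEStronglyMeasurable G μ) (hv : AEStronglyMeasurable v μ)
    (hw : AEStronglyMeasurable w μ) : AEStronglyMeasurable (fun t ↦ G t (v t) (w t)) μ :=
  continuous_bilin_apply.comp_aestronglyMeasurable (hG.prodMk (hv.prodMk hw))

set_option synthInstance.maxHeartbeats 100000 in
lemma abs_bilin_le {G : E →L[ℝ] E →L[ℝ] ℝ} {C D D' : ℝ} {v w : E} (hG : ‖G‖ ≤ C) (hv : ‖v‖ ≤ D)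
    (hw : ‖w‖ ≤ D') : ‖G v w‖ ≤ C * D * D' := by
  have hC : 0 ≤ C := (norm_nonneg G).trans hG
  have hD : 0 ≤ D := (norm_nonneg _).trans hv
  refine (G.le_opNorm₂ v w).trans ?_
  gcongr

variable [FiniteDimensional ℝ E] {U : Set E} {g : E → E →L[ℝ] E →L[ℝ] ℝ} {ψ : E → X}

/-- Where `c` is differentiable, its metric derivative is the norm of the velocity by the metric
chart, and `1` by the isometry property. -/
lemma IsMetricChart.ae_metric_deriv_eq_one (h : IsMetricChart U g ψ) {c : ℝ → E} {a b : ℝ}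
    {K : NNReal} (hc : LipschitzWith K c) (hU : range c ⊆ U)
    (hiso : ∀ s ∈ Icc a b, ∀ t ∈ Icc a b, dist (ψ (c s)) (ψ (c t)) = |s - t|) :
    ∀ᵐ t, t ∈ Ioo a b → g (c t) (deriv c t) (deriv c t) = 1 := by
  filter_upwards [hc.ae_differentiableAt_real] with t hct ht
  have h1 := h.tendsto_dist_div hct.hasDerivAt (hU (mem_range_self t))
  have h2 : Tendsto (fun s ↦ dist (ψ (c s)) (ψ (c t)) / |s - t|) (𝓝[≠] t) (𝓝 1) := by
    refine tendsto_const_nhds.congr' ?_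
    filter_upwards [self_mem_nhdsWithin, mem_nhdsWithin_of_mem_nhds (Ioo_mem_nhds ht.1 ht.2)]
      with s hs hs'
    rw [hiso s (Ioo_subset_Icc_self hs') t (Ioo_subset_Icc_self ht),
      div_self (abs_ne_zero.2 (sub_ne_zero.2 hs))]
  have h3 := tendsto_nhds_unique h1 h2
  rwa [Real.sqrt_eq_one] at h3

set_option maxHeartbeats 1000000 in
set_option synthInstance.maxHeartbeats 200000 in
/-- The first variation of the energy vanishes along minimizing curves. -/
theorem IsMetricChart.integral_first_variation_eq_zero (h : IsMetricChart U g ψ) {c : ℝ → E}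
    {a b : ℝ} (hab : a < b) {K : NNReal} (hc : LipschitzWith K c) (hcpt : IsCompact (range c))
    (hU : range c ⊆ U)
    (hiso : ∀ s ∈ Icc a b, ∀ t ∈ Icc a b, dist (ψ (c s)) (ψ (c t)) = |s - t|) (w : E)
    {η : ℝ → ℝ} {Kη : NNReal} (hη : LipschitzWith Kη η) (ha : η a = 0) (hb : η b = 0) :
    ∫ t in a..b, (η t * fderiv ℝ g (c t) w (deriv c t) (deriv c t) +
      deriv η t * (2 * g (c t) (deriv c t) w)) = 0 := by
  obtain ⟨δ, hδ, hδU⟩ := hcpt.exists_cthickening_subset_open h.isOpen hU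
  set K₁ := Metric.cthickening δ (range c) with hK₁
  have hK₁c : IsCompact K₁ := hcpt.cthickening
  obtain ⟨G, hG⟩ := exists_norm_le_of_isCompact hK₁c (h.contDiffOn.continuousOn.mono hδU)
  obtain ⟨G', hG'⟩ := exists_norm_le_of_isCompact hK₁c
    ((h.contDiffOn.continuousOn_fderiv_of_isOpen h.isOpen (by simp)).mono hδU)
  obtain ⟨C, hC⟩ := (h.locallyLipschitzOn.mono hδU).exists_lipschitzOnWith_of_compact hK₁c
  set D : ℝ := Kη * (b - a) + 1 with hD
  have hba : 0 < b - a := sub_pos.2 hab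
  have hDpos : 0 < D := by positivity
  have hηD : ∀ t ∈ Icc a b, |η t| ≤ D := by
    intro t ht
    have h1 := hη.dist_le_mul t a
    rw [Real.dist_eq, Real.dist_eq, ha, sub_zero, abs_of_nonneg (sub_nonneg.2 ht.1)] at h1
    have h2 : (Kη : ℝ) * (t - a) ≤ Kη * (b - a) :=
      mul_le_mul_of_nonneg_left (by linarith [ht.2]) Kη.2
    linarith
  -- For $|\varepsilon|<\varepsilon_0$ the varied curve stays within $\delta$ of the range of `c`;
  -- the bound by `1` keeps its velocity bounded uniformly in $\varepsilon$. The summands `+ 1` here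
  -- and in `D` only avoid zero denominators.
  set ε₀ : ℝ := min 1 (δ / (D * (‖w‖ + 1))) with hε₀
  have hε₀pos : 0 < ε₀ := by positivity
  set σ : ℝ → ℝ → E := fun ε t ↦ c t + (ε * η t) • w with hσ
  -- The formal velocity of `σ ε`. It equals the derivative almost everywhere by Rademacher, and is
  -- affine in `ε` at every `t`, which differentiation under the integral requires.
  set v : ℝ → ℝ → E := fun ε t ↦ deriv c t + (ε * deriv η t) • w with hv
  have hσK : ∀ ε ∈ Metric.ball (0 : ℝ) ε₀, ∀ t ∈ Icc a b, σ ε t ∈ K₁ := by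
    intro ε hε t ht
    refine Metric.mem_cthickening_of_dist_le _ (c t) δ _ (mem_range_self t) ?_
    rw [mem_ball_zero_iff, Real.norm_eq_abs] at hε
    rw [dist_eq_norm, hσ, add_sub_cancel_left, norm_smul, Real.norm_eq_abs, abs_mul]
    have h1 : |ε| ≤ δ / (D * (‖w‖ + 1)) := (hε.le).trans (min_le_right _ _)
    calc |ε| * |η t| * ‖w‖ ≤ δ / (D * (‖w‖ + 1)) * D * (‖w‖ + 1) := by
          gcongr
          · exact hηD t ht
          · linarith
      _ = δ := by field_simp
  have hσlip : ∀ ε, LipschitzWith (K + ‖ε‖₊ * Kη * ‖w‖₊) (σ ε) := by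
    intro ε
    refine hc.add (LipschitzWith.of_dist_le_mul fun s t ↦ ?_)
    rw [dist_eq_norm, ← sub_smul, ← mul_sub, norm_smul, norm_mul, ← dist_eq_norm]
    have := hη.dist_le_mul s t
    push_cast
    calc ‖ε‖ * dist (η s) (η t) * ‖w‖ ≤ ‖ε‖ * (Kη * dist s t) * ‖w‖ := by gcongr
      _ = _ := by ring
  have hσc : ∀ ε, Continuous (σ ε) := fun ε ↦ (hσlip ε).continuous
  have hvm : ∀ ε, StronglyMeasurable (v ε) := fun ε ↦
    (stronglyMeasurable_deriv c).add (((stronglyMeasurable_deriv η).const_mul ε).smul_const w)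
  have hηw : StronglyMeasurable fun t ↦ deriv η t • w :=
    (stronglyMeasurable_deriv η).smul_const w
  have hcn : ∀ t, ‖deriv c t‖ ≤ K := fun t ↦ norm_deriv_le_of_lipschitz hc
  have hηn : ∀ t, ‖deriv η t‖ ≤ Kη := fun t ↦ norm_deriv_le_of_lipschitz hη
  set W : ℝ := K + Kη * ‖w‖ with hW
  have hvn : ∀ ε ∈ Metric.ball (0 : ℝ) ε₀, ∀ t, ‖v ε t‖ ≤ W := by
    intro ε hε t
    rw [mem_ball_zero_iff] at hε
    refine (norm_add_le _ _).trans (add_le_add (hcn t) ?_)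
    rw [norm_smul, norm_mul]
    have h1 : ‖ε‖ ≤ 1 := hε.le.trans (min_le_left _ _)
    calc ‖ε‖ * ‖deriv η t‖ * ‖w‖ ≤ 1 * Kη * ‖w‖ := by gcongr; exact hηn t
      _ = _ := by ring
  have hηwn : ∀ t, ‖deriv η t • w‖ ≤ Kη * ‖w‖ := fun t ↦ by
    rw [norm_smul]; gcongr; exact hηn t
  have hsub : Set.uIoc a b ⊆ Icc a b := by rw [uIoc_of_le hab.le]; exact Ioc_subset_Icc_self
  have hgσ : ∀ ε ∈ Metric.ball (0 : ℝ) ε₀,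
      AEStronglyMeasurable (fun t ↦ g (σ ε t)) (volume.restrict (Set.uIoc a b)) := fun ε hε ↦
    ((h.contDiffOn.continuousOn.comp (hσc ε).continuousOn
      fun t ht ↦ hδU (hσK ε hε t (hsub ht)))).aestronglyMeasurable measurableSet_uIoc
  have hg'σ : AEStronglyMeasurable (fun t ↦ fderiv ℝ g (σ 0 t) (η t • w))
      (volume.restrict (Set.uIoc a b)) := by
    refine ContinuousOn.aestronglyMeasurable (continuousOn_clm_apply_apply
      (F := E →L[ℝ] E →L[ℝ] ℝ) ?_ ?_) measurableSet_uIoc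
    · exact (h.contDiffOn.continuousOn_fderiv_of_isOpen h.isOpen (by simp)).comp
        (hσc 0).continuousOn
        fun t ht ↦ hδU (hσK 0 (Metric.mem_ball_self hε₀pos) t (hsub ht))
    · exact (hη.continuous.smul continuous_const).continuousOn
  set F : ℝ → ℝ → ℝ := fun ε t ↦ g (σ ε t) (v ε t) (v ε t) with hF
  set F' : ℝ → ℝ → ℝ := fun ε t ↦ fderiv ℝ g (σ ε t) (η t • w) (v ε t) (v ε t) +
    g (σ ε t) (deriv η t • w) (v ε t) + g (σ ε t) (v ε t) (deriv η t • w) with hF'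
  have hFm : ∀ ε ∈ Metric.ball (0 : ℝ) ε₀,
      AEStronglyMeasurable (F ε) (volume.restrict (Set.uIoc a b)) := fun ε hε ↦
    aestronglyMeasurable_bilin (hgσ ε hε) (hvm ε).aestronglyMeasurable (hvm ε).aestronglyMeasurable
  have hFint : ∀ ε ∈ Metric.ball (0 : ℝ) ε₀, IntervalIntegrable (F ε) volume a b := by
    intro ε hε
    refine (intervalIntegrable_const (c := G * W * W)).mono_fun' (hFm ε hε) ?_
    rw [Filter.EventuallyLE, ae_restrict_iff' measurableSet_uIoc]
    refine Eventually.of_forall fun t ht ↦ ?_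
    exact abs_bilin_le (G := g (σ ε t)) (hG _ (hσK ε hε t (hsub ht))) (hvn ε hε t) (hvn ε hε t)
  have hball : Metric.ball (0 : ℝ) ε₀ ∈ 𝓝 (0 : ℝ) := Metric.ball_mem_nhds _ hε₀pos
  have h0 : (0 : ℝ) ∈ Metric.ball (0 : ℝ) ε₀ := Metric.mem_ball_self hε₀pos
  have hder : HasDerivAt (fun ε ↦ ∫ t in a..b, F ε t) (∫ t in a..b, F' 0 t) 0 := by
    refine (intervalIntegral.hasDerivAt_integral_of_dominated_loc_of_deriv_le
      (bound := fun _ ↦ (G' * (D * ‖w‖)) * W * W + G * (Kη * ‖w‖) * W + G * W * (Kη * ‖w‖))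
      hball ?_ (hFint 0 h0) ?_ ?_ intervalIntegrable_const ?_).2
    · filter_upwards [hball] with ε hε using hFm ε hε
    · exact ((aestronglyMeasurable_bilin hg'σ (hvm 0).aestronglyMeasurable
        (hvm 0).aestronglyMeasurable).add (aestronglyMeasurable_bilin (hgσ 0 h0)
        hηw.aestronglyMeasurable (hvm 0).aestronglyMeasurable)).add
        (aestronglyMeasurable_bilin (hgσ 0 h0) (hvm 0).aestronglyMeasurable
          hηw.aestronglyMeasurable)
    · refine Eventually.of_forall fun t ht ε hε ↦ ?_
      have hσt := hσK ε hε t (hsub ht)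
      refine (norm_add₃_le).trans (add_le_add (add_le_add ?_ ?_) ?_)
      · refine abs_bilin_le ?_ (hvn ε hε t) (hvn ε hε t)
        refine (norm_clm_apply_le (F := E →L[ℝ] E →L[ℝ] ℝ) (fderiv ℝ g (σ ε t)) _).trans ?_
        have h1 := hG' _ hσt
        have h2 : ‖η t • w‖ ≤ D * ‖w‖ := by
          rw [norm_smul]
          exact mul_le_mul_of_nonneg_right (hηD t (hsub ht)) (norm_nonneg w)
        exact mul_le_mul h1 h2 (norm_nonneg _) ((norm_nonneg _).trans h1)
      · exact abs_bilin_le (G := g (σ ε t)) (hG _ hσt) (hηwn t) (hvn ε hε t)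
      · exact abs_bilin_le (G := g (σ ε t)) (hG _ hσt) (hvn ε hε t) (hηwn t)
    · refine Eventually.of_forall fun t ht ε hε ↦ ?_
      have hσt := hδU (hσK ε hε t (hsub ht))
      have hgd : DifferentiableAt ℝ g (σ ε t) :=
        (h.contDiffOn.contDiffAt (h.isOpen.mem_nhds hσt)).differentiableAt (by simp)
      have hlin : ∀ (z : E) (r : ℝ), HasDerivAt (fun ε : ℝ ↦ z + (ε * r) • w) (r • w) ε := by
        intro z r
        simpa using (((hasDerivAt_id ε).mul_const r).smul_const w).const_add z
      have hσd : HasDerivAt (fun ε ↦ σ ε t) (η t • w) ε := hlin (c t) (η t)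
      have hvd : HasDerivAt (fun ε ↦ v ε t) (deriv η t • w) ε := hlin _ _
      have h1 : HasDerivAt (fun ε ↦ g (σ ε t)) (fderiv ℝ g (σ ε t) (η t • w)) ε :=
        hasDerivAt_comp_of_differentiableAt (F := E →L[ℝ] E →L[ℝ] ℝ) (f := g) hgd hσd
      exact (h1.clm_apply hvd).clm_apply hvd
  have hendpt : ∀ ε, σ ε a = c a ∧ σ ε b = c b := fun ε ↦ by simp [hσ, ha, hb]
  -- The variation fixes the end points, at distance `b - a`, so the energy inequality reads
  -- $2(b-a)\le(b-a)+E(\varepsilon)$.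
  have hlow : ∀ ε ∈ Metric.ball (0 : ℝ) ε₀, b - a ≤ ∫ t in a..b, F ε t := by
    intro ε hε
    have hae : ∀ᵐ t, deriv (σ ε) t = v ε t := by
      filter_upwards [hc.ae_differentiableAt_real, hη.ae_differentiableAt_real] with t h1 h2
      exact (h1.hasDerivAt.add ((h2.hasDerivAt.const_mul ε).smul_const w)).deriv
    have hae' : ∀ᵐ t, t ∈ Set.uIoc a b → g (σ ε t) (deriv (σ ε) t) (deriv (σ ε) t) = F ε t :=
      hae.mono fun t ht _ ↦ by rw [ht]
    have hLip : LipschitzOnWith (C * (K + ‖ε‖₊ * Kη * ‖w‖₊)) (ψ ∘ σ ε) (Icc a b) :=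
      hC.comp (hσlip ε).lipschitzOnWith (fun t ht ↦ hσK ε hε t ht)
    have h1 := h.two_mul_dist_le_energy hab.le (hσlip ε) (fun t ht ↦ hδU (hσK ε hε t ht)) hLip
      ((hFint ε hε).congr_ae ((ae_restrict_iff' measurableSet_uIoc).2
        (hae'.mono fun t ht ht' ↦ (ht ht').symm)))
    rw [intervalIntegral.integral_congr_ae hae', (hendpt ε).1, (hendpt ε).2,
      hiso a (left_mem_Icc.2 hab.le) b (right_mem_Icc.2 hab.le), abs_sub_comm,
      abs_of_pos hba] at h1
    linarith
  -- Unit speed makes the lower bound an equality at $\varepsilon=0$, which is therefore a minimum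
  -- of the energy.
  have hF0 : ∫ t in a..b, F 0 t = b - a := by
    have h1 := h.ae_metric_deriv_eq_one hc hU hiso
    have h2 : ∀ᵐ t, t ≠ b := by simp [ae_iff, measure_singleton]
    have h3 : ∫ t in a..b, F 0 t = ∫ t in a..b, (1 : ℝ) := by
      refine intervalIntegral.integral_congr_ae ?_
      filter_upwards [h1, h2] with t ht htb ht'
      rw [uIoc_of_le hab.le] at ht'
      have := ht ⟨ht'.1, lt_of_le_of_ne ht'.2 htb⟩
      simpa [hF, hσ, hv] using this
    rw [h3, intervalIntegral.integral_const, smul_eq_mul, mul_one]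
  have hmin : IsLocalMin (fun ε ↦ ∫ t in a..b, F ε t) 0 := by
    filter_upwards [hball] with ε hε
    rw [hF0]
    exact hlow ε hε
  have hzero := hmin.hasDerivAt_eq_zero hder
  rw [← hzero]
  refine intervalIntegral.integral_congr fun t _ ↦ ?_
  simp only [hF', hσ, hv, zero_mul, zero_smul, add_zero, map_smul, smul_apply, smul_eq_mul]
  rw [h.symm (c t) w (deriv c t)]
  ring

end FirstVariation

/-! ### Regularity of minimizing curves -/

section GeodesicRegularity

variable {E : Type*} [NormedAddCommGroup E] [NormedSpace ℝ E] [FiniteDimensional ℝ E]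

lemma contDiffOn_inverse_apply {F : Type*} [NormedAddCommGroup F] [NormedSpace ℝ F] {s : Set ℝ}
    {A : ℝ → E →L[ℝ] F} {p : ℝ → F} {n : WithTop ℕ∞} (hA : ContDiffOn ℝ n A s)
    (hp : ContDiffOn ℝ n p s) (hinv : ∀ t ∈ s, (A t).IsInvertible) :
    ContDiffOn ℝ n (fun t ↦ (A t).inverse (p t)) s := by
  have := FiniteDimensional.complete ℝ E
  exact ContDiffOn.clm_apply (fun t ht ↦
    ((hinv t ht).contDiffAt_map_inverse (n := n)).comp_contDiffWithinAt t (hA t ht)) hp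

/-- Positivity gives injectivity, and a finite-dimensional space and its dual have equal dimension.
-/
lemma isInvertible_of_pos (G : E →L[ℝ] E →L[ℝ] ℝ) (hG : ∀ v, v ≠ 0 → 0 < G v v) :
    G.IsInvertible := by
  have hinj : Function.Injective (G : E →ₗ[ℝ] E →L[ℝ] ℝ) := by
    rw [injective_iff_map_eq_zero]
    intro v hv
    by_contra h
    have h1 := hG v h
    have h2 : G v = 0 := hv
    rw [h2] at h1
    simp at h1
  have hrank : Module.finrank ℝ E = Module.finrank ℝ (E →L[ℝ] ℝ) := by
    rw [← (LinearMap.toContinuousLinearMap (𝕜 := ℝ) (E := E) (F' := ℝ)).finrank_eq]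
    exact (Subspace.dual_finrank_eq).symm
  let e := (LinearEquiv.ofInjectiveOfFinrankEq (G : E →ₗ[ℝ] E →L[ℝ] ℝ) hinj
    hrank).toContinuousLinearEquiv
  exact ⟨e, by ext v w; rfl⟩

lemma contDiffOn_one_of_hasDerivAt {F : Type*} [NormedAddCommGroup F] [NormedSpace ℝ F]
    {f f' : ℝ → F} {s : Set ℝ} (hs : IsOpen s) (hf : ∀ t ∈ s, HasDerivAt f (f' t) t)
    (hf' : ContinuousOn f' s) : ContDiffOn ℝ 1 f s := by
  rw [show (1 : WithTop ℕ∞) = 0 + 1 from rfl, contDiffOn_succ_iff_deriv_of_isOpen hs]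
  refine ⟨fun t ht ↦ (hf t ht).differentiableAt.differentiableWithinAt, by simp, ?_⟩
  rw [contDiffOn_zero]
  exact hf'.congr fun t ht ↦ (hf t ht).deriv

/-- A Lipschitz curve whose derivative is almost everywhere equal to a continuous function is
continuously differentiable. -/
lemma hasDerivAt_of_ae_deriv_eq {c w : ℝ → E} {a b : ℝ} {K : NNReal}
    (hc : LipschitzWith K c) (hw : Continuous w)
    (hae : ∀ᵐ t, t ∈ Ioc a b → deriv c t = w t) :
    ∀ t ∈ Ioo a b, HasDerivAt c (w t) t := by
  have := FiniteDimensional.complete ℝ E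
  intro t ht
  have hab : a < b := ht.1.trans ht.2
  have hwd : ∀ t, HasDerivAt (fun t ↦ ∫ s in a..t, w s) (w t) t := fun t ↦
    intervalIntegral.integral_hasDerivAt_right (hw.intervalIntegrable _ _)
      (hw.stronglyMeasurableAtFilter _ _) hw.continuousAt
  have hac1 : AbsolutelyContinuousOnInterval c a b :=
    (hc.lipschitzOnWith (s := uIcc a b)).absolutelyContinuousOnInterval
  have hac2 : AbsolutelyContinuousOnInterval (fun t ↦ ∫ s in a..t, w s) a b :=
    ContDiffOn.absolutelyContinuousOnInterval
      (contDiff_one_iff_deriv.2 ⟨fun t ↦ (hwd t).differentiableAt, by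
        rw [show deriv (fun t ↦ ∫ s in a..t, w s) = w from funext fun t ↦ (hwd t).deriv]
        exact hw⟩).contDiffOn
  have hae2 : ∀ᵐ t, t ≠ a := by simp [ae_iff, measure_singleton]
  -- `c` and the primitive of `w` are both absolutely continuous with equal derivatives almost
  -- everywhere, so they differ by a constant.
  obtain ⟨C, hC⟩ := (hac1.sub hac2).const_of_ae_hasDerivAt_zero (by
    filter_upwards [hae, hae2, hc.ae_differentiableAt_real] with s h1 h2 h3 h4
    rw [uIcc_of_le hab.le] at h4
    have h5 := h3.hasDerivAt.sub (hwd s)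
    rwa [h1 ⟨lt_of_le_of_ne h4.1 (Ne.symm h2), h4.2⟩, sub_self] at h5)
  have heq : c =ᶠ[𝓝 t] fun s ↦ C + ∫ r in a..s, w r := by
    filter_upwards [Ioo_mem_nhds ht.1 ht.2] with s hs
    have := hC s (by rw [uIcc_of_le hab.le]; exact Ioo_subset_Icc_self hs)
    rw [Pi.sub_apply, sub_eq_iff_eq_add] at this
    exact this
  exact ((hwd t).const_add C).congr_of_eventuallyEq heq

variable {X : Type*} [MetricSpace X] {U : Set E} {g : E → E →L[ℝ] E →L[ℝ] ℝ} {ψ : E → X}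

set_option maxHeartbeats 1000000 in
set_option synthInstance.maxHeartbeats 200000 in
/-- Minimizing curves are twice continuously differentiable and satisfy the geodesic equation. -/
theorem IsMetricChart.geodesic_of_minimizing (h : IsMetricChart U g ψ) {c : ℝ → E}
    {a b : ℝ} (hab : a < b) {K : NNReal} (hc : LipschitzWith K c) (hcpt : IsCompact (range c))
    (hU : range c ⊆ U)
    (hiso : ∀ s ∈ Icc a b, ∀ t ∈ Icc a b, dist (ψ (c s)) (ψ (c t)) = |s - t|) :
    ContDiffOn ℝ 2 c (Ioo a b) ∧ ∀ t ∈ Ioo a b, ∀ w,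
      2 * (g (c t) (deriv (deriv c) t) w + fderiv ℝ g (c t) (deriv c t) (deriv c t) w) =
        fderiv ℝ g (c t) w (deriv c t) (deriv c t) := by
  have hcU : ∀ t, c t ∈ U := fun t ↦ hU (mem_range_self t)
  have hgc : Continuous fun t ↦ g (c t) :=
    h.contDiffOn.continuousOn.comp_continuous hc.continuous hcU
  obtain ⟨G, hG⟩ := exists_norm_le_of_isCompact hcpt (h.contDiffOn.continuousOn.mono hU)
  obtain ⟨G', hG'⟩ := exists_norm_le_of_isCompact hcpt
    ((h.contDiffOn.continuousOn_fderiv_of_isOpen h.isOpen (by simp)).mono hU)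
  have hcn : ∀ t, ‖deriv c t‖ ≤ K := fun t ↦ norm_deriv_le_of_lipschitz hc
  have hdm : StronglyMeasurable (deriv c) := stronglyMeasurable_deriv c
  have hbil : ∀ {A : ℝ → E →L[ℝ] E →L[ℝ] ℝ} {u v : ℝ → E}, Continuous A → StronglyMeasurable u →
      StronglyMeasurable v → Measurable fun t ↦ A t (u t) (v t) := fun hA hu hv ↦
    (continuous_bilin_apply.comp_stronglyMeasurable
      (hA.stronglyMeasurable.prodMk (hu.prodMk hv))).measurable
  have hgdw : ∀ w, Continuous fun t ↦ fderiv ℝ g (c t) w := fun w ↦ by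
    rw [← continuousOn_univ]
    exact continuousOn_clm_apply_apply (F := E →L[ℝ] E →L[ℝ] ℝ)
      ((h.contDiffOn.continuousOn_fderiv_of_isOpen h.isOpen (by simp)).comp_continuous
        hc.continuous hcU).continuousOn continuousOn_const
  set B : E → ℝ → ℝ := fun w t ↦ fderiv ℝ g (c t) w (deriv c t) (deriv c t) with hB
  set P : E → ℝ → ℝ := fun w t ↦ 2 * g (c t) (deriv c t) w with hP
  have hBm : ∀ w, Measurable (B w) := fun w ↦ hbil (hgdw w) hdm hdm
  have hPm : ∀ w, Measurable (P w) := fun w ↦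
    (hbil hgc hdm stronglyMeasurable_const).const_mul 2
  have hBP : ∀ w, ∃ C, (∀ t, |P w t| ≤ C) ∧ ∀ t, |B w t| ≤ C := by
    intro w
    refine ⟨max (2 * (G * K * ‖w‖)) (G' * ‖w‖ * K * K), fun t ↦ ?_, fun t ↦ ?_⟩
    · refine le_trans ?_ (le_max_left _ _)
      rw [hP, ← Real.norm_eq_abs, norm_mul, Real.norm_two]
      exact mul_le_mul_of_nonneg_left
        (abs_bilin_le (G := g (c t)) (hG _ (mem_range_self t)) (hcn t) le_rfl) zero_le_two
    · refine le_trans ?_ (le_max_right _ _)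
      rw [hB, ← Real.norm_eq_abs]
      refine abs_bilin_le (G := fderiv ℝ g (c t) w) ?_ (hcn t) (hcn t)
      exact (norm_clm_apply_le (F := E →L[ℝ] E →L[ℝ] ℝ) _ _).trans
        (mul_le_mul_of_nonneg_right (hG' _ (mem_range_self t)) (norm_nonneg w))
  -- The first variation formula is the hypothesis of the du Bois-Reymond lemma: the momentum
  -- $2g(c',w)$ agrees almost everywhere with a primitive of the force term.
  have hDR : ∀ w, ∃ κ, ∀ᵐ t, t ∈ Ioc a b → P w t = κ + ∫ s in a..t, B w s := by
    intro w
    obtain ⟨C, hPC, hBC⟩ := hBP w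
    exact ae_eq_const_add_integral_of_forall_integral_eq_zero hab (hPm w) (hBm w) hPC hBC
      fun η Kη hη ha hb ↦ h.integral_first_variation_eq_zero hab hc hcpt hU hiso w hη ha hb
  choose κ hκ using hDR
  set b₀ := Module.finBasis ℝ E with hb₀
  set coord : Fin (Module.finrank ℝ E) → E →L[ℝ] ℝ := fun i ↦
    LinearMap.toContinuousLinearMap (b₀.coord i) with hcoord
  have hcoordb : ∀ i j, coord i (b₀ j) = if j = i then 1 else 0 := by
    intro i j
    simp [hcoord, Finsupp.single_apply]
  -- The continuous representatives of the momentum components $g(c',b_i)$; the factor `2` in `P` is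
  -- divided out.
  set Φ : Fin (Module.finrank ℝ E) → ℝ → ℝ := fun i t ↦
    (κ (b₀ i) + ∫ s in a..t, B (b₀ i) s) / 2 with hΦ
  set p : ℝ → E →L[ℝ] ℝ := fun t ↦ ∑ i, Φ i t • coord i with hp
  have hpb : ∀ t j, p t (b₀ j) = Φ j t := by
    intro t j
    simp [hp, hcoordb]
  have hΦc : ∀ i, Continuous (Φ i) := by
    intro i
    obtain ⟨C, -, hBC⟩ := hBP (b₀ i)
    exact (continuous_const.add
      (lipschitzWith_integral_of_bounded (hBm (b₀ i)) hBC a).continuous).div_const 2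
  have hpc : Continuous p :=
    continuous_finsetSum _ fun i _ ↦ (hΦc i).smul continuous_const
  have hinv : ∀ t, (g (c t)).IsInvertible := fun t ↦ isInvertible_of_pos _ (h.pos _ (hcU t))
  -- The velocity recovered from the continuous momentum by inverting the metric. As it is
  -- continuous and equals $c'$ almost everywhere, the curve is $C^1$.
  set w : ℝ → E := fun t ↦ (g (c t)).inverse (p t) with hw
  have hgw : ∀ t, g (c t) (w t) = p t := fun t ↦ ((hinv t).inverse_apply_eq.1 rfl).symm
  have hwc : Continuous w := by
    rw [← continuousOn_univ, ← contDiffOn_zero (𝕜 := ℝ)]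
    exact contDiffOn_inverse_apply (F := E →L[ℝ] ℝ) (contDiffOn_zero.2 hgc.continuousOn)
      (contDiffOn_zero.2 hpc.continuousOn) fun t _ ↦ hinv t
  have hderw : ∀ᵐ t, t ∈ Ioc a b → deriv c t = w t := by
    have h1 : ∀ᵐ t, ∀ i, t ∈ Ioc a b → P (b₀ i) t = κ (b₀ i) + ∫ s in a..t, B (b₀ i) s :=
      ae_all_iff.2 fun i ↦ hκ (b₀ i)
    filter_upwards [h1] with t ht htI
    refine ((hinv t).inverse_apply_eq.2 ?_).symm
    refine ContinuousLinearMap.coe_injective (b₀.ext fun i ↦ ?_)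
    have h2 := ht i htI
    have h3 : p t (b₀ i) = g (c t) (deriv c t) (b₀ i) := by
      rw [hpb, hΦ]
      simp only
      rw [← h2, hP]
      simp
    exact h3
  have hcd : ∀ t ∈ Ioo a b, HasDerivAt c (w t) t := hasDerivAt_of_ae_deriv_eq hc hwc hderw
  have hderiv : ∀ t ∈ Ioo a b, deriv c t = w t := fun t ht ↦ (hcd t ht).deriv
  have hderc : ContinuousOn (deriv c) (Ioo a b) := hwc.continuousOn.congr hderiv
  -- Bootstrap: now that $c'$ is continuous, so is the force term. Hence the momentum is $C^1$, then
  -- the velocity is $C^1$, and the curve is $C^2$.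
  have hBc : ∀ v, ContinuousOn (B v) (Ioo a b) := fun v ↦
    continuous_bilin_apply.comp_continuousOn
      ((hgdw v).continuousOn.prodMk (hderc.prodMk hderc))
  have hΦd : ∀ i, ∀ t ∈ Ioo a b, HasDerivAt (Φ i) (B (b₀ i) t / 2) t := by
    intro i t ht
    obtain ⟨C, -, hBC⟩ := hBP (b₀ i)
    have h1 := intervalIntegral.integral_hasDerivAt_right
      (intervalIntegrable_of_bounded (hBm (b₀ i)) hBC a t)
      ((hBm (b₀ i)).stronglyMeasurable.stronglyMeasurableAtFilter)
      ((hBc (b₀ i)).continuousAt (Ioo_mem_nhds ht.1 ht.2))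
    exact (h1.const_add _).div_const 2
  have hc1 : ContDiffOn ℝ 1 c (Ioo a b) :=
    contDiffOn_one_of_hasDerivAt isOpen_Ioo hcd hwc.continuousOn
  have hp1 : ContDiffOn ℝ 1 p (Ioo a b) := by
    refine ContDiffOn.sum fun i _ ↦ ContDiffOn.fun_smul ?_ contDiffOn_const
    exact contDiffOn_one_of_hasDerivAt isOpen_Ioo (hΦd i) ((hBc (b₀ i)).div_const 2)
  have hgc1 : ContDiffOn ℝ 1 (fun t ↦ g (c t)) (Ioo a b) :=
    (h.contDiffOn.of_le (by simp)).comp hc1 fun t _ ↦ hcU t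
  have hw1 : ContDiffOn ℝ 1 w (Ioo a b) :=
    contDiffOn_inverse_apply (F := E →L[ℝ] ℝ) hgc1 hp1 fun t _ ↦ hinv t
  have hdc1 : ContDiffOn ℝ 1 (deriv c) (Ioo a b) := hw1.congr hderiv
  refine ⟨?_, fun t ht v ↦ ?_⟩
  · rw [show (2 : WithTop ℕ∞) = 1 + 1 from (one_add_one_eq_two).symm,
      contDiffOn_succ_iff_deriv_of_isOpen isOpen_Ioo]
    exact ⟨fun t ht ↦ (hcd t ht).differentiableAt.differentiableWithinAt, by simp, hdc1⟩
  · have hddc : HasDerivAt (deriv c) (deriv (deriv c) t) t :=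
      ((hdc1.contDiffAt (Ioo_mem_nhds ht.1 ht.2)).differentiableAt one_ne_zero).hasDerivAt
    have hdc : HasDerivAt c (deriv c t) t := by rw [hderiv t ht]; exact hcd t ht
    have hdg : HasDerivAt (fun s ↦ g (c s)) (fderiv ℝ g (c t) (deriv c t)) t :=
      hasDerivAt_comp_of_differentiableAt (F := E →L[ℝ] E →L[ℝ] ℝ) (f := g)
        ((h.contDiffOn.contDiffAt (h.isOpen.mem_nhds (hcU t))).differentiableAt (by simp)) hdc
    -- The Euler–Lagrange equation on basis vectors, by computing the derivative of the momentum
    -- once with the product rule and once as that of a primitive.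
    have hbasis : ∀ i, 2 * (g (c t) (deriv (deriv c) t) (b₀ i) +
        fderiv ℝ g (c t) (deriv c t) (deriv c t) (b₀ i)) = B (b₀ i) t := by
      intro i
      have h1 : HasDerivAt (fun s ↦ g (c s) (deriv c s) (b₀ i))
          ((fderiv ℝ g (c t) (deriv c t)) (deriv c t) (b₀ i) +
            g (c t) (deriv (deriv c) t) (b₀ i)) t := by
        have := (hdg.clm_apply hddc).clm_apply (hasDerivAt_const t (b₀ i))
        simpa using this
      have h2 : (fun s ↦ g (c s) (deriv c s) (b₀ i)) =ᶠ[𝓝 t] Φ i := by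
        filter_upwards [Ioo_mem_nhds ht.1 ht.2] with s hs
        rw [hderiv s hs, hgw, hpb]
      have h3 := (h1.congr_of_eventuallyEq h2.symm).unique (hΦd i t ht)
      rw [add_comm, h3]
      ring
    have hv := (b₀.sum_repr v).symm
    have e1 : 2 * (g (c t) (deriv (deriv c) t) v + fderiv ℝ g (c t) (deriv c t) (deriv c t) v) =
        ∑ i, b₀.repr v i * (2 * (g (c t) (deriv (deriv c) t) (b₀ i) +
        fderiv ℝ g (c t) (deriv c t) (deriv c t) (b₀ i))) := by
      conv_lhs => rw [hv]
      simp only [map_sum, map_smul, smul_eq_mul]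
      rw [← Finset.sum_add_distrib, Finset.mul_sum]
      exact Finset.sum_congr rfl fun i _ ↦ by ring
    have e2 : fderiv ℝ g (c t) v (deriv c t) (deriv c t) = ∑ i, b₀.repr v i * B (b₀ i) t := by
      conv_lhs => rw [hv]
      simp only [map_sum, map_smul, sum_apply, smul_apply, smul_eq_mul, hB]
    rw [e1, e2]
    simp only [hbasis]

end GeodesicRegularity

/-! ### The Riemannian distance and its first-order expansion in charts -/

section ManifoldDistance

open Manifold

lemma eventually_norm_sub_lt_of_continuousAt {Y F : Type*} [TopologicalSpace Y]
    [NormedAddCommGroup F] {f : Y → F} {y₀ : Y} (hf : ContinuousAt f y₀) {ε : ℝ} (hε : 0 < ε) :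
    ∀ᶠ y in 𝓝 y₀, ‖f y - f y₀‖ < ε := by
  simpa [dist_eq_norm] using Metric.tendsto_nhds.1 hf ε hε

section Construction

variable {m : ℕ} {M : Type*} [TopologicalSpace M] [ChartedSpace (EuclideanSpace ℝ (Fin m)) M]
  [IsManifold (𝓡 m) ∞ M] [RiemannianBundle (fun x : M ↦ TangentSpace (𝓡 m) x)]
  [IsContMDiffRiemannianBundle (𝓡 m) ∞ (EuclideanSpace ℝ (Fin m))
    (fun x : M ↦ TangentSpace (𝓡 m) x)]

lemma isContinuousRiemannianBundle_tangent : IsContinuousRiemannianBundle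
    (EuclideanSpace ℝ (Fin m)) (fun x : M ↦ TangentSpace (𝓡 m) x) := by
  obtain ⟨g, hg, h⟩ := IsContMDiffRiemannianBundle.exists_contMDiff (IB := 𝓡 m) (n := ∞)
    (F := EuclideanSpace ℝ (Fin m)) (E := fun x : M ↦ TangentSpace (𝓡 m) x)
  exact ⟨g, hg.continuous, h⟩

variable (m M) in
/-- A connected Riemannian manifold is a metric space for the Riemannian distance. -/
theorem exists_metricSpace_isRiemannianManifold [T2Space M] [ConnectedSpace M] :
    ∃ d : MetricSpace M, d.toUniformSpace.toTopologicalSpace = ‹TopologicalSpace M› ∧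
      ∀ x y : M, edist x y = riemannianEDist (𝓡 m) x y := by
  have : LocallyCompactSpace M := ChartedSpace.locallyCompactSpace (EuclideanSpace ℝ (Fin m)) M
  have : IsContinuousRiemannianBundle
    (EuclideanSpace ℝ (Fin m)) (fun x : M ↦ TangentSpace (𝓡 m) x) :=
    isContinuousRiemannianBundle_tangent
  have : IsManifold (𝓡 m) 1 M := IsManifold.of_le (n := ∞) (by simp)
  let d : EMetricSpace M := EMetricSpace.ofRiemannianMetric (𝓡 m) M
  have hfin : ∀ x y : M, edist x y ≠ ⊤ := by
    intro x y
    -- The points at finite distance from `x` form a clopen set, which is everything by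
    -- connectedness.
    have h1 : IsClopen (Metric.eball x ⊤) := ⟨Metric.isClosed_eball_top, Metric.isOpen_eball⟩
    have h2 : Metric.eball x ⊤ = univ := h1.eq_univ ⟨x, Metric.mem_eball_self ENNReal.zero_lt_top⟩
    have h3 : y ∈ Metric.eball x ⊤ := h2 ▸ mem_univ y
    rw [edist_comm]
    exact h3.ne
  exact ⟨EMetricSpace.toMetricSpace hfin, rfl, fun x y ↦ rfl⟩

end Construction

variable {m : ℕ} {M : Type*} [MetricSpace M] [ChartedSpace (EuclideanSpace ℝ (Fin m)) M]
  [IsManifold (𝓡 m) ∞ M] [RiemannianBundle (fun x : M ↦ TangentSpace (𝓡 m) x)]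

local notation "𝔼" => EuclideanSpace ℝ (Fin m)

omit [IsManifold (𝓡 m) ∞ M] in
lemma edist_le_pathELength [IsRiemannianManifold (𝓡 m) M] {γ : ℝ → M} {a b : ℝ}
    (hγ : ContMDiffOn 𝓘(ℝ, ℝ) (𝓡 m) 1 γ (Icc a b)) {s t : ℝ} (has : a ≤ s) (hst : s ≤ t)
    (htb : t ≤ b) : edist (γ s) (γ t) ≤ pathELength (𝓡 m) γ s t := by
  rw [IsRiemannianManifold.out (I := 𝓡 m)]
  exact riemannianEDist_le_pathELength (hγ.mono (Icc_subset_Icc has htb)) rfl rfl hst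

omit [IsManifold (𝓡 m) ∞ M] in
variable (m M) in
-- Take a path of length less than `r + s`. By connectedness it either meets the intersection of the
-- balls around the end points or has a point outside both. In the latter case the two parts of the
-- path have lengths at least `r` and `s`.
lemma hasIntermediatePoints [IsRiemannianManifold (𝓡 m) M] : HasIntermediatePoints M := by
  intro x y r s hr hs h
  have h1 : riemannianEDist (𝓡 m) x y < ENNReal.ofReal r + ENNReal.ofReal s := by
    rw [← IsRiemannianManifold.out (I := 𝓡 m), edist_dist, ← ENNReal.ofReal_add hr.le hs.le]
    exact (ENNReal.ofReal_lt_ofReal_iff (by positivity)).2 h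
  obtain ⟨γ, h0, h1, hγ, hL⟩ := exists_lt_of_riemannianEDist_lt h1
  have hc : ContinuousOn γ (Icc 0 1) := hγ.continuousOn
  have hpre := isPreconnected_Icc (a := (0 : ℝ)) (b := 1) |>.image γ hc
  have key := hpre (Metric.ball x r) (Metric.ball y s) Metric.isOpen_ball Metric.isOpen_ball ?_
    ⟨x, ⟨0, by simp, h0⟩, Metric.mem_ball_self hr⟩ ⟨y, ⟨1, by simp, h1⟩, Metric.mem_ball_self hs⟩
  · obtain ⟨z, -, hz1, hz2⟩ := key
    exact ⟨z, by rwa [dist_comm], hz2⟩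
  · rintro - ⟨t, ht, rfl⟩
    by_contra hn
    simp only [mem_union, Metric.mem_ball, not_or, not_lt] at hn
    have e1 := edist_le_pathELength hγ le_rfl ht.1 ht.2
    have e2 := edist_le_pathELength hγ ht.1 ht.2 le_rfl
    rw [h0, edist_comm, edist_dist] at e1
    rw [h1, edist_dist] at e2
    have e3 := pathELength_add (I := 𝓡 m) (γ := γ) ht.1 ht.2
    refine absurd hL (not_lt.2 ?_)
    rw [← e3]
    exact add_le_add ((ENNReal.ofReal_le_ofReal hn.1).trans e1)
      ((ENNReal.ofReal_le_ofReal hn.2).trans e2)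

omit [IsManifold (𝓡 m) ∞ M] in
lemma sqrt_chartForm_eq_norm (x : M) (y v : 𝔼) :
    √(chartForm m x y v v) = ‖chartFrame m x y v‖ := by
  rw [chartForm_apply, chartMetric_self_eq_norm, Real.sqrt_sq (norm_nonneg _)]

lemma enorm_mfderiv_eq (x : M) {γ : ℝ → M} {t : ℝ}
    (hγ : MDifferentiableAt 𝓘(ℝ, ℝ) (𝓡 m) γ t) (ht : γ t ∈ (chartAt 𝔼 x).source) :
    ‖mfderiv 𝓘(ℝ, ℝ) (𝓡 m) γ t 1‖ₑ = ENNReal.ofReal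
      √(chartForm m x (extChartAt (𝓡 m) x (γ t)) (deriv (fun s ↦ extChartAt (𝓡 m) x (γ s)) t)
        (deriv (fun s ↦ extChartAt (𝓡 m) x (γ s)) t)) := by
  have h1 : mfderiv 𝓘(ℝ, ℝ) 𝓘(ℝ, 𝔼) (fun s ↦ extChartAt (𝓡 m) x (γ s)) t =
      mfderiv (𝓡 m) 𝓘(ℝ, 𝔼) (extChartAt (𝓡 m) x) (γ t) ∘L mfderiv 𝓘(ℝ, ℝ) (𝓡 m) γ t :=
    mfderiv_comp t (mdifferentiableAt_extChartAt ht) hγ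
  have h2 : deriv (fun s ↦ extChartAt (𝓡 m) x (γ s)) t =
      mfderiv (𝓡 m) 𝓘(ℝ, 𝔼) (extChartAt (𝓡 m) x) (γ t) (mfderiv 𝓘(ℝ, ℝ) (𝓡 m) γ t 1) := by
    rw [← fderiv_apply_one_eq_deriv, ← mfderiv_eq_fderiv, h1]
    rfl
  rw [chartForm_apply, chartMetric_extChartAt x ht, h2]
  erw [frameField_mfderiv_extChartAt x ht]
  rw [real_inner_self_eq_norm_sq, Real.sqrt_sq (norm_nonneg _), ofReal_norm]

variable [IsContMDiffRiemannianBundle (𝓡 m) ∞ (EuclideanSpace ℝ (Fin m))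
    (fun x : M ↦ TangentSpace (𝓡 m) x)]

set_option synthInstance.maxHeartbeats 200000 in
-- Continuity of the metric in operator norm, combined with $|\sqrt a-\sqrt b|^2\le|a-b|$; this is
-- why the forms must be $\varepsilon^2$-close.
lemma eventually_abs_sqrt_chartForm_sub_le (x : M) {y₀ : 𝔼}
    (hy₀ : y₀ ∈ (extChartAt (𝓡 m) x).target) {ε : ℝ} (hε : 0 < ε) :
    ∀ᶠ y in 𝓝 y₀, ∀ v, |√(chartForm m x y v v) - √(chartForm m x y₀ v v)| ≤ ε * ‖v‖ := by
  have hc : ContinuousAt (chartForm m x) y₀ :=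
    (contDiffOn_chartForm x).continuousOn.continuousAt ((isOpen_target x).mem_nhds hy₀)
  filter_upwards [eventually_norm_sub_lt_of_continuousAt (F := 𝔼 →L[ℝ] 𝔼 →L[ℝ] ℝ) hc
    (show 0 < ε ^ 2 by positivity)] with y hy v
  have h2 : |chartForm m x y v v - chartForm m x y₀ v v| ≤ ε ^ 2 * ‖v‖ * ‖v‖ := by
    have := abs_bilin_le (G := chartForm m x y - chartForm m x y₀) hy.le (le_refl ‖v‖) (le_refl ‖v‖)
    exact this
  have ha : 0 ≤ chartForm m x y v v := chartMetric_self_nonneg x y v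
  have hb : 0 ≤ chartForm m x y₀ v v := chartMetric_self_nonneg x y₀ v
  have h3 : (√(chartForm m x y v v) - √(chartForm m x y₀ v v)) ^ 2 ≤ (ε * ‖v‖) ^ 2 := by
    refine le_trans ?_ (h2.trans (le_of_eq (by ring)))
    have e1 := Real.sq_sqrt ha
    have e2 := Real.sq_sqrt hb
    have e3 := Real.sqrt_nonneg (chartForm m x y v v)
    have e4 := Real.sqrt_nonneg (chartForm m x y₀ v v)
    set a := √(chartForm m x y v v)
    set b := √(chartForm m x y₀ v v)
    rw [← e1, ← e2]
    rcases le_total a b with h | h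
    · rw [abs_sub_comm, abs_of_nonneg (by nlinarith)]; nlinarith
    · rw [abs_of_nonneg (by nlinarith)]; nlinarith
  exact abs_le_of_sq_le_sq h3 (by positivity)

variable [IsRiemannianManifold (𝓡 m) M]

/-- The coordinate segment between the two points is a competitor, and near `y₀` its speed is almost
that for the frozen metric. -/
lemma eventually_edist_extChartAt_symm_le (x : M) {y₀ : 𝔼}
    (hy₀ : y₀ ∈ (extChartAt (𝓡 m) x).target) {ε : ℝ} (hε : 0 < ε) :
    ∀ᶠ q in 𝓝 (y₀, y₀), edist ((extChartAt (𝓡 m) x).symm q.1) ((extChartAt (𝓡 m) x).symm q.2) ≤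
      ENNReal.ofReal (√(chartForm m x y₀ (q.1 - q.2) (q.1 - q.2)) + ε * ‖q.1 - q.2‖) := by
  obtain ⟨r, hr, hrs⟩ := Metric.mem_nhds_iff.1
    (inter_mem (eventually_abs_sqrt_chartForm_sub_le x hy₀ hε) ((isOpen_target x).mem_nhds hy₀))
  filter_upwards [prod_mem_nhds (Metric.ball_mem_nhds y₀ hr) (Metric.ball_mem_nhds y₀ hr)]
    with q hq
  set c : ℝ → 𝔼 := fun t ↦ q.2 + t • (q.1 - q.2) with hcdef
  have hcI : ∀ t ∈ Icc (0 : ℝ) 1, c t ∈ Metric.ball y₀ r := fun t ht ↦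
    (convex_ball y₀ r).add_smul_sub_mem hq.2 hq.1 ht
  have hcd : ∀ t, HasDerivAt c (q.1 - q.2) t := fun t ↦ by
    have := ((hasDerivAt_id t).smul_const (q.1 - q.2)).const_add q.2
    rwa [one_smul] at this
  have hcs : ContMDiff 𝓘(ℝ, ℝ) (𝓡 m) 1 c := by
    rw [contMDiff_iff_contDiff]; fun_prop
  set γ : ℝ → M := fun t ↦ (extChartAt (𝓡 m) x).symm (c t) with hγdef
  have hγ : ContMDiffOn 𝓘(ℝ, ℝ) (𝓡 m) 1 γ (Icc 0 1) :=
    (contMDiffOn_extChartAt_symm x).comp hcs.contMDiffOn fun t ht ↦ (hrs (hcI t ht)).2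
  have h1 := edist_le_pathELength hγ le_rfl zero_le_one le_rfl
  have e0 : γ 0 = (extChartAt (𝓡 m) x).symm q.2 := by simp [hγdef, hcdef]
  have e1 : γ 1 = (extChartAt (𝓡 m) x).symm q.1 := by simp [hγdef, hcdef]
  rw [e0, e1, edist_comm] at h1
  refine h1.trans ?_
  rw [pathELength_eq_lintegral_mfderiv_Ioo]
  calc _ ≤ ∫⁻ t in Ioo (0 : ℝ) 1,
        ENNReal.ofReal (√(chartForm m x y₀ (q.1 - q.2) (q.1 - q.2)) + ε * ‖q.1 - q.2‖) := by
        refine setLIntegral_mono' measurableSet_Ioo fun t ht ↦ ?_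
        have htI := Ioo_subset_Icc_self ht
        have hs : γ t ∈ (chartAt 𝔼 x).source := by
          have := (extChartAt (𝓡 m) x).map_target (hrs (hcI t htI)).2
          rwa [extChartAt_source] at this
        have hd : MDifferentiableAt 𝓘(ℝ, ℝ) (𝓡 m) γ t :=
          (hγ.contMDiffAt (Icc_mem_nhds ht.1 ht.2)).mdifferentiableAt one_ne_zero
        rw [enorm_mfderiv_eq x hd hs]
        have hec : (fun s ↦ extChartAt (𝓡 m) x (γ s)) =ᶠ[𝓝 t] c := by
          filter_upwards [Ioo_mem_nhds ht.1 ht.2] with s hs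
          exact (extChartAt (𝓡 m) x).right_inv (hrs (hcI s (Ioo_subset_Icc_self hs))).2
        rw [hec.deriv_eq, (hcd t).deriv, hec.eq_of_nhds]
        refine ENNReal.ofReal_le_ofReal ?_
        have := (hrs (hcI t htI)).1 (q.1 - q.2)
        linarith [(abs_le.1 this).2]
    _ = _ := by simp

/-- A path much shorter than the frozen metric predicts would be too short to leave the region where
the metric is comparable to its value at `y₀`. There a linear functional of norm one calibrates its
length from below. -/
lemma eventually_le_edist_extChartAt_symm (x : M) {y₀ : 𝔼}
    (hy₀ : y₀ ∈ (extChartAt (𝓡 m) x).target) {ε : ℝ} (hε : 0 < ε) :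
    ∀ᶠ q in 𝓝 (y₀, y₀), ENNReal.ofReal √(chartForm m x y₀ (q.1 - q.2) (q.1 - q.2)) ≤
      ENNReal.ofReal (1 + ε) *
        edist ((extChartAt (𝓡 m) x).symm q.1) ((extChartAt (𝓡 m) x).symm q.2) := by
  obtain ⟨l, hl, hlb⟩ := exists_pos_le_bilin (chartForm m x y₀)
    fun v hv ↦ chartMetric_self_pos x hy₀ hv
  -- Since $1-\varepsilon/(1+\varepsilon)=1/(1+\varepsilon)$, this additive tolerance, scaled by the
  -- lower bound `l`, gives a comparison with factor $1+\varepsilon$.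
  obtain ⟨r, hr, hrs⟩ := Metric.mem_nhds_iff.1 (inter_mem (eventually_abs_sqrt_chartForm_sub_le x hy₀
    (show 0 < l * (ε / (1 + ε)) by positivity)) ((isOpen_target x).mem_nhds hy₀))
  have hcomp : ∀ y ∈ Metric.ball y₀ r, ∀ v,
      √(chartForm m x y₀ v v) ≤ (1 + ε) * √(chartForm m x y v v) := by
    intro y hy v
    have h1 := (abs_le.1 ((hrs hy).1 v)).1
    have h2 : l * (ε / (1 + ε)) * ‖v‖ ≤ (ε / (1 + ε)) * √(chartForm m x y₀ v v) := by
      have := mul_le_mul_of_nonneg_left (hlb v) (show 0 ≤ ε / (1 + ε) by positivity)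
      linarith
    have h3 : √(chartForm m x y₀ v v) * (1 - ε / (1 + ε)) ≤ √(chartForm m x y v v) := by linarith
    have h4 : (1 - ε / (1 + ε)) = (1 + ε)⁻¹ := by field_simp; ring
    rw [h4, ← div_eq_mul_inv, div_le_iff₀ (by positivity)] at h3
    linarith
  have hcψ : ContinuousAt (extChartAt (𝓡 m) x).symm y₀ :=
    (continuousOn_extChartAt_symm x).continuousAt ((isOpen_target x).mem_nhds hy₀)
  have hsrc : (extChartAt (𝓡 m) x).symm y₀ ∈ (extChartAt (𝓡 m) x).source :=
    (extChartAt (𝓡 m) x).map_target hy₀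
  have hV : (extChartAt (𝓡 m) x).source ∩ extChartAt (𝓡 m) x ⁻¹' Metric.ball y₀ r ∈
      𝓝 ((extChartAt (𝓡 m) x).symm y₀) := by
    refine inter_mem ((isOpen_extChartAt_source x).mem_nhds hsrc)
      ((continuousOn_extChartAt x).continuousAt ((isOpen_extChartAt_source x).mem_nhds hsrc) ?_)
    rw [(extChartAt (𝓡 m) x).right_inv hy₀]
    exact Metric.ball_mem_nhds y₀ hr
  -- A path starting within `δ / 2` of the centre and shorter than `δ / 2` stays in the controlled
  -- part of the chart.
  obtain ⟨δ, hδ, hδs⟩ := Metric.mem_nhds_iff.1 hV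
  have hN : ∀ᶠ q : 𝔼 × 𝔼 in 𝓝 (y₀, y₀), √(chartForm m x y₀ (q.1 - q.2) (q.1 - q.2)) < δ / 2 := by
    have hc : Continuous fun q : 𝔼 × 𝔼 ↦ √(chartForm m x y₀ (q.1 - q.2) (q.1 - q.2)) :=
      (continuous_bilin_apply.comp (continuous_const.prodMk
        ((continuous_fst.sub continuous_snd).prodMk (continuous_fst.sub continuous_snd)))).sqrt
    refine hc.continuousAt.eventually_lt continuousAt_const ?_
    simpa using hδ
  have hb : ∀ᶠ q : 𝔼 × 𝔼 in 𝓝 (y₀, y₀),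
      dist ((extChartAt (𝓡 m) x).symm q.2) ((extChartAt (𝓡 m) x).symm y₀) < δ / 2 :=
    (hcψ.comp (x := (y₀, y₀)) (f := fun q : 𝔼 × 𝔼 ↦ q.2) continuousAt_snd).tendsto.eventually
      (Metric.ball_mem_nhds _ (half_pos hδ))
  filter_upwards [hN, hb, prod_mem_nhds ((isOpen_target x).mem_nhds hy₀)
    ((isOpen_target x).mem_nhds hy₀)] with q hq hqb hqt
  set u := q.1 - q.2 with hu
  by_contra! hlt
  have hNpos : 0 < √(chartForm m x y₀ u u) := by
    rw [← ENNReal.ofReal_pos]; exact lt_of_le_of_lt zero_le hlt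
  have h1 : riemannianEDist (𝓡 m) ((extChartAt (𝓡 m) x).symm q.2) ((extChartAt (𝓡 m) x).symm q.1) <
      ENNReal.ofReal (√(chartForm m x y₀ u u) / (1 + ε)) := by
    rw [← IsRiemannianManifold.out (I := 𝓡 m), edist_comm,
      ENNReal.ofReal_div_of_pos (by positivity), ENNReal.lt_div_iff_mul_lt
        (Or.inl (ENNReal.ofReal_pos.2 (by positivity)).ne')
      (by simp), mul_comm]
    exact hlt
  obtain ⟨γ, h0, h1, hγ, hL⟩ := exists_lt_of_riemannianEDist_lt h1
  have hLδ : pathELength (𝓡 m) γ 0 1 < ENNReal.ofReal (δ / 2) := by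
    refine hL.trans_le (ENNReal.ofReal_le_ofReal ((div_le_self hNpos.le (by linarith)).trans hq.le))
  have hγV : ∀ t ∈ Icc (0 : ℝ) 1, γ t ∈ (extChartAt (𝓡 m) x).source ∧
      extChartAt (𝓡 m) x (γ t) ∈ Metric.ball y₀ r := by
    intro t ht
    refine hδs ?_
    have e1 := edist_le_pathELength hγ le_rfl ht.1 ht.2
    have e2 : edist (γ 0) (γ t) < ENNReal.ofReal (δ / 2) :=
      (e1.trans (pathELength_mono le_rfl ht.2)).trans_lt hLδ
    rw [edist_dist, ENNReal.ofReal_lt_ofReal_iff (half_pos hδ), h0, dist_comm] at e2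
    have := dist_triangle (γ t) ((extChartAt (𝓡 m) x).symm q.2) ((extChartAt (𝓡 m) x).symm y₀)
    rw [Metric.mem_ball]
    linarith
  set c : ℝ → 𝔼 := fun t ↦ extChartAt (𝓡 m) x (γ t) with hcdef
  have hγs : ∀ t ∈ Icc (0 : ℝ) 1, γ t ∈ (chartAt 𝔼 x).source := fun t ht ↦ by
    simpa [extChartAt_source] using (hγV t ht).1
  have hc : ContDiffOn ℝ 1 c (Icc 0 1) := by
    rw [← contMDiffOn_iff_contDiffOn]
    exact (contMDiffOn_extChartAt (n := 1) (x := x)).comp hγ hγs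
  -- The unit covector dual to `u`: it attains the norm on `u` and is bounded by the norm of the
  -- frozen metric in all directions, so integrating it along the path bounds the length from below.
  set ℓ : 𝔼 →L[ℝ] ℝ := (√(chartForm m x y₀ u u))⁻¹ • chartForm m x y₀ u with hℓ
  have hℓu : ℓ u = √(chartForm m x y₀ u u) := by
    have : ℓ u = (√(chartForm m x y₀ u u))⁻¹ * chartForm m x y₀ u u := rfl
    rw [this, inv_mul_eq_div, Real.div_sqrt]
  have hℓw : ∀ w, |ℓ w| ≤ √(chartForm m x y₀ w w) := by
    intro w
    have e1 : ℓ w = (√(chartForm m x y₀ u u))⁻¹ * chartForm m x y₀ u w := rfl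
    rw [e1, abs_mul, abs_of_pos (inv_pos.2 hNpos), inv_mul_le_iff₀ hNpos, sqrt_chartForm_eq_norm,
      sqrt_chartForm_eq_norm]
    exact abs_real_inner_le_norm (chartFrame m x y₀ u) (chartFrame m x y₀ w)
  have hcint : ∀ t ∈ Ioo (0 : ℝ) 1, DifferentiableAt ℝ c t := fun t ht ↦
    (hc.differentiableOn one_ne_zero).differentiableAt (Icc_mem_nhds ht.1 ht.2)
  have hf : ContDiffOn ℝ 1 (fun t ↦ ℓ (c t)) (Icc 0 1) := ℓ.contDiff.comp_contDiffOn hc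
  have key := enorm_sub_le_lintegral_derivWithin_Icc_of_contDiffOn_Icc hf zero_le_one
  have ec0 : c 0 = q.2 := by
    rw [hcdef]; simp only; rw [h0]; exact (extChartAt (𝓡 m) x).right_inv hqt.2
  have ec1 : c 1 = q.1 := by
    rw [hcdef]; simp only; rw [h1]; exact (extChartAt (𝓡 m) x).right_inv hqt.1
  rw [ec0, ec1, ← map_sub, ← hu, hℓu, ← ofReal_norm, Real.norm_of_nonneg hNpos.le,
    ← restrict_Ioo_eq_restrict_Icc] at key
  have hle : ∫⁻ t in Ioo (0 : ℝ) 1, ‖derivWithin (fun t ↦ ℓ (c t)) (Icc 0 1) t‖ₑ ≤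
      ENNReal.ofReal (1 + ε) * pathELength (𝓡 m) γ 0 1 := by
    rw [pathELength_eq_lintegral_mfderiv_Ioo, ← lintegral_const_mul' _ _ ENNReal.ofReal_ne_top]
    refine setLIntegral_mono' measurableSet_Ioo fun t ht ↦ ?_
    have htI := Ioo_subset_Icc_self ht
    rw [derivWithin_of_mem_nhds (Icc_mem_nhds ht.1 ht.2)]
    have hd : MDifferentiableAt 𝓘(ℝ, ℝ) (𝓡 m) γ t :=
      (hγ.contMDiffAt (Icc_mem_nhds ht.1 ht.2)).mdifferentiableAt one_ne_zero
    rw [enorm_mfderiv_eq x hd (hγs t htI), ← ENNReal.ofReal_mul (by positivity), ← ofReal_norm]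
    refine ENNReal.ofReal_le_ofReal ?_
    have e1 : deriv (fun t ↦ ℓ (c t)) t = ℓ (deriv c t) :=
      (ℓ.hasFDerivAt.comp_hasDerivAt t (hcint t ht).hasDerivAt).deriv
    rw [e1]
    exact (hℓw _).trans (hcomp _ (hγV t htI).2 _)
  have hfin := key.trans hle
  have : ENNReal.ofReal (1 + ε) * pathELength (𝓡 m) γ 0 1 <
      ENNReal.ofReal (1 + ε) * ENNReal.ofReal (√(chartForm m x y₀ u u) / (1 + ε)) :=
    (ENNReal.mul_lt_mul_iff_right (by simp; positivity) (by simp)).2 hL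
  rw [← ENNReal.ofReal_mul (by positivity), mul_div_cancel₀ _ (by positivity)] at this
  exact absurd (hfin.trans_lt this) (lt_irrefl _)

/-- The charts of a Riemannian manifold are metric charts. -/
theorem isMetricChart_extChartAt (x : M) :
    IsMetricChart (extChartAt (𝓡 m) x).target (chartForm m x) (extChartAt (𝓡 m) x).symm where
  isOpen := isOpen_target x
  contDiffOn := contDiffOn_chartForm x
  symm y v w := chartMetric_comm x y v w
  pos y hy v hv := chartMetric_self_pos x hy hv
  strict y hy := by
    refine Asymptotics.IsLittleO.of_bound fun ε hε ↦ ?_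
    set C := √‖chartForm m x y‖ with hC
    have hC0 : 0 ≤ C := Real.sqrt_nonneg _
    -- The lower bound has the error $\varepsilon' D$ with $D$ the distance. Since
    -- $\varepsilon'\le1$, the upper bound gives $D\le(C+1)\|q_1-q_2\|$.
    set ε' := min 1 (ε / (C + 1)) with hε'
    have hε'pos : 0 < ε' := by positivity
    filter_upwards [eventually_edist_extChartAt_symm_le x hy hε'pos,
      eventually_le_edist_extChartAt_symm x hy hε'pos] with q h1 h2
    rw [edist_dist, ENNReal.ofReal_le_ofReal_iff (by positivity)] at h1
    rw [edist_dist, ← ENNReal.ofReal_mul (by positivity),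
      ENNReal.ofReal_le_ofReal_iff (by positivity)] at h2
    have h3 := sqrt_bilin_le (chartForm m x y) (q.1 - q.2)
    have h4 : ε' * (C + 1) ≤ ε := by
      rw [← le_div_iff₀ (by positivity)]; exact min_le_right _ _
    have h5 : ε' ≤ 1 := min_le_left _ _
    have h6 : ε' * (C + 1) * ‖q.1 - q.2‖ ≤ ε * ‖q.1 - q.2‖ := by gcongr
    set N := √(chartForm m x y (q.1 - q.2) (q.1 - q.2))
    set D := dist ((extChartAt (𝓡 m) x).symm q.1) ((extChartAt (𝓡 m) x).symm q.2)
    have hn : 0 ≤ ‖q.1 - q.2‖ := norm_nonneg _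
    rw [Real.norm_eq_abs, abs_le]
    constructor
    · have : ε' * D ≤ ε' * (C + 1) * ‖q.1 - q.2‖ := by
        rw [mul_assoc]
        refine mul_le_mul_of_nonneg_left ?_ hε'pos.le
        nlinarith
      linarith
    · have : ε' * ‖q.1 - q.2‖ ≤ ε' * (C + 1) * ‖q.1 - q.2‖ := by
        gcongr
        nlinarith
      linarith

end ManifoldDistance

/-! ### From geodesic completeness to compact balls -/

section GeodesicCompleteness

variable {m : ℕ} {M : Type*} [MetricSpace M] [ChartedSpace (EuclideanSpace ℝ (Fin m)) M]
  [IsManifold (𝓡 m) ∞ M] [RiemannianBundle (fun x : M ↦ TangentSpace (𝓡 m) x)]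
  [IsContMDiffRiemannianBundle (𝓡 m) ∞ (EuclideanSpace ℝ (Fin m))
    (fun x : M ↦ TangentSpace (𝓡 m) x)]

local notation "𝔼" => EuclideanSpace ℝ (Fin m)

lemma differentiableAt_fderiv_clm_apply {E F : Type*} [NormedAddCommGroup E] [NormedSpace ℝ E]
    [NormedAddCommGroup F] [NormedSpace ℝ F] {T : E → E →L[ℝ] F} {y : E}
    (hT : DifferentiableAt ℝ T y) (v : E) : DifferentiableAt ℝ (fun z ↦ T z v) y ∧
      ∀ u, fderiv ℝ (fun z ↦ T z v) y u = fderiv ℝ T y u v := by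
  have h := (ContinuousLinearMap.apply ℝ F v).hasFDerivAt.comp y hT.hasFDerivAt
  exact ⟨h.differentiableAt, fun u ↦ DFunLike.congr_fun h.fderiv u⟩

lemma fderiv_bilin_apply {E : Type*} [NormedAddCommGroup E] [NormedSpace ℝ E]
    {g : E → E →L[ℝ] E →L[ℝ] ℝ} {y : E} (hg : DifferentiableAt ℝ g y) (u v w : E) :
    fderiv ℝ (fun z ↦ g z v w) y u = fderiv ℝ g y u v w := by
  obtain ⟨h1, h2⟩ := differentiableAt_fderiv_clm_apply (F := E →L[ℝ] ℝ) hg v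
  obtain ⟨-, h4⟩ := differentiableAt_fderiv_clm_apply (F := ℝ) h1 w
  rw [h4, h2]

/-- With equal first arguments two of the three derivatives in the Christoffel symbol coincide. This
matches the geodesic equation with the Euler–Lagrange equation of the energy. -/
lemma two_mul_christoffel (x : M) {y : 𝔼} (hy : y ∈ (extChartAt (𝓡 m) x).target) (v w : 𝔼) :
    2 * christoffel m x y v v w =
      2 * fderiv ℝ (chartForm m x) y v v w - fderiv ℝ (chartForm m x) y w v v := by
  have hd : DifferentiableAt ℝ (chartForm m x) y :=
    ((contDiffOn_chartForm x).contDiffAt ((isOpen_target x).mem_nhds hy)).differentiableAt (by simp)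
  have h1 : ∀ u v w, fderiv ℝ (fun z ↦ chartMetric m x z v w) y u =
      fderiv ℝ (chartForm m x) y u v w := fun u v w ↦ fderiv_bilin_apply hd u v w
  rw [christoffel, h1, h1]
  ring

variable [IsRiemannianManifold (𝓡 m) M]

/-- A curve whose arcs realize the distance between their endpoints is a geodesic. -/
theorem isGeodesicOn_of_dist_eq {γ : ℝ → M} {a b : ℝ}
    (hγ : ∀ s ∈ Ioo a b, ∀ t ∈ Ioo a b, dist (γ s) (γ t) = |s - t|) :
    IsGeodesicOn m γ (Ioo a b) := by
  have hcont : ContinuousOn γ (Ioo a b) := by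
    refine (LipschitzOnWith.of_dist_le_mul (K := 1) fun s hs t ht ↦ ?_).continuousOn
    rw [hγ s hs t ht, Real.dist_eq, NNReal.coe_one, one_mul]
  have key : ∀ t ∈ Ioo a b, ContDiffAt ℝ 2 (fun s ↦ extChartAt (𝓡 m) (γ t) (γ s)) t ∧
      ∀ c : ℝ → 𝔼, (c = fun s ↦ extChartAt (𝓡 m) (γ t) (γ s)) → ∀ w,
      2 * (chartForm m (γ t) (c t) (deriv (deriv c) t) w +
        fderiv ℝ (chartForm m (γ t)) (c t) (deriv c t) (deriv c t) w) =
        fderiv ℝ (chartForm m (γ t)) (c t) w (deriv c t) (deriv c t) := by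
    intro t ht
    set x := γ t with hx
    set e := extChartAt (𝓡 m) x with he
    have hm := isMetricChart_extChartAt (m := m) x
    have hyt : e x ∈ e.target := mem_extChartAt_target x
    obtain ⟨C, hC, hCq⟩ := hm.eventually_norm_sub_le hyt
    have hct : ContinuousAt γ t := hcont.continuousAt (Ioo_mem_nhds ht.1 ht.2)
    have hcc : ContinuousAt (fun s ↦ e (γ s)) t := (continuousAt_extChartAt x).comp hct
    have hev : ∀ᶠ q : ℝ × ℝ in 𝓝 (t, t), ‖e (γ q.1) - e (γ q.2)‖ ≤
        C * dist (e.symm (e (γ q.1))) (e.symm (e (γ q.2))) := by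
      have : Tendsto (fun q : ℝ × ℝ ↦ (e (γ q.1), e (γ q.2))) (𝓝 (t, t)) (𝓝 (e x, e x)) := by
        rw [nhds_prod_eq, nhds_prod_eq]
        exact (hcc.tendsto.comp tendsto_fst).prodMk (hcc.tendsto.comp tendsto_snd)
      exact this.eventually hCq
    have hsrc : ∀ᶠ s in 𝓝 t, γ s ∈ e.source :=
      hct.eventually (extChartAt_source_mem_nhds x)
    obtain ⟨r, hr, hrs⟩ := Metric.mem_nhds_iff.1 (inter_mem hev (prod_mem_nhds
      (inter_mem hsrc (Ioo_mem_nhds ht.1 ht.2)) (inter_mem hsrc (Ioo_mem_nhds ht.1 ht.2))))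
    set a' := t - r / 2 with ha'
    set b' := t + r / 2 with hb'
    have hab' : a' ≤ b' := by linarith
    have hI : ∀ s ∈ Icc a' b', dist s t < r := fun s hs ↦ by
      rw [Real.dist_eq, abs_lt]; constructor <;> linarith [hs.1, hs.2]
    have hI2 : ∀ s ∈ Icc a' b', ∀ s' ∈ Icc a' b', (s, s') ∈ Metric.ball (t, t) r :=
      fun s hs s' hs' ↦ by
        rw [Metric.mem_ball, Prod.dist_eq]; exact max_lt (hI s hs) (hI s' hs')
    have hIs : ∀ s ∈ Icc a' b', γ s ∈ e.source ∧ s ∈ Ioo a b := fun s hs ↦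
      (hrs (hI2 s hs s hs)).2.1
    -- Freezing the curve outside a small interval makes it globally Lipschitz with compact range
    -- inside the chart, as required by the regularity theorem. Nothing changes near `t`.
    set c : ℝ → 𝔼 := fun s ↦ e (γ (projIcc a' b' hab' s)) with hc
    have hceq : ∀ s ∈ Icc a' b', c s = e (γ s) := fun s hs ↦ by
      rw [hc]; simp only; rw [projIcc_of_mem hab' hs]
    have hψc : ∀ s ∈ Icc a' b', e.symm (c s) = γ s := fun s hs ↦ by
      rw [hceq s hs, e.left_inv (hIs s hs).1]
    have hcL : LipschitzWith C.toNNReal c := by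
      refine LipschitzWith.of_dist_le_mul fun s s' ↦ ?_
      have hs := (projIcc a' b' hab' s).2
      have hs' := (projIcc a' b' hab' s').2
      have h1 := (hrs (hI2 _ hs _ hs')).1
      simp only [mem_ofPred_eq] at h1
      rw [e.left_inv (hIs _ hs).1, e.left_inv (hIs _ hs').1,
        hγ _ (hIs _ hs).2 _ (hIs _ hs').2] at h1
      rw [dist_eq_norm, Real.coe_toNNReal _ hC.le]
      refine h1.trans (mul_le_mul_of_nonneg_left ?_ hC.le)
      have := (LipschitzWith.projIcc hab').dist_le_mul s s'
      rwa [NNReal.coe_one, one_mul] at this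
    have hrange : range c = (fun s ↦ e (γ s)) '' Icc a' b' := by
      ext z
      constructor
      · rintro ⟨s, rfl⟩
        exact ⟨_, (projIcc a' b' hab' s).2, rfl⟩
      · rintro ⟨s, hs, rfl⟩
        exact ⟨s, hceq s hs⟩
    have hcpt : IsCompact (range c) := by
      rw [hrange]
      refine isCompact_Icc.image_of_continuousOn ((continuousOn_extChartAt x).comp
        (hcont.mono fun s hs ↦ (hIs s hs).2) fun s hs ↦ (hIs s hs).1)
    have hU : range c ⊆ e.target := by
      rw [hrange]; rintro - ⟨s, hs, rfl⟩; exact e.map_source (hIs s hs).1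
    obtain ⟨h1, h2⟩ := hm.geodesic_of_minimizing (a := a') (b := b') (by linarith) hcL hcpt hU
      fun s hs s' hs' ↦ by rw [hψc s hs, hψc s' hs', hγ _ (hIs s hs).2 _ (hIs s' hs').2]
    have htI : t ∈ Ioo a' b' := ⟨by linarith, by linarith⟩
    have hev2 : (fun s ↦ e (γ s)) =ᶠ[𝓝 t] c := by
      filter_upwards [Ioo_mem_nhds htI.1 htI.2] with s hs
      exact (hceq s (Ioo_subset_Icc_self hs)).symm
    refine ⟨(h1.contDiffAt (Ioo_mem_nhds htI.1 htI.2)).congr_of_eventuallyEq hev2, ?_⟩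
    rintro c' rfl w
    have := h2 t htI w
    rwa [← hev2.deriv.deriv_eq, ← hev2.deriv_eq, ← hev2.eq_of_nhds] at this
  refine ⟨fun t ht ↦ ?_, fun t ht c hc w ↦ ?_⟩
  · refine ContMDiffAt.contMDiffWithinAt ?_
    rw [contMDiffAt_iff_target]
    exact ⟨hcont.continuousAt (Ioo_mem_nhds ht.1 ht.2), (key t ht).1.contMDiffAt⟩
  · have h1 := (key t ht).2 c hc w
    have h2 : c t ∈ (extChartAt (𝓡 m) (γ t)).target := by
      rw [hc]; exact mem_extChartAt_target _
    have h3 := two_mul_christoffel (γ t) h2 (deriv c t) w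
    rw [chartForm_apply] at h1
    linarith

/-- **Hopf–Rinow**: closed balls of a geodesically complete manifold are compact. -/
theorem properSpace_of_geodesicallyComplete (hM : GeodesicallyComplete m M) : ProperSpace M := by
  have : LocallyCompactSpace M := ChartedSpace.locallyCompactSpace (EuclideanSpace ℝ (Fin m)) M
  refine (hasIntermediatePoints m M).properSpace fun R γ hR hγ ↦ ?_
  -- The extension is continuous at `R`, and its value there is the missing limit.
  obtain ⟨γ', hγ', heq⟩ := hM (Ioo 0 R) γ isOpen_Ioo ordConnected_Ioo (isGeodesicOn_of_dist_eq hγ)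
  have hc : Continuous γ' := continuousOn_univ.1 hγ'.1.continuousOn
  refine ⟨γ' R, (hc.continuousAt.tendsto.mono_left nhdsWithin_le_nhds).congr' ?_⟩
  filter_upwards [Ioo_mem_nhdsLT hR] with t ht using heq ht

end GeodesicCompleteness

/-! ### Weak derivatives and mollification -/

section WeakDerivative

open Function ContinuousLinearMap
open scoped Convolution

variable {E : Type*} [NormedAddCommGroup E] [InnerProductSpace ℝ E] [FiniteDimensional ℝ E]
  [MeasurableSpace E] [BorelSpace E]
  {W : Type*} [NormedAddCommGroup W] [NormedSpace ℝ W]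

/-- `G` is the weak derivative of `F` in the direction `v` on the open set `U`. -/
def HasWeakDeriv (U : Set E) (F G : E → W) (v : E) : Prop :=
  ∀ ρ : E → ℝ, ContDiff ℝ ∞ ρ → HasCompactSupport ρ → tsupport ρ ⊆ U →
    ∫ y, fderiv ℝ ρ y v • F y = -∫ y, ρ y • G y

section Mollification

variable (φ : ContDiffBump (0 : E))

lemma convolution_normed_eq (F : E → W) (x : E) :
    (φ.normed volume ⋆[lsmul ℝ ℝ, volume] F) x = ∫ t, φ.normed volume (x - t) • F t := by
  rw [convolution_eq_swap]; rfl

lemma contDiff_convolution_normed [CompleteSpace W] {F : E → W} (hF : LocallyIntegrable F) :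
    ContDiff ℝ ∞ (φ.normed volume ⋆[lsmul ℝ ℝ, volume] F) :=
  φ.hasCompactSupport_normed.contDiff_convolution_left _ φ.contDiff_normed hF

/-- The derivative falls on the kernel, and `t ↦ φ (x - t)` is an admissible test function. The sign
from reflecting the argument cancels that of the weak derivative. -/
lemma fderiv_convolution_normed [CompleteSpace W] {F G : E → W} (hF : LocallyIntegrable F)
    {v : E} (h : HasWeakDeriv univ F G v) (x : E) :
    fderiv ℝ (φ.normed volume ⋆[lsmul ℝ ℝ, volume] F) x v =
      (φ.normed volume ⋆[lsmul ℝ ℝ, volume] G) x := by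
  have hφ : ContDiff ℝ ∞ (φ.normed volume : E → ℝ) := φ.contDiff_normed
  have hφc : HasCompactSupport (φ.normed volume : E → ℝ) := φ.hasCompactSupport_normed
  rw [(hφc.hasFDerivAt_convolution_left (lsmul ℝ ℝ) (hφ.of_le (by simp)) hF x).fderiv,
    convolution_normed_eq, convolution_eq_swap]
  have hint : Integrable (fun t ↦ (lsmul ℝ ℝ : ℝ →L[ℝ] W →L[ℝ] W).precompL E
      (fderiv ℝ (φ.normed volume) (x - t)) (F t)) :=
    ((hφc.fderiv ℝ).convolutionExists_left ((lsmul ℝ ℝ : ℝ →L[ℝ] W →L[ℝ] W).precompL E)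
      (hφ.continuous_fderiv (by simp)) hF x).integrable_swap
  rw [ContinuousLinearMap.integral_apply hint]
  have hρ : ContDiff ℝ ∞ fun t ↦ φ.normed volume (x - t) := hφ.comp (contDiff_const.sub contDiff_id)
  have hρc : HasCompactSupport fun t ↦ φ.normed volume (x - t) :=
    hφc.comp_homeomorph (Homeomorph.subLeft x)
  have key := h _ hρ hρc (subset_univ _)
  have hd : ∀ t, fderiv ℝ (fun t ↦ φ.normed volume (x - t)) t v =
      -fderiv ℝ (φ.normed volume) (x - t) v := by
    intro t
    have h1 : HasFDerivAt (fun t ↦ φ.normed volume (x - t))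
        ((fderiv ℝ (φ.normed volume) (x - t)) ∘L (-ContinuousLinearMap.id ℝ E)) t :=
      ((hφ.differentiable (by simp)) (x - t)).hasFDerivAt.comp t ((hasFDerivAt_id t).const_sub x)
    rw [h1.fderiv]; simp
  simp only [hd, neg_smul, integral_neg, neg_inj] at key
  exact key

lemma tsupport_convolution_normed_subset {F : E → W} {K : Set E}
    (hF : ∀ x ∉ K, F x = 0) :
    tsupport (φ.normed volume ⋆[lsmul ℝ ℝ, volume] F) ⊆ Metric.cthickening φ.rOut K := by
  refine closure_minimal (fun x hx ↦ ?_) Metric.isClosed_cthickening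
  obtain ⟨a, ha, b, hb, rfl⟩ := support_convolution_subset_swap (L := lsmul ℝ ℝ) (μ := volume) hx
  have haK : a ∈ K := by by_contra h; exact ha (hF a h)
  rw [φ.support_normed_eq, mem_ball_zero_iff] at hb
  exact Metric.mem_cthickening_of_dist_le _ a _ _ haK (by simpa [dist_eq_norm] using hb.le)

lemma norm_convolution_normed_le {F : E → W} {C : ℝ} (hF : ∀ x, ‖F x‖ ≤ C) (x : E) :
    ‖(φ.normed volume ⋆[lsmul ℝ ℝ, volume] F) x‖ ≤ C := by
  have h1 : ∫ t, φ.normed volume t * C = C := by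
    rw [integral_mul_const, φ.integral_normed, one_mul]
  rw [convolution_def, ← h1]
  refine norm_integral_le_of_norm_le (φ.integrable_normed.mul_const C) (Eventually.of_forall
    fun t ↦ ?_)
  rw [lsmul_apply, norm_smul, Real.norm_of_nonneg (φ.nonneg_normed t)]
  exact mul_le_mul_of_nonneg_left (hF _) (φ.nonneg_normed t)

/-- The mollified function is the average of translates of `F` for a probability measure on a small
ball, so Jensen and Tonelli bound the error by the worst translation error in that ball. -/
lemma eLpNorm_convolution_normed_sub_le_of_stronglyMeasurable [CompleteSpace W] {F : E → W}
    (hFm : StronglyMeasurable F) {p : ℝ≥0∞} (hp : 1 ≤ p) (hp' : p ≠ ⊤) (hF : LocallyIntegrable F)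
    {ε : ℝ≥0∞} (hε : ∀ t ∈ Metric.ball (0 : E) φ.rOut, eLpNorm (fun x ↦ F (x - t) - F x) p ≤ ε) :
    eLpNorm ((φ.normed volume ⋆[lsmul ℝ ℝ, volume] F) - F) p ≤ ε := by
  have hp0 : p ≠ 0 := (zero_lt_one.trans_le hp).ne'
  have hpr : 0 < p.toReal := ENNReal.toReal_pos hp0 hp'
  set ν : Measure E := volume.withDensity fun t ↦ ENNReal.ofReal (φ.normed volume t) with hν
  have hφm : Measurable fun t ↦ ENNReal.ofReal (φ.normed volume t) :=
    φ.continuous_normed.measurable.ennreal_ofReal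
  have hνp : IsProbabilityMeasure ν := ⟨by
    rw [hν, withDensity_apply _ MeasurableSet.univ, Measure.restrict_univ,
      ← ofReal_integral_eq_lintegral_ofReal φ.integrable_normed
      (Eventually.of_forall φ.nonneg_normed), φ.integral_normed, ENNReal.ofReal_one]⟩
  have hconv : ∀ x, (φ.normed volume ⋆[lsmul ℝ ℝ, volume] F) x - F x =
      ∫ t, (F (x - t) - F x) ∂ν := by
    intro x
    rw [hν, integral_withDensity_eq_integral_toReal_smul hφm (by simp)]
    have h1 : Integrable fun t ↦ φ.normed volume t • F (x - t) :=
      φ.hasCompactSupport_normed.convolutionExists_left (lsmul ℝ ℝ) φ.continuous_normed hF x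
    have h2 : Integrable fun t ↦ φ.normed volume t • F x := φ.integrable_normed.smul_const _
    have h3 : ∫ t, φ.normed volume t • F x = F x := by
      rw [integral_smul_const, φ.integral_normed, one_smul]
    rw [convolution_def]
    conv_lhs => rw [← h3]
    simp only [lsmul_apply]
    rw [← integral_sub h1 h2]
    refine integral_congr_ae (Eventually.of_forall fun t ↦ ?_)
    simp only [ENNReal.toReal_ofReal (φ.nonneg_normed t), smul_sub]
  have hmeas : Measurable fun q : E × E ↦ ‖F (q.1 - q.2) - F q.1‖ₑ ^ p.toReal :=
    ((hFm.comp_measurable (measurable_fst.sub measurable_snd)).sub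
      (hFm.comp_measurable measurable_fst)).enorm.pow_const _
  have hpt : ∀ x, ‖((φ.normed volume ⋆[lsmul ℝ ℝ, volume] F) - F) x‖ₑ ^ p.toReal ≤
      ∫⁻ t, ‖F (x - t) - F x‖ₑ ^ p.toReal ∂ν := by
    intro x
    have hs : AEStronglyMeasurable (fun t ↦ F (x - t) - F x) ν :=
      ((hFm.comp_measurable (measurable_const.sub measurable_id)).sub
        stronglyMeasurable_const).aestronglyMeasurable
    rw [Pi.sub_apply, hconv x]
    -- Jensen's inequality in the form that $L^p$-norms increase with the exponent on a probability
    -- space.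
    have h1 : ‖∫ t, (F (x - t) - F x) ∂ν‖ₑ ≤ eLpNorm (fun t ↦ F (x - t) - F x) p ν := by
      refine (enorm_integral_le_lintegral_enorm _).trans ?_
      rw [← eLpNorm_one_eq_lintegral_enorm]
      exact eLpNorm_le_eLpNorm_of_exponent_le hp hs
    refine (ENNReal.rpow_le_rpow h1 hpr.le).trans (le_of_eq ?_)
    rw [eLpNorm_eq_lintegral_rpow_enorm_toReal hp0 hp', ← ENNReal.rpow_mul,
      one_div_mul_cancel hpr.ne', ENNReal.rpow_one]
  rw [← ENNReal.rpow_le_rpow_iff hpr, eLpNorm_eq_lintegral_rpow_enorm_toReal hp0 hp',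
    ← ENNReal.rpow_mul, one_div_mul_cancel hpr.ne', ENNReal.rpow_one]
  calc _ ≤ ∫⁻ x, ∫⁻ t, ‖F (x - t) - F x‖ₑ ^ p.toReal ∂ν := lintegral_mono hpt
    _ = ∫⁻ t, (∫⁻ x, ‖F (x - t) - F x‖ₑ ^ p.toReal) ∂ν :=
        lintegral_lintegral_swap hmeas.aemeasurable
    _ ≤ ∫⁻ _, ε ^ p.toReal ∂ν := by
        refine lintegral_mono_ae ?_
        rw [hν, ae_withDensity_iff hφm]
        refine Eventually.of_forall fun t ht ↦ ?_
        have htb : t ∈ Metric.ball (0 : E) φ.rOut := by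
          rw [← φ.support_normed_eq (μ := volume)]
          intro h0
          exact ht (by rw [h0, ENNReal.ofReal_zero])
        have := ENNReal.rpow_le_rpow (hε t htb) hpr.le
        rwa [eLpNorm_eq_lintegral_rpow_enorm_toReal hp0 hp', ← ENNReal.rpow_mul,
          one_div_mul_cancel hpr.ne', ENNReal.rpow_one] at this
    _ = _ := by simp

end Mollification

omit [NormedSpace ℝ W] in
/-- Translation is continuous in `L^p`. -/
lemma tendsto_eLpNorm_translate_sub {F : E → W} {p : ℝ≥0∞} (hp : 1 ≤ p) (hp' : p ≠ ⊤)
    (hF : MemLp F p) : Tendsto (fun t : E ↦ eLpNorm (fun x ↦ F (x - t) - F x) p) (𝓝 0) (𝓝 0) := by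
  have : Fact (1 ≤ p) := ⟨hp⟩
  have hmp : ∀ t : E, MeasurePreserving (fun x : E ↦ x - t) volume volume := fun t ↦
    measurePreserving_sub_right volume t
  let g : E → C(E, E) := fun t ↦ ⟨fun x ↦ x - t, by fun_prop⟩
  have hg : Continuous g := ContinuousMap.continuous_of_continuous_uncurry _ (by
    change Continuous fun q : E × E ↦ q.2 - q.1
    fun_prop)
  have hc : Continuous fun t ↦ Lp.compMeasurePreserving (g t) (hmp t) (hF.toLp F) :=
    continuous_const.compMeasurePreservingLp hg hmp hp'
  have h1 := (hc.tendsto 0)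
  rw [tendsto_iff_edist_tendsto_0] at h1
  refine h1.congr fun t ↦ ?_
  have e1 : ∀ t, Lp.compMeasurePreserving (g t) (hmp t) (hF.toLp F) =
      (hF.comp_measurePreserving (hmp t)).toLp _ := fun t ↦
    Lp.toLp_compMeasurePreserving hF (hmp t)
  rw [e1, e1, Lp.edist_toLp_toLp]
  refine eLpNorm_congr_ae (Eventually.of_forall fun x ↦ ?_)
  simp

/-- Mollification converges in `L^p`. -/
lemma tendsto_eLpNorm_convolution_normed_sub [CompleteSpace W] {F : E → W} {p : ℝ≥0∞} (hp : 1 ≤ p)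
    (hp' : p ≠ ⊤) (hF : MemLp F p) {φ : ℕ → ContDiffBump (0 : E)}
    (hφ : Tendsto (fun n ↦ (φ n).rOut) atTop (𝓝 0)) :
    Tendsto (fun n ↦ eLpNorm (((φ n).normed volume ⋆[lsmul ℝ ℝ, volume] F) - F) p) atTop
      (𝓝 0) := by
  -- Tonelli needs joint measurability of `F (x - t)`, so a strongly measurable representative is
  -- treated first; convolution does not see the difference.
  have key : ∀ {F : E → W}, StronglyMeasurable F → MemLp F p →
      Tendsto (fun n ↦ eLpNorm (((φ n).normed volume ⋆[lsmul ℝ ℝ, volume] F) - F) p) atTop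
      (𝓝 0) := by
    intro F hFm hF
    rw [ENNReal.tendsto_nhds_zero]
    intro ε hε
    obtain ⟨r, hr, hrs⟩ := Metric.eventually_nhds_iff_ball.1
      (ENNReal.tendsto_nhds_zero.1 (tendsto_eLpNorm_translate_sub hp hp' hF) ε hε)
    filter_upwards [hφ.eventually (gt_mem_nhds hr)] with n hn
    exact eLpNorm_convolution_normed_sub_le_of_stronglyMeasurable (φ n) hFm hp hp'
      (hF.locallyIntegrable hp) fun t ht ↦ hrs t (Metric.ball_subset_ball hn.le ht)
  have hmk := hF.1.ae_eq_mk
  refine (key hF.1.stronglyMeasurable_mk ((memLp_congr_ae hmk).1 hF)).congr fun n ↦ ?_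
  refine eLpNorm_congr_ae ?_
  rw [convolution_congr (L := lsmul ℝ ℝ) (f' := (φ n).normed volume) EventuallyEq.rfl hmk]
  exact EventuallyEq.rfl.sub hmk.symm

end WeakDerivative

/-! ### Lipschitz test functions and the product rule -/

section WeakDerivativeProduct

open Function ContinuousLinearMap
open scoped Convolution

variable {E : Type*} [NormedAddCommGroup E] [InnerProductSpace ℝ E] [FiniteDimensional ℝ E]
  [MeasurableSpace E] [BorelSpace E]
  {W : Type*} [NormedAddCommGroup W] [NormedSpace ℝ W]

omit [InnerProductSpace ℝ E] [FiniteDimensional ℝ E] [MeasurableSpace E] [BorelSpace E] in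
-- The bounded ratio of outer and inner radii serves the almost everywhere convergence of
-- mollifications of locally integrable functions.
lemma exists_contDiffBump_seq {δ : ℝ} (hδ : 0 < δ) : ∃ φ : ℕ → ContDiffBump (0 : E),
    Tendsto (fun n ↦ (φ n).rOut) atTop (𝓝 0) ∧ (∀ n, (φ n).rOut ≤ δ) ∧
      ∀ n, (φ n).rOut ≤ 2 * (φ n).rIn := by
  refine ⟨fun n ↦ ⟨δ / (n + 1) / 2, δ / (n + 1), by positivity, half_lt_self (by positivity)⟩,
    ?_, fun n ↦ ?_, fun n ↦ ?_⟩
  · have := (tendsto_one_div_add_atTop_nhds_zero_nat (𝕜 := ℝ)).const_mul δ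
    simpa [div_eq_mul_inv] using this
  · exact div_le_self hδ.le (by linarith [(Nat.cast_nonneg n : (0 : ℝ) ≤ n)])
  · simp only; linarith

lemma _root_.LocallyLipschitz.real_mul {X : Type*} [PseudoEMetricSpace X] {f g : X → ℝ}
    (hf : LocallyLipschitz f) (hg : LocallyLipschitz g) : LocallyLipschitz (f * g) := by
  have h : ContDiff ℝ 1 fun q : ℝ × ℝ ↦ q.1 * q.2 := contDiff_mul
  exact h.locallyLipschitz.comp (hf.prodMk hg)

omit [MeasurableSpace E] [BorelSpace E] in
/-- A function with compact support that is locally Lipschitz around its support is Lipschitz. -/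
lemma exists_lipschitzWith_of_locallyLipschitzOn {h : E → ℝ} {U K : Set E} (hU : IsOpen U)
    (hK : IsCompact K) (hKU : K ⊆ U) (hh : LocallyLipschitzOn U h) (h0 : ∀ x ∉ K, h x = 0) :
    ∃ C, LipschitzWith C h := by
  have hloc : LocallyLipschitz h := by
    intro x
    by_cases hx : x ∈ U
    · obtain ⟨C, t, ht, hC⟩ := hh hx
      exact ⟨C, t, (nhdsWithin_eq_nhds.2 (hU.mem_nhds hx)) ▸ ht, hC⟩
    · refine ⟨0, Kᶜ, hK.isClosed.isOpen_compl.mem_nhds fun h ↦ hx (hKU h), ?_⟩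
      refine LipschitzOnWith.of_dist_le_mul fun y hy z hz ↦ ?_
      rw [h0 y hy, h0 z hz]; simp
  obtain ⟨R, hR⟩ := hK.isBounded.subset_closedBall 0
  obtain ⟨C, hC⟩ := (hloc.locallyLipschitzOn (s := Metric.closedBall (0 : E)
    (R + 1))).exists_lipschitzOnWith_of_compact (isCompact_closedBall _ _)
  obtain ⟨D, hD⟩ := hK.exists_bound_of_continuousOn hloc.continuous.continuousOn
  have hD' : ∀ x, ‖h x‖ ≤ max D 0 := fun x ↦ by
    by_cases hx : x ∈ K
    · exact (hD x hx).trans (le_max_left _ _)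
    · rw [h0 x hx]; simp
  -- Nearby points lie in a compact ball, where locally Lipschitz implies Lipschitz. Points far from
  -- `K` have distance at least `1` from `x`, so the sup bound of `h` does the work.
  have key : ∀ x y, x ∈ K → dist (h x) (h y) ≤ max (C : ℝ) (max D 0) * dist x y := by
    intro x y hx
    have hxR : ‖x‖ ≤ R := by simpa using hR hx
    by_cases hy : ‖y‖ ≤ R + 1
    · refine (hC.dist_le_mul x (by simp; linarith) y (by simpa using hy)).trans ?_
      gcongr
      exact le_max_left _ _
    · have hyK : y ∉ K := fun h ↦ hy (by
        have : ‖y‖ ≤ R := by simpa using hR h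
        linarith)
      have h1 : 1 ≤ dist x y := by
        have := norm_sub_norm_le y x
        rw [dist_comm, dist_eq_norm]; push Not at hy; linarith
      rw [h0 y hyK, dist_zero_right]
      calc ‖h x‖ ≤ max D 0 := hD' x
        _ ≤ max (C : ℝ) (max D 0) := le_max_right _ _
        _ ≤ max (C : ℝ) (max D 0) * dist x y :=
            le_mul_of_one_le_right ((le_max_right D 0).trans (le_max_right _ _)) h1
  refine ⟨(max C (max D 0) : ℝ).toNNReal, LipschitzWith.of_dist_le_mul fun x y ↦ ?_⟩
  rw [Real.coe_toNNReal _ ((NNReal.coe_nonneg C).trans (le_max_left _ _))]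
  by_cases hx : x ∈ K
  · exact key x y hx
  · by_cases hy : y ∈ K
    · rw [dist_comm, dist_comm x]; exact key y x hy
    · rw [h0 x hx, h0 y hy, dist_self]
      exact mul_nonneg ((NNReal.coe_nonneg C).trans (le_max_left _ _)) dist_nonneg

lemma hasWeakDeriv_lineDeriv {ζ : E → ℝ} {C : NNReal} (hζ : LipschitzWith C ζ) (v : E) :
    HasWeakDeriv univ ζ (fun y ↦ lineDeriv ℝ ζ y v) v := by
  intro ρ hρ hρc _
  obtain ⟨D, hD⟩ := (hρ.of_le (by simp)).lipschitzWith_of_hasCompactSupport hρc one_ne_zero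
  have := hζ.integral_lineDeriv_mul_eq (μ := volume) hD hρc v
  have h1 : ∀ y, lineDeriv ℝ ρ y (-v) = -fderiv ℝ ρ y v := fun y ↦ by
    rw [((hρ.differentiable (by simp)) y).lineDeriv_eq_fderiv, map_neg]
  simp only [h1, neg_mul, integral_neg] at this
  simp only [smul_eq_mul]
  rw [eq_neg_iff_add_eq_zero, ← neg_eq_iff_add_eq_zero, ← this]
  exact integral_congr_ae (Eventually.of_forall fun y ↦ mul_comm _ _)

/-- Lipschitz functions are admissible test functions for weak derivatives. -/
lemma HasWeakDeriv.integral_lineDeriv_smul {U : Set E} (hU : IsOpen U) {F G : E → W} {v : E}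
    (h : HasWeakDeriv U F G v) (hF : LocallyIntegrableOn F U) (hG : LocallyIntegrableOn G U)
    {ζ : E → ℝ} {C : NNReal} (hζ : LipschitzWith C ζ) {K : Set E} (hK : IsCompact K) (hKU : K ⊆ U)
    (h0 : ∀ x ∉ K, ζ x = 0) :
    ∫ y, lineDeriv ℝ ζ y v • F y = -∫ y, ζ y • G y := by
  obtain ⟨δ, hδ, hδU⟩ := hK.exists_cthickening_subset_open hU hKU
  obtain ⟨φ, hφ, hφδ, hφ2⟩ := exists_contDiffBump_seq (E := E) hδ
  set K' := Metric.cthickening δ K with hK'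
  have hK'c : IsCompact K' := hK.cthickening
  have hζi : LocallyIntegrable ζ := hζ.continuous.locallyIntegrable
  -- The mollified test functions are smooth with supports in a fixed compact subset of `U`. They
  -- converge pointwise and their derivatives almost everywhere, under uniform bounds from the
  -- Lipschitz constant, so the identity passes to the limit by dominated convergence.
  set Z : ℕ → E → ℝ := fun n ↦ ((φ n).normed volume ⋆[lsmul ℝ ℝ, volume] ζ) with hZ
  have hZs : ∀ n, ContDiff ℝ ∞ (Z n) := fun n ↦ contDiff_convolution_normed (φ n) hζi
  have hZK : ∀ n, tsupport (Z n) ⊆ K' := fun n ↦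
    (tsupport_convolution_normed_subset (φ n) h0).trans (Metric.cthickening_mono (hφδ n) K)
  have hZc : ∀ n, HasCompactSupport (Z n) := fun n ↦
    HasCompactSupport.of_support_subset_isCompact hK'c (subset_closure.trans (hZK n))
  have hZd : ∀ n x, fderiv ℝ (Z n) x v =
      ((φ n).normed volume ⋆[lsmul ℝ ℝ, volume] fun y ↦ lineDeriv ℝ ζ y v) x := fun n x ↦
    fderiv_convolution_normed (φ n) hζi (hasWeakDeriv_lineDeriv hζ v) x
  have hli : LocallyIntegrable fun y ↦ lineDeriv ℝ ζ y v := hζ.locallyIntegrable_lineDeriv v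
  have ht1 := ContDiffBump.ae_convolution_tendsto_right_of_locallyIntegrable (μ := volume) hφ
    (Eventually.of_forall hφ2) hli
  have ht0 : ∀ x, Tendsto (fun n ↦ Z n x) atTop (𝓝 (ζ x)) :=
    ContDiffBump.convolution_tendsto_right_of_continuous hφ hζ.continuous
  obtain ⟨D, hD⟩ := hK.exists_bound_of_continuousOn hζ.continuous.continuousOn
  have hD' : ∀ x, ‖ζ x‖ ≤ max D 0 := fun x ↦ by
    by_cases hx : x ∈ K
    · exact (hD x hx).trans (le_max_left _ _)
    · rw [h0 x hx]; simp
  have hZ0 : ∀ n, ∀ x ∉ K', Z n x = 0 := fun n x hx ↦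
    image_eq_zero_of_notMem_tsupport fun h ↦ hx (hZK n h)
  have hdZ0 : ∀ n, ∀ x ∉ K', fderiv ℝ (Z n) x v = 0 := fun n x hx ↦ by
    rw [image_eq_zero_of_notMem_tsupport (f := fderiv ℝ (Z n))
      fun h ↦ hx (hZK n (tsupport_fderiv_subset ℝ h)), zero_apply]
  have hFK : IntegrableOn F K' := hF.integrableOn_compact_subset hδU hK'c
  have hGK : IntegrableOn G K' := hG.integrableOn_compact_subset hδU hK'c
  have hζ0 : ∀ x ∉ K', ζ x = 0 := fun x hx ↦ h0 x fun h ↦ hx (Metric.self_subset_cthickening K h)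
  have hdζ0 : ∀ x ∉ K', lineDeriv ℝ ζ x v = 0 := fun x hx ↦ by
    have : ζ =ᶠ[𝓝 x] fun _ ↦ 0 := by
      filter_upwards [hK.isClosed.isOpen_compl.mem_nhds
        fun h ↦ hx (Metric.self_subset_cthickening K h)] with y hy using h0 y hy
    rw [this.lineDeriv_eq]; simp [lineDeriv]
  have hres : ∀ {a : E → ℝ} {A : E → W}, (∀ x ∉ K', a x = 0) →
      ∫ y, a y • A y = ∫ y in K', a y • A y := fun h ↦
    (setIntegral_eq_integral_of_forall_compl_eq_zero fun x hx ↦ by rw [h x hx, zero_smul]).symm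
  have key : ∀ n, ∫ y in K', fderiv ℝ (Z n) y v • F y = -∫ y in K', Z n y • G y := by
    intro n
    rw [← hres (hdZ0 n), ← hres (hZ0 n)]
    exact h (Z n) (hZs n) (hZc n) ((hZK n).trans hδU)
  rw [hres hdζ0, hres hζ0]
  have hZdc : ∀ n, Continuous fun y ↦ fderiv ℝ (Z n) y v := fun n ↦
    ((hZs n).continuous_fderiv (by simp)).clm_apply continuous_const
  have l1 : Tendsto (fun n ↦ ∫ y in K', fderiv ℝ (Z n) y v • F y) atTop
      (𝓝 (∫ y in K', lineDeriv ℝ ζ y v • F y)) := by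
    refine tendsto_integral_of_dominated_convergence (fun y ↦ C * ‖v‖ * ‖F y‖)
      (fun n ↦ (hZdc n).aestronglyMeasurable.smul hFK.1) (hFK.norm.const_mul _)
      (fun n ↦ Eventually.of_forall fun y ↦ ?_) ?_
    · rw [norm_smul]
      refine mul_le_mul_of_nonneg_right ?_ (norm_nonneg _)
      rw [hZd]
      exact norm_convolution_normed_le (φ n)
        (fun y ↦ norm_lineDeriv_le_of_lipschitz ℝ hζ) y
    · refine ae_restrict_of_ae ?_
      filter_upwards [ht1] with y hy
      simp only [hZd]
      exact hy.smul_const _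
  have l2 : Tendsto (fun n ↦ ∫ y in K', Z n y • G y) atTop (𝓝 (∫ y in K', ζ y • G y)) := by
    refine tendsto_integral_of_dominated_convergence (fun y ↦ max D 0 * ‖G y‖)
      (fun n ↦ (hZs n).continuous.aestronglyMeasurable.smul hGK.1) (hGK.norm.const_mul _)
      (fun n ↦ Eventually.of_forall fun y ↦ ?_)
      (Eventually.of_forall fun y ↦ (ht0 y).smul_const _)
    rw [norm_smul]
    exact mul_le_mul_of_nonneg_right (norm_convolution_normed_le (φ n) hD' y) (norm_nonneg _)
  simp only [key] at l1
  exact tendsto_nhds_unique l1 l2.neg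

/-- The product rule for weak derivatives and Lipschitz functions. -/
lemma HasWeakDeriv.lipschitz_smul {U : Set E} (hU : IsOpen U) {F G : E → W} {v : E}
    (h : HasWeakDeriv U F G v) (hF : LocallyIntegrableOn F U) (hG : LocallyIntegrableOn G U)
    {θ : E → ℝ} {C : NNReal} (hθ : LipschitzWith C θ) {K : Set E} (hK : IsCompact K) (hKU : K ⊆ U)
    (h0 : ∀ x ∉ K, θ x = 0) :
    HasWeakDeriv univ (fun y ↦ θ y • F y) (fun y ↦ θ y • G y + lineDeriv ℝ θ y v • F y) v := by
  intro ρ hρ hρc _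
  have hρd := hρ.differentiable (by simp)
  have hloc : LocallyLipschitzOn univ (ρ * θ) :=
    (((hρ.of_le (by simp)).locallyLipschitz).real_mul hθ.locallyLipschitz).locallyLipschitzOn
  obtain ⟨D, hD⟩ := exists_lipschitzWith_of_locallyLipschitzOn (h := ρ * θ) isOpen_univ hK
    (subset_univ _) hloc (fun x hx ↦ by simp [h0 x hx])
  -- The product `ρ * θ` serves as a Lipschitz test function; its derivative splits almost
  -- everywhere by Rademacher.
  have h1 := h.integral_lineDeriv_smul hU hF hG hD hK hKU (fun x hx ↦ by simp [h0 x hx])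
  have hae : ∀ᵐ y, lineDeriv ℝ (ρ * θ) y v = ρ y * lineDeriv ℝ θ y v + fderiv ℝ ρ y v * θ y := by
    filter_upwards [hθ.ae_differentiableAt (μ := volume)] with y hy
    rw [((hρd y).mul hy).lineDeriv_eq_fderiv, fderiv_mul (hρd y) hy, hy.lineDeriv_eq_fderiv]
    simp [mul_comm]
  have hFK : IntegrableOn F K := hF.integrableOn_compact_subset hKU hK
  have hGK : IntegrableOn G K := hG.integrableOn_compact_subset hKU hK
  have hdθ0 : ∀ x ∉ K, lineDeriv ℝ θ x v = 0 := fun x hx ↦ by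
    have : θ =ᶠ[𝓝 x] fun _ ↦ 0 := by
      filter_upwards [hK.isClosed.isOpen_compl.mem_nhds hx] with y hy using h0 y hy
    rw [this.lineDeriv_eq]; simp [lineDeriv]
  have hint : ∀ {a : E → ℝ} {A : E → W} {B : ℝ}, IntegrableOn A K → (∀ x ∉ K, a x = 0) →
      AEStronglyMeasurable a volume → (∀ x, ‖a x‖ ≤ B) → Integrable fun y ↦ a y • A y := by
    intro a A B hA ha ham hab
    rw [← integrableOn_iff_integrable_of_support_subset (s := K)]
    · exact hA.bdd_smul B ham.restrict (Eventually.of_forall hab)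
    · intro x hx
      by_contra hxK
      exact hx (by simp [ha x hxK])
  obtain ⟨B, hB⟩ := hρc.exists_bound_of_continuous hρ.continuous
  obtain ⟨B', hB'⟩ := (hρc.fderiv_apply ℝ v).exists_bound_of_continuous
    ((hρ.continuous_fderiv (by simp)).clm_apply continuous_const)
  obtain ⟨T, hT⟩ : ∃ T, ∀ x, ‖θ x‖ ≤ T :=
    (HasCompactSupport.intro hK h0).exists_bound_of_continuous hθ.continuous
  have hldm : AEStronglyMeasurable (fun y ↦ lineDeriv ℝ θ y v) volume :=
    aestronglyMeasurable_lineDeriv hθ.continuous volume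
  have hρm := hρ.continuous.aestronglyMeasurable (μ := (volume : Measure E))
  have hθm := hθ.continuous.aestronglyMeasurable (μ := (volume : Measure E))
  have hρdm := ((hρ.continuous_fderiv (by simp)).clm_apply
    (continuous_const (y := v))).aestronglyMeasurable (μ := (volume : Measure E))
  have hmul : ∀ {a b A B : ℝ}, ‖a‖ ≤ A → ‖b‖ ≤ B → ‖a * b‖ ≤ A * B := fun ha hb ↦ by
    rw [norm_mul]
    exact mul_le_mul ha hb (norm_nonneg _) ((norm_nonneg _).trans ha)
  have i1 : Integrable fun y ↦ (ρ y * lineDeriv ℝ θ y v) • F y :=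
    hint hFK (fun x hx ↦ by rw [hdθ0 x hx, mul_zero]) (hρm.mul hldm)
      (fun x ↦ hmul (hB x) (norm_lineDeriv_le_of_lipschitz ℝ hθ))
  have i2 : Integrable fun y ↦ (fderiv ℝ ρ y v * θ y) • F y :=
    hint hFK (fun x hx ↦ by rw [h0 x hx, mul_zero]) (hρdm.mul hθm) (fun x ↦ hmul (hB' x) (hT x))
  have i3 : Integrable fun y ↦ (ρ y * θ y) • G y :=
    hint hGK (fun x hx ↦ by rw [h0 x hx, mul_zero]) (hρm.mul hθm) (fun x ↦ hmul (hB x) (hT x))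
  have e1 : ∫ y, lineDeriv ℝ (ρ * θ) y v • F y =
      (∫ y, (ρ y * lineDeriv ℝ θ y v) • F y) + ∫ y, (fderiv ℝ ρ y v * θ y) • F y := by
    rw [← integral_add i1 i2]
    refine integral_congr_ae (hae.mono fun y hy ↦ ?_)
    simp only [hy, add_smul]
  have e2 : ∫ y, ρ y • (θ y • G y + lineDeriv ℝ θ y v • F y) =
      (∫ y, (ρ y * θ y) • G y) + ∫ y, (ρ y * lineDeriv ℝ θ y v) • F y := by
    rw [← integral_add i3 i1]
    refine integral_congr_ae (Eventually.of_forall fun y ↦ ?_)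
    simp only [smul_add, smul_smul]
  rw [e2]
  simp only [smul_smul]
  rw [e1] at h1
  simp only [Pi.mul_apply] at h1
  rw [neg_add, ← h1]
  abel

/-- Functions in `L^p` with compact support and weak derivatives in `L^p` are approximated by smooth
functions with supports in a fixed neighbourhood. -/
lemma exists_contDiff_eLpNorm_sub_le [CompleteSpace W] {ι : Type*} [Finite ι] {K : Set E}
    {δ : ℝ} (hδ : 0 < δ)
    {H : E → W} {H' : ι → E → W} {v : ι → E} {p : ℝ≥0∞} (hp : 1 ≤ p) (hp' : p ≠ ⊤)
    (hH : MemLp H p) (hH' : ∀ i, MemLp (H' i) p) (h0 : ∀ x ∉ K, H x = 0)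
    (hw : ∀ i, HasWeakDeriv univ H (H' i) (v i)) {ε : ℝ≥0∞} (hε : 0 < ε) :
    ∃ φ : E → W, ContDiff ℝ ∞ φ ∧ tsupport φ ⊆ Metric.cthickening δ K ∧
      eLpNorm (φ - H) p ≤ ε ∧ ∀ i, eLpNorm ((fun y ↦ fderiv ℝ φ y (v i)) - H' i) p ≤ ε := by
  obtain ⟨φ, hφ, hφδ, -⟩ := exists_contDiffBump_seq (E := E) hδ
  have h1 := ENNReal.tendsto_nhds_zero.1
    (tendsto_eLpNorm_convolution_normed_sub hp hp' hH hφ) ε hε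
  have h2 := fun i ↦ ENNReal.tendsto_nhds_zero.1
    (tendsto_eLpNorm_convolution_normed_sub hp hp' (hH' i) hφ) ε hε
  obtain ⟨n, hn1, hn2⟩ := (h1.and (eventually_all.2 h2)).exists
  refine ⟨(φ n).normed volume ⋆[lsmul ℝ ℝ, volume] H,
    contDiff_convolution_normed _ (hH.locallyIntegrable hp),
    (tsupport_convolution_normed_subset (φ n) h0).trans (Metric.cthickening_mono (hφδ n) K),
    hn1, fun i ↦ ?_⟩
  have : (fun y ↦ fderiv ℝ ((φ n).normed volume ⋆[lsmul ℝ ℝ, volume] H) y (v i)) =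
      (φ n).normed volume ⋆[lsmul ℝ ℝ, volume] H' i := funext fun y ↦
    fderiv_convolution_normed (φ n) (hH.locallyIntegrable hp) (hw i) y
  rw [this]
  exact hn2 i

end WeakDerivativeProduct

/-! ### The volume measure in charts -/

section Volume

variable {m : ℕ} {M : Type*} [TopologicalSpace M] [ChartedSpace (EuclideanSpace ℝ (Fin m)) M]
  [IsManifold (𝓡 m) ∞ M] [RiemannianBundle (fun x : M ↦ TangentSpace (𝓡 m) x)]
  [IsContMDiffRiemannianBundle (𝓡 m) ∞ (EuclideanSpace ℝ (Fin m))
    (fun x : M ↦ TangentSpace (𝓡 m) x)]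

local notation "𝔼" => EuclideanSpace ℝ (Fin m)

variable (m) in
/-- The density of the volume measure in the chart around `x`. -/
def chartDensity (x : M) (y : 𝔼) : ℝ := √(chartGram m x y).det

variable (m) in
/-- The volume measure in the chart around `x`, as a measure on the model space. -/
def chartMeasure (x : M) : Measure 𝔼 :=
  ((volume : Measure 𝔼).restrict (extChartAt (𝓡 m) x).target).withDensity
    fun y ↦ ENNReal.ofReal (chartDensity m x y)

omit [IsContMDiffRiemannianBundle (𝓡 m) ∞ (EuclideanSpace ℝ (Fin m))
    (fun x : M ↦ TangentSpace (𝓡 m) x)] in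
lemma chartDensity_pos (x : M) {y : 𝔼} (hy : y ∈ (extChartAt (𝓡 m) x).target) :
    0 < chartDensity m x y := Real.sqrt_pos.2 (det_chartGram_pos x hy)

lemma measurableSet_target (x : M) : MeasurableSet (extChartAt (𝓡 m) x).target :=
  (isOpen_target x).measurableSet

lemma aemeasurable_chartDensity (x : M) :
    AEMeasurable (fun y ↦ ENNReal.ofReal (chartDensity m x y))
      (volume.restrict (extChartAt (𝓡 m) x).target) :=
  ((contDiffOn_chartDensity x).continuousOn.aemeasurable (measurableSet_target x)).ennreal_ofReal

lemma chartMeasure_absolutelyContinuous (x : M) :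
    chartMeasure m x ≪ volume.restrict (extChartAt (𝓡 m) x).target :=
  withDensity_absolutelyContinuous _ _

lemma absolutelyContinuous_chartMeasure (x : M) :
    volume.restrict (extChartAt (𝓡 m) x).target ≪ chartMeasure m x := by
  refine withDensity_absolutelyContinuous' (aemeasurable_chartDensity x) ?_
  rw [ae_restrict_iff' (measurableSet_target x)]
  exact Eventually.of_forall fun y hy ↦ (ENNReal.ofReal_pos.2 (chartDensity_pos x hy)).ne'

lemma integral_chartMeasure {W : Type*} [NormedAddCommGroup W] [NormedSpace ℝ W] (x : M)
    (f : 𝔼 → W) : ∫ y, f y ∂chartMeasure m x =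
      ∫ y in (extChartAt (𝓡 m) x).target, chartDensity m x y • f y := by
  rw [chartMeasure, integral_withDensity_eq_integral_toReal_smul₀ (aemeasurable_chartDensity x)
    (by simp)]
  refine integral_congr_ae (Eventually.of_forall fun y ↦ ?_)
  have h : 0 ≤ chartDensity m x y := Real.sqrt_nonneg _
  simp only [ENNReal.toReal_ofReal h]

omit [IsContMDiffRiemannianBundle (𝓡 m) ∞ (EuclideanSpace ℝ (Fin m))
    (fun x : M ↦ TangentSpace (𝓡 m) x)] in
lemma chartDensity_transition (x x' : M) {y : 𝔼} (hy : y ∈ (extChartAt (𝓡 m) x).target)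
    (hy' : (extChartAt (𝓡 m) x).symm y ∈ (chartAt 𝔼 x').source) :
    chartDensity m x y =
      |(fderiv ℝ (transition x x') y).det| * chartDensity m x' (transition x x' y) := by
  rw [chartDensity, det_chartGram_transition x x' hy hy', Real.sqrt_mul (sq_nonneg _),
    Real.sqrt_sq_eq_abs, chartDensity]

variable [MeasurableSpace M] [BorelSpace M]

lemma aemeasurable_extChartAt_symm (x : M) :
    AEMeasurable (extChartAt (𝓡 m) x).symm (chartMeasure m x) :=
  ((continuousOn_extChartAt_symm x).aemeasurable (measurableSet_target x)).mono_ac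
    (chartMeasure_absolutelyContinuous x)

omit [BorelSpace M] in
lemma chartVolume_eq (x : M) :
    chartVolume m x = (chartMeasure m x).map (extChartAt (𝓡 m) x).symm := rfl

lemma chartVolume_apply (x : M) {A : Set M} (hA : MeasurableSet A) : chartVolume m x A =
    ∫⁻ y in (extChartAt (𝓡 m) x).symm ⁻¹' A ∩ (extChartAt (𝓡 m) x).target,
      ENNReal.ofReal (chartDensity m x y) := by
  rw [chartVolume_eq, Measure.map_apply_of_aemeasurable (aemeasurable_extChartAt_symm x) hA,
    chartMeasure, withDensity_apply', Measure.restrict_restrict' (measurableSet_target x)]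

lemma measurableSet_preimage_inter_target (x : M) {A : Set M} (hA : MeasurableSet A) :
    MeasurableSet ((extChartAt (𝓡 m) x).symm ⁻¹' A ∩ (extChartAt (𝓡 m) x).target) := by
  have h : Measurable ((extChartAt (𝓡 m) x).target.domRestrict (extChartAt (𝓡 m) x).symm) :=
    (continuousOn_iff_continuous_domRestrict.1 (continuousOn_extChartAt_symm x)).measurable
  have := (measurableSet_target x).subtype_image (h hA)
  convert this using 1
  ext y
  simp only [mem_inter_iff, mem_preimage, mem_image, Subtype.exists, Set.domRestrict_apply]
  constructor
  · rintro ⟨h1, h2⟩; exact ⟨y, h2, h1, rfl⟩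
  · rintro ⟨z, h2, h1, rfl⟩; exact ⟨h1, h2⟩

/-- Change of variables along the transition map, whose Jacobian is exactly the quotient of the two
densities. -/
lemma chartVolume_eq_of_subset (x x' : M) {A : Set M} (hA : MeasurableSet A)
    (hx : A ⊆ (chartAt 𝔼 x).source) (hx' : A ⊆ (chartAt 𝔼 x').source) :
    chartVolume m x A = chartVolume m x' A := by
  rw [chartVolume_apply x hA, chartVolume_apply x' hA]
  have hxs : A ⊆ (extChartAt (𝓡 m) x).source := by rwa [extChartAt_source]
  have hxs' : A ⊆ (extChartAt (𝓡 m) x').source := by rwa [extChartAt_source]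
  set D := (extChartAt (𝓡 m) x).symm ⁻¹' A ∩ (extChartAt (𝓡 m) x).target with hD
  have himg : (extChartAt (𝓡 m) x').symm ⁻¹' A ∩ (extChartAt (𝓡 m) x').target =
      transition x x' '' D := by
    ext z
    constructor
    · rintro ⟨h1, h2⟩
      refine ⟨extChartAt (𝓡 m) x ((extChartAt (𝓡 m) x').symm z), ⟨?_, ?_⟩, ?_⟩
      · rw [mem_preimage, (extChartAt (𝓡 m) x).left_inv (hxs h1)]; exact h1
      · exact (extChartAt (𝓡 m) x).map_source (hxs h1)
      · rw [transition, Function.comp_apply, (extChartAt (𝓡 m) x).left_inv (hxs h1),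
          (extChartAt (𝓡 m) x').right_inv h2]
    · rintro ⟨y, ⟨h1, h2⟩, rfl⟩
      refine ⟨?_, (extChartAt (𝓡 m) x').map_source (hxs' h1)⟩
      rw [mem_preimage, transition, Function.comp_apply,
        (extChartAt (𝓡 m) x').left_inv (hxs' h1)]
      exact h1
  have hinj : InjOn (transition x x') D := by
    rintro y ⟨h1, h2⟩ z ⟨h3, h4⟩ h
    exact (extChartAt (𝓡 m) x).symm.injOn h2 h4 ((extChartAt (𝓡 m) x').injOn (hxs' h1) (hxs' h3) h)
  have hder : ∀ y ∈ D, HasFDerivWithinAt (transition x x') (fderiv ℝ (transition x x') y) D y := by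
    rintro y ⟨h1, h2⟩
    have hd : MDifferentiableAt (𝓡 m) (𝓡 m) (extChartAt (𝓡 m) x')
      ((extChartAt (𝓡 m) x).symm y) := mdifferentiableAt_extChartAt (hx' h1)
    exact (hasFDerivAt_comp_chart x h2 hd).differentiableAt.hasFDerivAt.hasFDerivWithinAt
  rw [himg, lintegral_image_eq_lintegral_abs_det_fderiv_mul volume
    (measurableSet_preimage_inter_target x hA) hder hinj]
  refine setLIntegral_congr_fun (measurableSet_preimage_inter_target x hA) ?_
  rintro y ⟨h1, h2⟩
  simp only
  rw [chartDensity_transition x x' h2 (hx' h1), ENNReal.ofReal_mul (abs_nonneg _)]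

lemma chartVolume_compl_source (x : M) : chartVolume m x (chartAt 𝔼 x).sourceᶜ = 0 := by
  rw [chartVolume_apply x (chartAt 𝔼 x).open_source.measurableSet.compl]
  have : (extChartAt (𝓡 m) x).symm ⁻¹' (chartAt 𝔼 x).sourceᶜ ∩ (extChartAt (𝓡 m) x).target = ∅ := by
    ext y
    simp only [mem_inter_iff, mem_preimage, mem_compl_iff, mem_empty_iff_false, iff_false, not_and]
    intro h1 h2
    have := (extChartAt (𝓡 m) x).map_target h2
    rw [extChartAt_source] at this
    exact h1 this
  rw [this]; simp

/-- The volume measure restricts to `chartVolume` on the domains of the charts. -/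
theorem riemannianVolume_restrict_source (x : M) :
    (riemannianVolume m M).restrict (chartAt 𝔼 x).source = chartVolume m x := by
  set S := (chartAt 𝔼 x).source with hS
  have hSm : MeasurableSet S := (chartAt 𝔼 x).open_source.measurableSet
  -- A candidate upper bound for all chart volumes: on the domain of the chart they agree with
  -- `chartVolume m x`, and off it they are bounded by the supremum. As the volume is the least
  -- upper bound, it is at most `μ`, whose restriction to the domain is `chartVolume m x`.
  set μ := chartVolume m x + (riemannianVolume m M).restrict Sᶜ with hμ
  have hle : riemannianVolume m M ≤ μ := by
    refine iSup_le fun x' ↦ Measure.le_iff.2 fun A hA ↦ ?_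
    have h1 : chartVolume m x' (A ∩ S) ≤ chartVolume m x A := by
      set S' := (chartAt 𝔼 x').source
      have hS' : MeasurableSet S' := (chartAt 𝔼 x').open_source.measurableSet
      have e1 : chartVolume m x' (A ∩ S) = chartVolume m x' (A ∩ S ∩ S') := by
        exact (measure_inter_conull (chartVolume_compl_source x')).symm
      rw [e1, ← chartVolume_eq_of_subset x x' ((hA.inter hSm).inter hS') (fun z hz ↦ hz.1.2)
        fun z hz ↦ hz.2]
      exact measure_mono fun z hz ↦ hz.1.1
    have h2 : chartVolume m x' (A \ S) ≤ riemannianVolume m M (A \ S) :=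
      (le_iSup (fun x : M ↦ chartVolume m x) x') _
    rw [hμ, Measure.add_apply, Measure.restrict_apply hA, ← measure_inter_add_sdiff A hSm]
    exact add_le_add h1 h2
  refine Measure.ext fun A hA ↦ le_antisymm ?_ ?_
  · rw [Measure.restrict_apply hA]
    refine (hle _).trans ?_
    rw [hμ, Measure.add_apply, Measure.restrict_apply (hA.inter hSm)]
    have : A ∩ S ∩ Sᶜ = ∅ := by ext; simp
    rw [this, measure_empty, add_zero]
    exact measure_mono inter_subset_left
  · have h1 : chartVolume m x A = chartVolume m x (A ∩ S) := by
      exact (measure_inter_conull (chartVolume_compl_source x)).symm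
    rw [Measure.restrict_apply hA, h1]
    exact (le_iSup (fun x : M ↦ chartVolume m x) x) _

lemma aemeasurable_extChartAt (x : M) : AEMeasurable (extChartAt (𝓡 m) x)
    ((riemannianVolume m M).restrict (chartAt 𝔼 x).source) := by
  refine ContinuousOn.aemeasurable ?_ (chartAt 𝔼 x).open_source.measurableSet
  have := continuousOn_extChartAt (I := 𝓡 m) x
  rwa [extChartAt_source] at this

lemma map_extChartAt_restrict (x : M) :
    ((riemannianVolume m M).restrict (chartAt 𝔼 x).source).map (extChartAt (𝓡 m) x) =
      chartMeasure m x := by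
  have h := aemeasurable_extChartAt (m := m) x
  rw [riemannianVolume_restrict_source, chartVolume_eq] at h ⊢
  rw [AEMeasurable.map_map_of_aemeasurable h (aemeasurable_extChartAt_symm x)]
  have : (extChartAt (𝓡 m) x) ∘ (extChartAt (𝓡 m) x).symm =ᵐ[chartMeasure m x] id := by
    refine (chartMeasure_absolutelyContinuous x).ae_le ?_
    refine (ae_restrict_iff' (measurableSet_target x)).2 ?_
    exact Eventually.of_forall fun y hy ↦ (extChartAt (𝓡 m) x).right_inv hy
  rw [Measure.map_congr this, Measure.map_id]

/-- Almost everywhere statements on the domain of a chart can be checked in the chart. -/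
lemma ae_restrict_source_iff (x : M) {P : M → Prop} :
    (∀ᵐ p ∂(riemannianVolume m M).restrict (chartAt 𝔼 x).source, P p) ↔
      ∀ᵐ y ∂volume.restrict (extChartAt (𝓡 m) x).target, P ((extChartAt (𝓡 m) x).symm y) := by
  constructor
  · intro h
    rw [riemannianVolume_restrict_source, chartVolume_eq] at h
    exact (absolutelyContinuous_chartMeasure x).ae_le (ae_of_ae_map
      (aemeasurable_extChartAt_symm x) h)
  · intro h
    have h1 := (chartMeasure_absolutelyContinuous x).ae_le h
    rw [← map_extChartAt_restrict] at h1
    have h2 := ae_of_ae_map (aemeasurable_extChartAt x) h1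
    filter_upwards [h2, ae_restrict_mem (chartAt 𝔼 x).open_source.measurableSet] with p hp hps
    rwa [(extChartAt (𝓡 m) x).left_inv (by rwa [extChartAt_source])] at hp

lemma aestronglyMeasurable_restrict_source_iff {W : Type*} [TopologicalSpace W]
    (x : M) {f : M → W} :
    AEStronglyMeasurable f ((riemannianVolume m M).restrict (chartAt 𝔼 x).source) ↔
      AEStronglyMeasurable (fun y ↦ f ((extChartAt (𝓡 m) x).symm y))
        (volume.restrict (extChartAt (𝓡 m) x).target) := by
  constructor
  · intro h
    rw [riemannianVolume_restrict_source, chartVolume_eq] at h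
    exact (h.comp_aemeasurable (aemeasurable_extChartAt_symm x)).mono_ac
      (absolutelyContinuous_chartMeasure x)
  · intro h
    have h1 := h.mono_ac (chartMeasure_absolutelyContinuous x)
    rw [← map_extChartAt_restrict] at h1
    refine (h1.comp_aemeasurable (aemeasurable_extChartAt x)).congr ?_
    filter_upwards [ae_restrict_mem (chartAt 𝔼 x).open_source.measurableSet] with p hps
    rw [Function.comp_apply, (extChartAt (𝓡 m) x).left_inv (by rwa [extChartAt_source])]

lemma setIntegral_source {W : Type*} [NormedAddCommGroup W] [NormedSpace ℝ W] (x : M) {f : M → W}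
    (hf : AEStronglyMeasurable f ((riemannianVolume m M).restrict (chartAt 𝔼 x).source)) :
    ∫ p in (chartAt 𝔼 x).source, f p ∂(riemannianVolume m M) =
      ∫ y in (extChartAt (𝓡 m) x).target,
        chartDensity m x y • f ((extChartAt (𝓡 m) x).symm y) := by
  rw [riemannianVolume_restrict_source, chartVolume_eq] at hf ⊢
  rw [integral_map (aemeasurable_extChartAt_symm x) hf, integral_chartMeasure]

lemma eLpNorm_restrict_source {W : Type*} [NormedAddCommGroup W] (x : M) {f : M → W}
    (hf : AEStronglyMeasurable f ((riemannianVolume m M).restrict (chartAt 𝔼 x).source))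
    (p : ℝ≥0∞) :
    eLpNorm f p ((riemannianVolume m M).restrict (chartAt 𝔼 x).source) =
      eLpNorm (fun y ↦ f ((extChartAt (𝓡 m) x).symm y)) p (chartMeasure m x) := by
  rw [riemannianVolume_restrict_source, chartVolume_eq] at hf ⊢
  exact eLpNorm_map_measure hf (aemeasurable_extChartAt_symm x)

variable (m M) in
lemma exists_seq_iUnion_source [SecondCountableTopology M] [Nonempty M] :
    ∃ c : ℕ → M, ⋃ n, (chartAt 𝔼 (c n)).source = univ := by
  obtain ⟨s, hs, hsu⟩ := countable_cover_nhds fun x : M ↦ chart_source_mem_nhds 𝔼 x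
  have hne : s.Nonempty := by
    by_contra h
    rw [not_nonempty_iff_eq_empty] at h
    simp [h] at hsu
    exact absurd (mem_univ (Classical.arbitrary M)) (by rw [← hsu]; simp)
  obtain ⟨c, rfl⟩ := hs.exists_eq_range hne
  exact ⟨c, by rwa [biUnion_range] at hsu⟩

variable (m) in
/-- Measurability can be checked in charts. -/
lemma aestronglyMeasurable_of_charts [SecondCountableTopology M] {W : Type*} [TopologicalSpace W]
    [TopologicalSpace.PseudoMetrizableSpace W] {f : M → W}
    (h : ∀ x : M, AEStronglyMeasurable (fun y ↦ f ((extChartAt (𝓡 m) x).symm y))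
        (volume.restrict (extChartAt (𝓡 m) x).target)) :
    AEStronglyMeasurable f (riemannianVolume m M) := by
  cases isEmpty_or_nonempty M
  · rw [Measure.eq_zero_of_isEmpty (riemannianVolume m M)]; exact aestronglyMeasurable_zero_measure f
  obtain ⟨c, hc⟩ := exists_seq_iUnion_source m M
  rw [← Measure.restrict_univ (μ := riemannianVolume m M), ← hc, aestronglyMeasurable_iUnion_iff]
  exact fun n ↦ (aestronglyMeasurable_restrict_source_iff (c n)).2 (h (c n))

variable (m) in
/-- Almost everywhere statements can be checked in charts. -/
lemma ae_of_charts [SecondCountableTopology M] {P : M → Prop}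
    (h : ∀ x : M, ∀ᵐ y ∂volume.restrict (extChartAt (𝓡 m) x).target,
      P ((extChartAt (𝓡 m) x).symm y)) :
    ∀ᵐ p ∂riemannianVolume m M, P p := by
  cases isEmpty_or_nonempty M
  · rw [Measure.eq_zero_of_isEmpty (riemannianVolume m M)]; simp
  obtain ⟨c, hc⟩ := exists_seq_iUnion_source m M
  rw [← Measure.restrict_univ (μ := riemannianVolume m M), ← hc, ae_restrict_iUnion_iff]
  exact fun n ↦ (ae_restrict_source_iff (c n)).2 (h (c n))

/-- The volume of a set with compact closure in the domain of a chart is finite. -/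
instance isLocallyFiniteMeasure_riemannianVolume :
    IsLocallyFiniteMeasure (riemannianVolume m M) := by
  refine ⟨fun x ↦ ?_⟩
  have hy : extChartAt (𝓡 m) x x ∈ (extChartAt (𝓡 m) x).target := mem_extChartAt_target x
  have hJ : ContinuousAt (chartDensity m x) (extChartAt (𝓡 m) x x) :=
    (contDiffOn_chartDensity x).continuousOn.continuousAt ((isOpen_target x).mem_nhds hy)
  -- The density is bounded on a small coordinate ball, which has finite Lebesgue measure.
  have hev : ∀ᶠ y in 𝓝 (extChartAt (𝓡 m) x x),
      chartDensity m x y < chartDensity m x (extChartAt (𝓡 m) x x) + 1 :=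
    hJ.eventually (gt_mem_nhds (lt_add_one _))
  obtain ⟨r, hr, hrs⟩ := Metric.mem_nhds_iff.1 hev
  set C := chartDensity m x (extChartAt (𝓡 m) x x) + 1
  set B := Metric.ball (extChartAt (𝓡 m) x x) r
  have hV : (extChartAt (𝓡 m) x).source ∩ extChartAt (𝓡 m) x ⁻¹' B ∈ 𝓝 x :=
    inter_mem (extChartAt_source_mem_nhds x)
      ((continuousAt_extChartAt x) (Metric.ball_mem_nhds _ hr))
  obtain ⟨O, hO, hOo, hxO⟩ := mem_nhds_iff.1 hV
  refine ⟨O, hOo.mem_nhds hxO, ?_⟩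
  have hOs : O ⊆ (chartAt 𝔼 x).source := fun z hz ↦ by
    have := (hO hz).1; rwa [extChartAt_source] at this
  have e1 : riemannianVolume m M O = chartVolume m x O := by
    rw [← riemannianVolume_restrict_source, Measure.restrict_apply hOo.measurableSet,
      inter_eq_left.2 hOs]
  rw [e1, chartVolume_apply x hOo.measurableSet]
  have hsub : (extChartAt (𝓡 m) x).symm ⁻¹' O ∩ (extChartAt (𝓡 m) x).target ⊆ B := by
    rintro y ⟨h1, h2⟩
    have := (hO h1).2
    rwa [mem_preimage, (extChartAt (𝓡 m) x).right_inv h2] at this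
  calc _ ≤ ∫⁻ y in B, ENNReal.ofReal (chartDensity m x y) := lintegral_mono_set hsub
    _ ≤ ∫⁻ _ in B, ENNReal.ofReal C :=
        setLIntegral_mono' Metric.isOpen_ball.measurableSet fun y hy ↦
          ENNReal.ofReal_le_ofReal (hrs hy).le
    _ < ⊤ := by
        rw [setLIntegral_const]
        exact ENNReal.mul_lt_top ENNReal.ofReal_lt_top measure_ball_lt_top

end Volume

/-! ### Measurability and integrability of one-forms -/

section Forms

variable {m : ℕ} {M : Type*} [TopologicalSpace M] [ChartedSpace (EuclideanSpace ℝ (Fin m)) M]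
  [IsManifold (𝓡 m) ∞ M] [RiemannianBundle (fun x : M ↦ TangentSpace (𝓡 m) x)]
  [IsContMDiffRiemannianBundle (𝓡 m) ∞ (EuclideanSpace ℝ (Fin m))
    (fun x : M ↦ TangentSpace (𝓡 m) x)]

local notation "𝔼" => EuclideanSpace ℝ (Fin m)

lemma covectorNorm_eq_sqrt_inner {V : Type*} [NormedAddCommGroup V] [InnerProductSpace ℝ V]
    [FiniteDimensional ℝ V] (β : V →L[ℝ] ℂ) : covectorNorm β = √(covectorInner β β).re := by
  rw [← covectorNorm_sq, Real.sqrt_sq (covectorNorm_nonneg β)]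

lemma covectorInner_zero_left {V : Type*} [NormedAddCommGroup V] [InnerProductSpace ℝ V]
    [FiniteDimensional ℝ V] (α : V →L[ℝ] ℂ) : covectorInner 0 α = 0 := by
  simp [covectorInner]

/-- A complex one-form is continuous if its coefficients in charts are. -/
def IsContinuousForm (α : (x : M) → Covector m x) : Prop :=
  ∀ (x : M) (v : 𝔼), ContinuousOn
    (fun y ↦ α ((extChartAt (𝓡 m) x).symm y) (chartFrame m x y v)) (extChartAt (𝓡 m) x).target

lemma IsContinuousForm.aemeasurableForm {α : (x : M) → Covector m x} (hα : IsContinuousForm α) :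
    AEMeasurableForm α := fun x v ↦
  (hα x v).aestronglyMeasurable (measurableSet_target x)

lemma IsContinuousForm.continuousOn_covectorNorm {α : (x : M) → Covector m x}
    (hα : IsContinuousForm α) (x : M) :
    ContinuousOn (fun y ↦ covectorNorm (α ((extChartAt (𝓡 m) x).symm y)))
      (extChartAt (𝓡 m) x).target := by
  have h : ContinuousOn (fun y ↦ √(∑ j, ∑ k, (((chartGram m x y)⁻¹ j k : ℝ) : ℂ) *
      (conj (α ((extChartAt (𝓡 m) x).symm y) (chartFrame m x y (EuclideanSpace.single j 1))) *
        α ((extChartAt (𝓡 m) x).symm y) (chartFrame m x y (EuclideanSpace.single k 1)))).re)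
      (extChartAt (𝓡 m) x).target := by
    refine (Complex.continuous_re.comp_continuousOn (continuousOn_finsetSum _ fun j _ ↦
      continuousOn_finsetSum _ fun k _ ↦ ?_)).sqrt
    exact (Complex.continuous_ofReal.comp_continuousOn (continuousOn_chartGram_inv x j k)).mul
      ((Complex.continuous_conj.comp_continuousOn (hα x _)).mul (hα x _))
  refine h.congr fun y hy ↦ ?_
  simp only
  rw [covectorNorm_eq_sqrt_inner, covectorInner_chart x hy]

lemma continuous_of_charts {Y : Type*} [TopologicalSpace Y] {f : M → Y}
    (h : ∀ x : M, ContinuousOn (fun y ↦ f ((extChartAt (𝓡 m) x).symm y))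
      (extChartAt (𝓡 m) x).target) : Continuous f := by
  rw [continuous_iff_continuousAt]
  intro x
  have h1 : ContinuousAt (fun y ↦ f ((extChartAt (𝓡 m) x).symm y)) (extChartAt (𝓡 m) x x) :=
    (h x).continuousAt ((isOpen_target x).mem_nhds (mem_extChartAt_target x))
  refine (h1.comp (continuousAt_extChartAt x)).congr ?_
  filter_upwards [extChartAt_source_mem_nhds (I := 𝓡 m) x] with p hp
  rw [Function.comp_apply, (extChartAt (𝓡 m) x).left_inv hp]

lemma IsContinuousForm.continuous_covectorNorm {α : (x : M) → Covector m x}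
    (hα : IsContinuousForm α) : Continuous fun p ↦ covectorNorm (α p) :=
  continuous_of_charts (m := m) hα.continuousOn_covectorNorm

/-- The coefficients arise by applying the smooth form to the smooth coordinate fields. -/
lemma IsTestForm.isContinuousForm {α : (x : M) → Covector m x} (hα : IsTestForm α) :
    IsContinuousForm α := by
  intro x v
  have h1 : ContMDiffOn (𝓡 m) ((𝓡 m).prod 𝓘(ℝ, ℂ)) ∞
      (fun p ↦ TotalSpace.mk' ℂ (E := Bundle.Trivial M ℂ) p (α p (frameField m x v p)))
      (chartAt 𝔼 x).source :=
    ContMDiffOn.clm_bundle_apply (E₂ := Bundle.Trivial M ℂ) hα.1.contMDiffOn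
      (contMDiffOn_frameField x v)
  have h2 : ContinuousOn (fun p ↦ α p (frameField m x v p)) (chartAt 𝔼 x).source := by
    intro p hp
    exact (((contMDiffWithinAt_totalSpace).1 (h1 p hp)).2).continuousWithinAt
  refine (h2.comp (continuousOn_extChartAt_symm x) fun y hy ↦ ?_).congr fun y hy ↦ ?_
  · have := (extChartAt (𝓡 m) x).map_target hy
    rwa [extChartAt_source] at this
  · simp only [Function.comp_apply]
    rw [chartFrame_eq_frameField x hy]

lemma contDiffOn_comp_extChartAt_symm {φ : M → ℂ} (hφ : ContMDiff (𝓡 m) 𝓘(ℝ, ℂ) ∞ φ) (x : M) :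
    ContDiffOn ℝ ∞ (φ ∘ (extChartAt (𝓡 m) x).symm) (extChartAt (𝓡 m) x).target := by
  rw [← contMDiffOn_iff_contDiffOn]
  exact hφ.comp_contMDiffOn (contMDiffOn_extChartAt_symm x)

lemma isContinuousForm_differential {φ : M → ℂ} (hφ : ContMDiff (𝓡 m) 𝓘(ℝ, ℂ) ∞ φ) :
    IsContinuousForm (differential m φ) := by
  intro x v
  have h1 := (contDiffOn_comp_extChartAt_symm hφ x).continuousOn_fderiv_of_isOpen
    (isOpen_target x) (by simp)
  refine (h1.clm_apply (continuousOn_const (c := v))).congr fun y hy ↦ ?_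
  exact differential_chartFrame x hy (hφ.mdifferentiable (by simp) _) v

lemma differential_eq_zero_of_notMem_tsupport {φ : M → ℂ} {p : M} (hp : p ∉ tsupport φ) :
    differential m φ p = 0 := by
  have h : φ =ᶠ[𝓝 p] fun _ ↦ 0 := notMem_tsupport_iff_eventuallyEq.1 hp
  have h2 : mfderiv (𝓡 m) 𝓘(ℝ, ℂ) φ p = 0 := by
    rw [h.mfderiv_eq]; exact mfderiv_const
  rw [differential, mvfderiv, h2]
  rfl

variable [MeasurableSpace M] [BorelSpace M] [SecondCountableTopology M]

omit [MeasurableSpace M] [BorelSpace M] [SecondCountableTopology M]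
  [IsContMDiffRiemannianBundle (𝓡 m) ∞ (EuclideanSpace ℝ (Fin m))
    (fun x : M ↦ TangentSpace (𝓡 m) x)] [IsManifold (𝓡 m) ∞ M] in
lemma AEMeasurableForm.sub {β α : (x : M) → Covector m x} (hβ : AEMeasurableForm β)
    (hα : AEMeasurableForm α) : AEMeasurableForm fun x ↦ β x - α x := fun x v ↦
  (hβ x v).sub (hα x v)

lemma AEMeasurableForm.aestronglyMeasurable_covectorInner {β α : (x : M) → Covector m x}
    (hβ : AEMeasurableForm β) (hα : AEMeasurableForm α) :
    AEStronglyMeasurable (fun x ↦ covectorInner (β x) (α x)) (riemannianVolume m M) := by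
  refine aestronglyMeasurable_of_charts m fun x ↦ ?_
  have h : AEStronglyMeasurable (fun y ↦ ∑ j, ∑ k, (((chartGram m x y)⁻¹ j k : ℝ) : ℂ) *
      (conj (β ((extChartAt (𝓡 m) x).symm y) (chartFrame m x y (EuclideanSpace.single j 1))) *
        α ((extChartAt (𝓡 m) x).symm y) (chartFrame m x y (EuclideanSpace.single k 1))))
      (volume.restrict (extChartAt (𝓡 m) x).target) := by
    refine Finset.aestronglyMeasurable_fun_sum _ fun j _ ↦
      Finset.aestronglyMeasurable_fun_sum _ fun k _ ↦ ?_
    exact (Complex.continuous_ofReal.comp_aestronglyMeasurable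
      ((continuousOn_chartGram_inv x j k).aestronglyMeasurable (measurableSet_target x))).mul
      ((Complex.continuous_conj.comp_aestronglyMeasurable (hβ x _)).mul (hα x _))
  refine h.congr ?_
  filter_upwards [ae_restrict_mem (measurableSet_target x)] with y hy
  rw [covectorInner_chart x hy]

lemma AEMeasurableForm.aestronglyMeasurable_covectorNorm {β : (x : M) → Covector m x}
    (hβ : AEMeasurableForm β) :
    AEStronglyMeasurable (fun x ↦ covectorNorm (β x)) (riemannianVolume m M) := by
  simp only [covectorNorm_eq_sqrt_inner]
  exact Real.continuous_sqrt.comp_aestronglyMeasurable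
    (Complex.continuous_re.comp_aestronglyMeasurable (hβ.aestronglyMeasurable_covectorInner hβ))

lemma LocallyIntegrable.covectorNorm_sub {β α : (x : M) → Covector m x}
    (hβm : AEMeasurableForm β) (hαm : AEMeasurableForm α)
    (hβ : LocallyIntegrable (fun x ↦ covectorNorm (β x)) (riemannianVolume m M))
    (hα : LocallyIntegrable (fun x ↦ covectorNorm (α x)) (riemannianVolume m M)) :
    LocallyIntegrable (fun x ↦ covectorNorm (β x - α x)) (riemannianVolume m M) := by
  refine (hβ.add hα).mono (hβm.sub hαm).aestronglyMeasurable_covectorNorm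
    (Eventually.of_forall fun x ↦ ?_)
  rw [Real.norm_of_nonneg (covectorNorm_nonneg _), Pi.add_apply,
    Real.norm_of_nonneg (add_nonneg (covectorNorm_nonneg _) (covectorNorm_nonneg _))]
  exact covectorNorm_sub_le _ _

variable [T2Space M]

lemma sigmaCompactSpace_of_manifold (m : ℕ) (M : Type*) [TopologicalSpace M]
    [ChartedSpace (EuclideanSpace ℝ (Fin m)) M] [SecondCountableTopology M] :
    SigmaCompactSpace M := by
  have : LocallyCompactSpace M := ChartedSpace.locallyCompactSpace (EuclideanSpace ℝ (Fin m)) M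
  infer_instance

/-- The codifferential of a form vanishes outside the support of the form. -/
lemma IsCodifferential.ae_eq_zero {α : (x : M) → Covector m x} {h : M → ℂ}
    (hh : IsCodifferential α h) :
    ∀ᵐ x ∂riemannianVolume m M, x ∈ (closure {x | α x ≠ 0})ᶜ → h x = 0 := by
  have := sigmaCompactSpace_of_manifold m M
  refine IsOpen.ae_eq_zero_of_integral_contMDiff_smul_eq_zero (𝓡 m) isClosed_closure.isOpen_compl
    (hh.1.continuous.locallyIntegrable.locallyIntegrableOn _) fun g hg hgc hgs ↦ ?_
  have hφ : IsTestFunction m fun x ↦ (g x : ℂ) := by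
    refine ⟨?_, ?_⟩
    · exact (Complex.ofRealCLM.contDiff.contMDiff).comp hg
    · exact hgc.comp_left (g := fun r : ℝ ↦ (r : ℂ)) Complex.ofReal_zero
  have key := hh.2 _ hφ
  -- If the support of `g` avoids that of `α`, at each point one of the two covectors vanishes.
  -- Hence the codifferential integrates to zero against all such `g`.
  have h0 : ∀ x, covectorInner (differential m (fun x ↦ (g x : ℂ)) x) (α x) = 0 := by
    intro x
    by_cases hx : x ∈ tsupport g
    · have : α x = 0 := by
        by_contra h
        exact hgs hx (subset_closure h)
      rw [this, covectorInner_zero_right]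
    · rw [differential_eq_zero_of_notMem_tsupport, covectorInner_zero_left]
      intro hx'
      exact hx (closure_mono (fun z hz ↦ by
        rw [Function.mem_support] at hz ⊢
        exact fun h ↦ hz (by rw [h, Complex.ofReal_zero])) hx')
  simp only [h0, integral_zero, Complex.conj_ofReal] at key
  simpa [Complex.real_smul] using key.symm

lemma IsTestForm.exists_covectorNorm_le {α : (x : M) → Covector m x} (hα : IsTestForm α) :
    ∃ C, 0 ≤ C ∧ ∀ x, covectorNorm (α x) ≤ C := by
  obtain ⟨C, hC⟩ := hα.2.exists_bound_of_continuousOn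
    hα.isContinuousForm.continuous_covectorNorm.continuousOn
  refine ⟨max C 0, le_max_right _ _, fun x ↦ ?_⟩
  by_cases hx : x ∈ closure {x | α x ≠ 0}
  · exact (le_abs_self _).trans ((hC x hx).trans (le_max_left _ _))
  · have : α x = 0 := by
      by_contra h
      exact hx (subset_closure h)
    rw [this, covectorNorm_zero]
    exact le_max_right _ _

lemma integrable_covectorInner {β α : (x : M) → Covector m x} (hβm : AEMeasurableForm β)
    (hβ : LocallyIntegrable (fun x ↦ covectorNorm (β x)) (riemannianVolume m M))
    (hα : IsTestForm α) :
    Integrable (fun x ↦ covectorInner (β x) (α x)) (riemannianVolume m M) := by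
  obtain ⟨C, hC0, hC⟩ := hα.exists_covectorNorm_le
  rw [← integrableOn_iff_integrable_of_support_subset (s := closure {x | α x ≠ 0})]
  · refine ((hβ.integrableOn_isCompact hα.2).mul_const C).mono'
      (hβm.aestronglyMeasurable_covectorInner hα.isContinuousForm.aemeasurableForm).restrict
      (Eventually.of_forall fun x ↦ ?_)
    exact (norm_covectorInner_le _ _).trans
      (mul_le_mul_of_nonneg_left (hC x) (covectorNorm_nonneg _))
  · intro x hx
    refine subset_closure fun h ↦ hx ?_
    simp only [h, covectorInner_zero_right]

/-- The codifferential is determined only through its integrals, but it vanishes almost everywhere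
off the compact support of `α`. Hence local integrability of `f` suffices. -/
lemma integrable_conj_mul_codifferential {α : (x : M) → Covector m x} {h f : M → ℂ}
    (hα : IsTestForm α) (hh : IsCodifferential α h)
    (hf : LocallyIntegrable f (riemannianVolume m M)) :
    Integrable (fun x ↦ conj (f x) * h x) (riemannianVolume m M) := by
  set K := closure {x | α x ≠ 0} with hK
  obtain ⟨C, hC⟩ := hα.2.exists_bound_of_continuousOn hh.1.continuous.continuousOn
  have hi : IntegrableOn (fun x ↦ conj (f x) * h x) K (riemannianVolume m M) := by
    refine ((hf.integrableOn_isCompact hα.2).norm.mul_const C).mono'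
      ((Complex.continuous_conj.comp_aestronglyMeasurable hf.aestronglyMeasurable).mul
        hh.1.continuous.aestronglyMeasurable).restrict ?_
    filter_upwards [ae_restrict_mem hα.2.measurableSet] with x hx
    rw [norm_mul, RCLike.norm_conj]
    exact mul_le_mul_of_nonneg_left (hC x hx) (norm_nonneg _)
  refine (hi.integrable_indicator hα.2.measurableSet).congr ?_
  filter_upwards [hh.ae_eq_zero] with x hx
  by_cases hxK : x ∈ K
  · rw [indicator_of_mem hxK]
  · rw [indicator_of_notMem hxK, hx hxK, mul_zero]

/-- Test functions have their differentials as weak differentials. -/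
lemma IsTestFunction.isWeakDifferential {φ : M → ℂ} (hφ : IsTestFunction m φ) :
    IsWeakDifferential φ (differential m φ) :=
  ⟨hφ.1.continuous.locallyIntegrable, (isContinuousForm_differential hφ.1).aemeasurableForm,
    (isContinuousForm_differential hφ.1).continuous_covectorNorm.locallyIntegrable,
    fun _ _ _ hh ↦ hh.2 φ hφ⟩

lemma IsWeakDifferential.sub_differential {f φ : M → ℂ} {β : (x : M) → Covector m x}
    (hf : IsWeakDifferential f β) (hφ : IsTestFunction m φ) :
    IsWeakDifferential (f - φ) fun x ↦ β x - differential m φ x := by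
  have hφ' := hφ.isWeakDifferential
  refine ⟨hf.1.sub hφ'.1, hf.2.1.sub hφ'.2.1,
    LocallyIntegrable.covectorNorm_sub hf.2.1 hφ'.2.1 hf.2.2.1 hφ'.2.2.1, fun α h hα hh ↦ ?_⟩
  simp only [covectorInner_sub_left, Pi.sub_apply, map_sub, sub_mul]
  rw [integral_sub (integrable_covectorInner hf.2.1 hf.2.2.1 hα)
    (integrable_covectorInner hφ'.2.1 hφ'.2.2.1 hα),
    integral_sub (integrable_conj_mul_codifferential hα hh hf.1)
    (integrable_conj_mul_codifferential hα hh hφ'.1), hf.2.2.2 α h hα hh, hφ'.2.2.2 α h hα hh]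

lemma hasCompactSupport_covectorNorm_differential {φ : M → ℂ} (hφ : IsTestFunction m φ) :
    HasCompactSupport fun x ↦ covectorNorm (differential m φ x) :=
  HasCompactSupport.intro hφ.2 fun x hx ↦ by
    rw [differential_eq_zero_of_notMem_tsupport hx, covectorNorm_zero]

/-- Test functions belong to the Sobolev spaces. -/
lemma IsTestFunction.memLp {φ : M → ℂ} (hφ : IsTestFunction m φ) (p : ℝ≥0∞) :
    MemLp φ p (riemannianVolume m M) ∧ MemLpForm (differential m φ) p := by
  refine ⟨hφ.1.continuous.memLp_of_hasCompactSupport hφ.2,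
    (isContinuousForm_differential hφ.1).aemeasurableForm, ?_⟩
  exact ((isContinuousForm_differential hφ.1).continuous_covectorNorm.memLp_of_hasCompactSupport
    (hasCompactSupport_covectorNorm_differential hφ)).2

lemma IsTestFunction.mem_sobolevW {φ : M → ℂ} (hφ : IsTestFunction m φ) (p : ℝ≥0∞) :
    φ ∈ sobolevW m M p :=
  ⟨(hφ.memLp p).1, differential m φ, (hφ.memLp p).2, hφ.isWeakDifferential⟩

end Forms

/-! ### Extending functions from charts by zero -/

section ChartExtension

variable {m : ℕ} {M : Type*} [TopologicalSpace M] [ChartedSpace (EuclideanSpace ℝ (Fin m)) M]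
  {W : Type*} [NormedAddCommGroup W] [NormedSpace ℝ W]

local notation "𝔼" => EuclideanSpace ℝ (Fin m)

variable (m) in
/-- The function on `M` given by `F` in the chart around `x`, and by zero outside its domain. -/
def chartExtension (x : M) (F : 𝔼 → W) : M → W :=
  (chartAt 𝔼 x).source.indicator fun p ↦ F (extChartAt (𝓡 m) x p)

lemma symm_mem_source (x : M) {y : 𝔼} (hy : y ∈ (extChartAt (𝓡 m) x).target) :
    (extChartAt (𝓡 m) x).symm y ∈ (chartAt 𝔼 x).source := by
  have := (extChartAt (𝓡 m) x).map_target hy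
  rwa [extChartAt_source] at this

lemma mem_target (x : M) {p : M} (hp : p ∈ (chartAt 𝔼 x).source) :
    extChartAt (𝓡 m) x p ∈ (extChartAt (𝓡 m) x).target :=
  (extChartAt (𝓡 m) x).map_source (by rwa [extChartAt_source])

lemma symm_extChartAt (x : M) {p : M} (hp : p ∈ (chartAt 𝔼 x).source) :
    (extChartAt (𝓡 m) x).symm (extChartAt (𝓡 m) x p) = p :=
  (extChartAt (𝓡 m) x).left_inv (by rwa [extChartAt_source])

lemma chartExtension_of_mem (x : M) (F : 𝔼 → W) {p : M} (hp : p ∈ (chartAt 𝔼 x).source) :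
    chartExtension m x F p = F (extChartAt (𝓡 m) x p) := indicator_of_mem hp _

lemma chartExtension_of_notMem (x : M) (F : 𝔼 → W) {p : M} (hp : p ∉ (chartAt 𝔼 x).source) :
    chartExtension m x F p = 0 := indicator_of_notMem hp _

lemma chartExtension_symm (x : M) (F : 𝔼 → W) {y : 𝔼} (hy : y ∈ (extChartAt (𝓡 m) x).target) :
    chartExtension m x F ((extChartAt (𝓡 m) x).symm y) = F y := by
  rw [chartExtension_of_mem x F (symm_mem_source x hy), (extChartAt (𝓡 m) x).right_inv hy]

lemma chartExtension_eq_zero (x : M) {F : 𝔼 → W} {K : Set 𝔼} (hF : ∀ y ∉ K, F y = 0) {p : M}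
    (hp : p ∉ (extChartAt (𝓡 m) x).symm '' K) : chartExtension m x F p = 0 := by
  by_cases hps : p ∈ (chartAt 𝔼 x).source
  · rw [chartExtension_of_mem x F hps]
    exact hF _ fun h ↦ hp ⟨_, h, symm_extChartAt x hps⟩
  · exact chartExtension_of_notMem x F hps

lemma isCompact_image_symm (x : M) {K : Set 𝔼} (hK : IsCompact K)
    (hKT : K ⊆ (extChartAt (𝓡 m) x).target) : IsCompact ((extChartAt (𝓡 m) x).symm '' K) :=
  hK.image_of_continuousOn ((continuousOn_extChartAt_symm x).mono hKT)

lemma image_symm_subset_source (x : M) {K : Set 𝔼} (hKT : K ⊆ (extChartAt (𝓡 m) x).target) :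
    (extChartAt (𝓡 m) x).symm '' K ⊆ (chartAt 𝔼 x).source := by
  rintro _ ⟨y, hy, rfl⟩
  exact symm_mem_source x (hKT hy)

variable [IsManifold (𝓡 m) ∞ M] [T2Space M]

/-- Outside the domain of the chart the extension vanishes in a neighbourhood, because the image of
`K` is compact and hence closed in a Hausdorff space. -/
lemma contMDiff_chartExtension (x : M) {F : 𝔼 → W} {K : Set 𝔼} (hK : IsCompact K)
    (hKT : K ⊆ (extChartAt (𝓡 m) x).target) (hF : ∀ y ∉ K, F y = 0)
    (hFs : ContDiffOn ℝ ∞ F (extChartAt (𝓡 m) x).target) :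
    ContMDiff (𝓡 m) 𝓘(ℝ, W) ∞ (chartExtension m x F) := by
  intro p
  by_cases hp : p ∈ (chartAt 𝔼 x).source
  · have h1 : ContMDiffOn (𝓡 m) 𝓘(ℝ, W) ∞ (F ∘ extChartAt (𝓡 m) x) (chartAt 𝔼 x).source :=
      (contMDiffOn_iff_contDiffOn.2 hFs).comp contMDiffOn_extChartAt fun q hq ↦ mem_target x hq
    refine (h1.contMDiffAt ((chartAt 𝔼 x).open_source.mem_nhds hp)).congr_of_eventuallyEq ?_
    filter_upwards [(chartAt 𝔼 x).open_source.mem_nhds hp] with q hq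
    exact chartExtension_of_mem x F hq
  · have hc := (isCompact_image_symm x hK hKT).isClosed
    refine (contMDiffAt_const (c := (0 : W))).congr_of_eventuallyEq ?_
    filter_upwards [hc.isOpen_compl.mem_nhds fun h ↦ hp (image_symm_subset_source x hKT h)] with q hq
    exact chartExtension_eq_zero x hF hq

lemma hasCompactSupport_chartExtension (x : M) {F : 𝔼 → W} {K : Set 𝔼} (hK : IsCompact K)
    (hKT : K ⊆ (extChartAt (𝓡 m) x).target) (hF : ∀ y ∉ K, F y = 0) :
    HasCompactSupport (chartExtension m x F) :=
  HasCompactSupport.intro (isCompact_image_symm x hK hKT) fun _ hp ↦ chartExtension_eq_zero x hF hp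

lemma isTestFunction_chartExtension (x : M) {F : 𝔼 → ℂ} {K : Set 𝔼} (hK : IsCompact K)
    (hKT : K ⊆ (extChartAt (𝓡 m) x).target) (hF : ∀ y ∉ K, F y = 0)
    (hFs : ContDiffOn ℝ ∞ F (extChartAt (𝓡 m) x).target) :
    IsTestFunction m (chartExtension m x F) :=
  ⟨contMDiff_chartExtension x hK hKT hF hFs, hasCompactSupport_chartExtension x hK hKT hF⟩

omit [T2Space M] in
/-- A covector field is smooth if its coefficients with respect to the coordinate frames are. -/
lemma contMDiff_covector_of_frameField {α : (x : M) → Covector m x}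
    (h : ∀ (x : M) (v : 𝔼), ContMDiffAt (𝓡 m) 𝓘(ℝ, ℂ) ∞ (fun p ↦ α p (frameField m x v p)) x) :
    ContMDiff (𝓡 m) ((𝓡 m).prod 𝓘(ℝ, EuclideanSpace ℝ (Fin m) →L[ℝ] ℂ)) ∞
    (fun x ↦ TotalSpace.mk' (EuclideanSpace ℝ (Fin m) →L[ℝ] ℂ)
      (E := fun x : M ↦ TangentSpace (𝓡 m) x →L[ℝ] Bundle.Trivial M ℂ x) x (α x)) := by
  intro x
  rw [contMDiffAt_hom_bundle]
  refine ⟨contMDiffAt_id, ?_⟩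
  set g : M → (𝔼 →L[ℝ] ℂ) := fun p ↦ ContinuousLinearMap.inCoordinates 𝔼 (TangentSpace (𝓡 m)) ℂ
    (Bundle.Trivial M ℂ) x p x p (α p) with hg
  have hgv : ∀ v p, g p v = α p (frameField m x v p) := fun v p ↦ by
    rw [hg]
    exact DFunLike.congr_fun
      (Bundle.Trivial.continuousLinearMapAt_trivialization ℝ M ℂ p) (α p (frameField m x v p))
  have hsum : g = fun p ↦ ∑ i, ContinuousLinearMap.smulRightL ℝ 𝔼 ℂ (EuclideanSpace.proj i)
      (g p (EuclideanSpace.single i 1)) := by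
    funext p
    ext v
    have hv : v = ∑ i, v i • EuclideanSpace.single i (1 : ℝ) := by
      simpa using ((EuclideanSpace.basisFun (Fin m) ℝ).sum_repr v).symm
    conv_lhs => rw [hv]
    simp only [map_sum, map_smul, sum_apply,
      ContinuousLinearMap.smulRightL_apply_apply, ContinuousLinearMap.smulRight_apply]
    rfl
  change ContMDiffAt (𝓡 m) 𝓘(ℝ, 𝔼 →L[ℝ] ℂ) ∞ g x
  rw [hsum]
  refine ContMDiffAt.sum fun i _ ↦ ?_
  simp only [hgv]
  exact (ContinuousLinearMap.contMDiff (L :=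
    ContinuousLinearMap.smulRightL ℝ 𝔼 ℂ (EuclideanSpace.proj i))).contMDiffAt.comp x (h x _)

end ChartExtension

/-! ### Weak differentials as weak derivatives in charts -/

section ChartWeakDerivative

variable {m : ℕ} {M : Type*} [TopologicalSpace M] [ChartedSpace (EuclideanSpace ℝ (Fin m)) M]
  [IsManifold (𝓡 m) ∞ M] [RiemannianBundle (fun x : M ↦ TangentSpace (𝓡 m) x)]

local notation "𝔼" => EuclideanSpace ℝ (Fin m)

variable (m) in
/-- The one-form `(ζ / √g) ⟨∂_v, ·⟩`, for a function `ζ` supported in the chart around `x`. -/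
def coordinateForm (x : M) (ζ : 𝔼 → ℝ) (v : 𝔼) (p : M) : Covector m p :=
  chartExtension m x (fun y ↦ ζ y / chartDensity m x y) p •
    (Complex.ofRealCLM ∘L innerSL ℝ (frameField m x v p))

lemma coordinateForm_eq_zero (x : M) {ζ : 𝔼 → ℝ} (v : 𝔼) {p : M}
    (h : chartExtension m x (fun y ↦ ζ y / chartDensity m x y) p = 0) :
    coordinateForm m x ζ v p = 0 := by
  rw [coordinateForm, h]
  exact zero_smul ℝ (Complex.ofRealCLM ∘L innerSL ℝ (frameField m x v p))

variable (m) in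
/-- The codifferential of `coordinateForm m x ζ v`. -/
def coordinateCodifferential (x : M) (ζ : 𝔼 → ℝ) (v : 𝔼) : M → ℂ :=
  chartExtension m x fun y ↦ ((-(fderiv ℝ ζ y v / chartDensity m x y) : ℝ) : ℂ)

lemma fderiv_apply_eq_zero_of_notMem_tsupport {ζ : 𝔼 → ℝ} {y : 𝔼} (hy : y ∉ tsupport ζ) (v : 𝔼) :
    fderiv ℝ ζ y v = 0 := by
  rw [fderiv_of_notMem_tsupport ℝ hy]; rfl

variable [IsContMDiffRiemannianBundle (𝓡 m) ∞ (EuclideanSpace ℝ (Fin m))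
    (fun x : M ↦ TangentSpace (𝓡 m) x)]

section

variable [T2Space M]

lemma isTestForm_coordinateForm (x : M) {ζ : 𝔼 → ℝ} (hζ : ContDiff ℝ ∞ ζ)
    (hζc : HasCompactSupport ζ) (hζT : tsupport ζ ⊆ (extChartAt (𝓡 m) x).target) (v : 𝔼) :
    IsTestForm (coordinateForm m x ζ v) := by
  have h0 : ∀ y ∉ tsupport ζ, ζ y / chartDensity m x y = 0 := fun y hy ↦ by
    rw [image_eq_zero_of_notMem_tsupport hy, zero_div]
  have hc : ContMDiff (𝓡 m) 𝓘(ℝ, ℝ) ∞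
      (chartExtension m x (fun y ↦ ζ y / chartDensity m x y)) :=
    contMDiff_chartExtension x hζc hζT h0
      (hζ.contDiffOn.div (contDiffOn_chartDensity x) fun y hy ↦ (chartDensity_pos x hy).ne')
  have hK := isCompact_image_symm x hζc hζT
  have hα0 : ∀ p ∉ (extChartAt (𝓡 m) x).symm '' tsupport ζ, coordinateForm m x ζ v p = 0 :=
    fun p hp ↦ coordinateForm_eq_zero x v (chartExtension_eq_zero x h0 hp)
  refine ⟨contMDiff_covector_of_frameField fun x' w ↦ ?_, ?_⟩
  · by_cases hx' : x' ∈ (chartAt 𝔼 x).source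
    · have h1 : ContMDiffAt (𝓡 m) 𝓘(ℝ, ℝ) ∞
          (fun p ↦ inner ℝ (frameField m x v p) (frameField m x' w p)) x' :=
        ContMDiffAt.inner_bundle
          ((contMDiffOn_frameField x v).contMDiffAt ((chartAt 𝔼 x).open_source.mem_nhds hx'))
          ((contMDiffOn_frameField x' w).contMDiffAt (chart_source_mem_nhds 𝔼 x'))
      have h2 := (Complex.ofRealCLM.contMDiff (n := ∞)).contMDiffAt.comp x'
        ((hc x').smul h1)
      refine h2.congr_of_eventuallyEq (Eventually.of_forall fun p ↦ ?_)
      simp [coordinateForm]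
    · refine (contMDiffAt_const (c := (0 : ℂ))).congr_of_eventuallyEq ?_
      filter_upwards [hK.isClosed.isOpen_compl.mem_nhds
        fun h ↦ hx' (image_symm_subset_source x hζT h)] with p hp
      rw [hα0 p hp]; rfl
  · refine hK.of_isClosed_subset isClosed_closure (closure_minimal (fun p hp ↦ ?_) hK.isClosed)
    by_contra h
    exact hp (hα0 p h)

lemma contMDiff_coordinateCodifferential (x : M) {ζ : 𝔼 → ℝ} (hζ : ContDiff ℝ ∞ ζ)
    (hζc : HasCompactSupport ζ) (hζT : tsupport ζ ⊆ (extChartAt (𝓡 m) x).target) (v : 𝔼) :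
    ContMDiff (𝓡 m) 𝓘(ℝ, ℂ) ∞ (coordinateCodifferential m x ζ v) := by
  refine contMDiff_chartExtension x hζc hζT (fun y hy ↦ ?_) ?_
  · rw [fderiv_apply_eq_zero_of_notMem_tsupport hy, zero_div, neg_zero, Complex.ofReal_zero]
  · refine Complex.ofRealCLM.contDiff.comp_contDiffOn (ContDiffOn.neg (ContDiffOn.div ?_
      (contDiffOn_chartDensity x) fun y hy ↦ (chartDensity_pos x hy).ne'))
    exact ((hζ.fderiv_right (m := ∞) (by simp)).clm_apply contDiff_const).contDiffOn

end

variable [MeasurableSpace M] [BorelSpace M] [SecondCountableTopology M]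

/-- The factor $1/\sqrt g$ in the form cancels the volume density, and pairing with
$\langle\partial_v,\cdot\rangle$ extracts the conjugate of the coefficient in the direction `v`. -/
lemma integral_covectorInner_coordinateForm (x : M) {ζ : 𝔼 → ℝ} {β : (x : M) → Covector m x}
    (v : 𝔼)
    (hm : AEStronglyMeasurable (fun p ↦ covectorInner (β p) (coordinateForm m x ζ v p))
      (riemannianVolume m M)) :
    ∫ p, covectorInner (β p) (coordinateForm m x ζ v p) ∂riemannianVolume m M =
      ∫ y in (extChartAt (𝓡 m) x).target,
        ζ y • conj (β ((extChartAt (𝓡 m) x).symm y) (chartFrame m x y v)) := by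
  rw [← setIntegral_eq_integral_of_forall_compl_eq_zero (s := (chartAt 𝔼 x).source),
    setIntegral_source x hm.restrict]
  · refine setIntegral_congr_fun (measurableSet_target x) fun y hy ↦ ?_
    have hJ := (chartDensity_pos x hy).ne'
    simp only [coordinateForm]
    rw [chartExtension_symm x _ hy, covectorInner_flat, chartFrame_eq_frameField x hy]
    rw [← Complex.real_smul, smul_smul, mul_div_cancel₀ _ hJ]
  · intro p hp
    rw [coordinateForm_eq_zero x v (chartExtension_of_notMem x _ hp), covectorInner_zero_right]

lemma integral_conj_mul_coordinateCodifferential (x : M) {ζ : 𝔼 → ℝ} {f : M → ℂ} (v : 𝔼)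
    (hm : AEStronglyMeasurable (fun p ↦ conj (f p) * coordinateCodifferential m x ζ v p)
      (riemannianVolume m M)) :
    ∫ p, conj (f p) * coordinateCodifferential m x ζ v p ∂riemannianVolume m M =
      - ∫ y in (extChartAt (𝓡 m) x).target,
        fderiv ℝ ζ y v • conj (f ((extChartAt (𝓡 m) x).symm y)) := by
  rw [← setIntegral_eq_integral_of_forall_compl_eq_zero (s := (chartAt 𝔼 x).source),
    setIntegral_source x hm.restrict, ← integral_neg]
  · refine setIntegral_congr_fun (measurableSet_target x) fun y hy ↦ ?_
    have hJ := (chartDensity_pos x hy).ne'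
    simp only [coordinateCodifferential]
    rw [chartExtension_symm x _ hy, mul_comm, ← Complex.real_smul, smul_smul, mul_neg,
      mul_div_cancel₀ _ hJ, neg_smul]
  · intro p hp
    rw [coordinateCodifferential, chartExtension_of_notMem x _ hp, mul_zero]

/-- Integration by parts against a function that is differentiable near the support of `ζ`. -/
lemma setIntegral_fderiv_smul_eq_neg {E : Type*} [NormedAddCommGroup E] [NormedSpace ℝ E]
    [FiniteDimensional ℝ E] [MeasurableSpace E] [BorelSpace E] (μ : Measure E)
    [μ.IsAddHaarMeasure] {U : Set E} (hU : IsOpen U) {ζ : E → ℝ} (hζ : ContDiff ℝ ∞ ζ)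
    (hζc : HasCompactSupport ζ) (hζU : tsupport ζ ⊆ U) {F : E → ℂ} (hF : ContDiffOn ℝ ∞ F U)
    (v : E) : ∫ y in U, fderiv ℝ ζ y v • F y ∂μ = - ∫ y in U, ζ y • fderiv ℝ F y v ∂μ := by
  have hG : ContDiff ℝ ∞ fun y ↦ ζ y • F y := by
    rw [contDiff_iff_contDiffAt]
    intro y
    by_cases hy : y ∈ U
    · exact hζ.contDiffAt.smul (hF.contDiffAt (hU.mem_nhds hy))
    · have : (fun y ↦ ζ y • F y) =ᶠ[𝓝 y] fun _ ↦ 0 := by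
        filter_upwards [notMem_tsupport_iff_eventuallyEq.1 fun h ↦ hy (hζU h)] with z hz
        rw [hz, Pi.zero_apply, zero_smul]
      exact contDiffAt_const.congr_of_eventuallyEq this
  have hGc : HasCompactSupport fun y ↦ ζ y • F y := hζc.smul_right
  -- The derivative of a compactly supported smooth function has integral zero, obtained from
  -- integration by parts against the constant `1`.
  have hint : ∫ y, fderiv ℝ (fun y ↦ ζ y • F y) y v ∂μ = 0 := by
    have h1 : Continuous fun y ↦ fderiv ℝ (fun y ↦ ζ y • F y) y v :=
      (hG.continuous_fderiv (by simp)).clm_apply continuous_const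
    have h2 : HasCompactSupport fun y ↦ fderiv ℝ (fun y ↦ ζ y • F y) y v := hGc.fderiv_apply ℝ v
    have := integral_bilinear_hasFDerivAt_right_eq_neg_left_of_integrable (μ := μ) (v := v)
      (B := ContinuousLinearMap.mul ℝ ℂ) (f := fun _ : E ↦ (1 : ℂ)) (f' := 0)
      (g := fun y ↦ ζ y • F y) (by simp)
      (by simpa using h1.integrable_of_hasCompactSupport h2)
      (by simpa using hG.continuous.integrable_of_hasCompactSupport hGc)
      (fun y _ ↦ hasFDerivAt_const _ _) (fun y _ ↦ (hG.differentiable (by simp) y).hasFDerivAt)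
    simpa using this
  have hz : ∀ y ∉ U, fderiv ℝ (fun y ↦ ζ y • F y) y v = 0 := fun y hy ↦ by
    have : y ∉ tsupport fun y ↦ ζ y • F y :=
      fun h ↦ hy (hζU (tsupport_smul_subset_left ζ F h))
    rw [fderiv_of_notMem_tsupport ℝ this]; rfl
  rw [← setIntegral_eq_integral_of_forall_compl_eq_zero hz] at hint
  have hcont : ∀ {h : E → ℂ}, ContinuousOn h U → ∀ {ξ : E → ℝ}, Continuous ξ →
      tsupport ξ ⊆ tsupport ζ → IntegrableOn (fun y ↦ ξ y • h y) U μ := by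
    intro h hh ξ hξ hξs
    have hξc : HasCompactSupport ξ := hζc.of_isClosed_subset (isClosed_tsupport _) hξs
    have hc : Continuous fun y ↦ ξ y • h y :=
      continuous_iff_continuousAt.2 fun y ↦ by
        by_cases hy : y ∈ U
        · exact hξ.continuousAt.smul (hh.continuousAt (hU.mem_nhds hy))
        · have : (fun y ↦ ξ y • h y) =ᶠ[𝓝 y] fun _ ↦ 0 := by
            filter_upwards [notMem_tsupport_iff_eventuallyEq.1 fun h ↦ hy (hζU (hξs h))] with z hz
            rw [hz, Pi.zero_apply, zero_smul]
          exact continuousAt_const.congr this.symm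
    exact (hc.integrable_of_hasCompactSupport hξc.smul_right).integrableOn
  have hsum : ∫ y in U, fderiv ℝ (fun y ↦ ζ y • F y) y v ∂μ =
      ∫ y in U, (fderiv ℝ ζ y v • F y + ζ y • fderiv ℝ F y v) ∂μ := by
    refine setIntegral_congr_fun hU.measurableSet fun y hy ↦ ?_
    have h1 := ((hζ.differentiable (by simp) y).hasFDerivAt).smul
      (((hF.differentiableOn (by simp)).differentiableAt (hU.mem_nhds hy)).hasFDerivAt)
    have h2 := h1.fderiv
    simp only [Pi.smul_def'] at h2
    simp only [h2]
    simp [add_comm]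
  rw [hsum, integral_add] at hint
  · exact eq_neg_of_add_eq_zero_left hint
  · refine hcont hF.continuousOn ((hζ.continuous_fderiv (by simp)).clm_apply continuous_const) ?_
    exact tsupport_fderiv_apply_subset ℝ v
  · exact hcont ((hF.continuousOn_fderiv_of_isOpen hU (by simp)).clm_apply continuousOn_const)
      hζ.continuous subset_rfl

variable [T2Space M]

/-- In coordinates both densities cancel, and the defining identity becomes Euclidean integration by
parts between `ζ` and the conjugate of `φ`. -/
lemma isCodifferential_coordinateForm (x : M) {ζ : 𝔼 → ℝ} (hζ : ContDiff ℝ ∞ ζ)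
    (hζc : HasCompactSupport ζ) (hζT : tsupport ζ ⊆ (extChartAt (𝓡 m) x).target) (v : 𝔼) :
    IsCodifferential (coordinateForm m x ζ v) (coordinateCodifferential m x ζ v) := by
  refine ⟨contMDiff_coordinateCodifferential x hζ hζc hζT v, fun φ hφ ↦ ?_⟩
  have hα := isTestForm_coordinateForm x hζ hζc hζT v
  rw [integral_covectorInner_coordinateForm, integral_conj_mul_coordinateCodifferential]
  · have hF : ContDiffOn ℝ ∞ (fun y ↦ conj (φ ((extChartAt (𝓡 m) x).symm y)))
        (extChartAt (𝓡 m) x).target :=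
      Complex.conjCLE.contDiff.comp_contDiffOn (contDiffOn_comp_extChartAt_symm hφ.1 x)
    rw [setIntegral_fderiv_smul_eq_neg volume (isOpen_target x) hζ hζc hζT hF, neg_neg]
    refine setIntegral_congr_fun (measurableSet_target x) fun y hy ↦ ?_
    rw [differential_chartFrame x hy (hφ.1.mdifferentiable (by simp) _)]
    have h := ((contDiffOn_comp_extChartAt_symm hφ.1 x).differentiableOn
      (by simp)).differentiableAt ((isOpen_target x).mem_nhds hy)
    have h2 := (Complex.conjCLE.toContinuousLinearMap.hasFDerivAt.comp y h.hasFDerivAt).fderiv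
    have h3 : fderiv ℝ (fun y ↦ conj (φ ((extChartAt (𝓡 m) x).symm y))) y =
      Complex.conjCLE.toContinuousLinearMap ∘L
        fderiv ℝ (φ ∘ (extChartAt (𝓡 m) x).symm) y := h2
    rw [h3]
    rfl
  · exact ((Complex.continuous_conj.comp hφ.1.continuous).mul
      (contMDiff_coordinateCodifferential x hζ hζc hζT v).continuous).aestronglyMeasurable
  · exact (isContinuousForm_differential hφ.1).aemeasurableForm.aestronglyMeasurable_covectorInner
      hα.isContinuousForm.aemeasurableForm

/-- A weak differential on the manifold is a weak derivative in charts. -/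
lemma IsWeakDifferential.hasWeakDeriv {f : M → ℂ} {β : (x : M) → Covector m x}
    (hf : IsWeakDifferential f β) (x : M) (v : 𝔼) :
    HasWeakDeriv (extChartAt (𝓡 m) x).target (fun y ↦ f ((extChartAt (𝓡 m) x).symm y))
      (fun y ↦ β ((extChartAt (𝓡 m) x).symm y) (chartFrame m x y v)) v := by
  intro ζ hζ hζc hζT
  have hα := isTestForm_coordinateForm x hζ hζc hζT v
  have hh := isCodifferential_coordinateForm x hζ hζc hζT v
  have key := hf.2.2.2 _ _ hα hh
  rw [integral_covectorInner_coordinateForm x v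
    (integrable_covectorInner hf.2.1 hf.2.2.1 hα).aestronglyMeasurable,
    integral_conj_mul_coordinateCodifferential x v
    (integrable_conj_mul_codifferential hα hh hf.1).aestronglyMeasurable,
    setIntegral_eq_integral_of_forall_compl_eq_zero,
    setIntegral_eq_integral_of_forall_compl_eq_zero] at key
  -- The pairings are antilinear in `β` and `f`, so the identity obtained is the conjugate of the
  -- wanted one; `ζ` is real and unaffected.
  · have h1 : ∀ (r : ℝ) (z : ℂ), r • conj z = conj (r • z) := fun r z ↦ by simp
    simp only [h1, integral_conj] at key
    rw [← map_neg] at key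
    rw [(starRingEnd ℂ).injective key, neg_neg]
  · intro y hy
    rw [fderiv_apply_eq_zero_of_notMem_tsupport fun h ↦ hy (hζT h), zero_smul]
  · intro y hy
    rw [image_eq_zero_of_notMem_tsupport fun h ↦ hy (hζT h), zero_smul]

end ChartWeakDerivative

/-! ### Comparison of norms on the manifold and in charts -/

section ChartComparison

variable {m : ℕ} {M : Type*} [TopologicalSpace M] [ChartedSpace (EuclideanSpace ℝ (Fin m)) M]
  [IsManifold (𝓡 m) ∞ M] [RiemannianBundle (fun x : M ↦ TangentSpace (𝓡 m) x)]
  [IsContMDiffRiemannianBundle (𝓡 m) ∞ (EuclideanSpace ℝ (Fin m))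
    (fun x : M ↦ TangentSpace (𝓡 m) x)]

local notation "𝔼" => EuclideanSpace ℝ (Fin m)

lemma chartMeasure_apply (x : M) {K A : Set 𝔼} (hK : K ⊆ (extChartAt (𝓡 m) x).target) :
    chartMeasure m x (A ∩ K) =
      ∫⁻ y in A ∩ K, ENNReal.ofReal (chartDensity m x y) := by
  rw [chartMeasure, withDensity_apply', Measure.restrict_restrict' (measurableSet_target x),
    inter_assoc, inter_eq_left.2 hK]

/-- The density is continuous and positive on the target, hence bounded below on compact subsets. -/
lemma exists_restrict_le_chartMeasure (x : M) {K : Set 𝔼} (hK : IsCompact K)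
    (hKT : K ⊆ (extChartAt (𝓡 m) x).target) :
    ∃ c : ℝ≥0∞, c ≠ ⊤ ∧ volume.restrict K ≤ c • chartMeasure m x := by
  have hcont : ContinuousOn (fun y ↦ (chartDensity m x y)⁻¹) K :=
    ((contDiffOn_chartDensity x).continuousOn.mono hKT).inv₀
      fun y hy ↦ (chartDensity_pos x (hKT hy)).ne'
  obtain ⟨C, hC⟩ := hK.exists_bound_of_continuousOn hcont
  refine ⟨ENNReal.ofReal C, ENNReal.ofReal_ne_top, Measure.le_iff.2 fun A hA ↦ ?_⟩
  rw [Measure.restrict_apply hA, Measure.smul_apply, smul_eq_mul]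
  refine le_trans ?_ (mul_le_mul_right (measure_mono (inter_subset_left (t := K))) _)
  rw [chartMeasure_apply x hKT, ← lintegral_const_mul' _ _ ENNReal.ofReal_ne_top,
    ← setLIntegral_one]
  refine setLIntegral_mono' (hA.inter hK.measurableSet) fun y hy ↦ ?_
  have hJ := chartDensity_pos x (hKT hy.2)
  have hCy : (chartDensity m x y)⁻¹ ≤ C := (le_abs_self _).trans (hC y hy.2)
  rw [← ENNReal.ofReal_mul ((inv_nonneg.2 hJ.le).trans hCy), ← ENNReal.ofReal_one]
  refine ENNReal.ofReal_le_ofReal ?_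
  rw [← inv_mul_cancel₀ hJ.ne']
  gcongr

lemma exists_chartMeasure_restrict_le (x : M) {K : Set 𝔼} (hK : IsCompact K)
    (hKT : K ⊆ (extChartAt (𝓡 m) x).target) :
    ∃ c : ℝ≥0∞, c ≠ ⊤ ∧ (chartMeasure m x).restrict K ≤ c • volume.restrict K := by
  have hcont : ContinuousOn (fun y ↦ chartDensity m x y) K :=
    (contDiffOn_chartDensity x).continuousOn.mono hKT
  obtain ⟨C, hC⟩ := hK.exists_bound_of_continuousOn hcont
  refine ⟨ENNReal.ofReal C, ENNReal.ofReal_ne_top, Measure.le_iff.2 fun A hA ↦ ?_⟩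
  rw [Measure.restrict_apply hA, Measure.smul_apply, smul_eq_mul, Measure.restrict_apply hA,
    chartMeasure_apply x hKT, ← setLIntegral_const]
  refine setLIntegral_mono' (hA.inter hK.measurableSet) fun y hy ↦ ?_
  exact ENNReal.ofReal_le_ofReal ((le_abs_self _).trans (hC y hy.2))

variable [MeasurableSpace M] [BorelSpace M]

lemma exists_eLpNorm_comp_symm_le {W : Type*} [NormedAddCommGroup W] (x : M) {K : Set 𝔼}
    (hK : IsCompact K) (hKT : K ⊆ (extChartAt (𝓡 m) x).target) {p : ℝ≥0∞} (hp' : p ≠ ⊤) :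
    ∃ C : ℝ≥0∞, C ≠ ⊤ ∧ ∀ g : M → W, AEStronglyMeasurable g (riemannianVolume m M) →
      eLpNorm (fun y ↦ g ((extChartAt (𝓡 m) x).symm y)) p (volume.restrict K) ≤
        C * eLpNorm g p (riemannianVolume m M) := by
  obtain ⟨c, hc, hle⟩ := exists_restrict_le_chartMeasure x hK hKT
  refine ⟨c ^ (1 / p).toReal, ENNReal.rpow_ne_top_of_nonneg ENNReal.toReal_nonneg hc,
    fun g hg ↦ ?_⟩
  refine (eLpNorm_mono_measure _ hle).trans ?_
  rw [eLpNorm_smul_measure_of_ne_top hp', smul_eq_mul, ← eLpNorm_restrict_source x hg.restrict]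
  gcongr
  exact Measure.restrict_le_self

/-- The constant depends on `K` only. It is fixed before the mollification parameter, so that the
chart error can be prescribed in terms of it. -/
lemma exists_eLpNorm_le_of_support {W : Type*} [NormedAddCommGroup W] (x : M) {K : Set 𝔼}
    (hK : IsCompact K) (hKT : K ⊆ (extChartAt (𝓡 m) x).target) {p : ℝ≥0∞} (hp' : p ≠ ⊤) :
    ∃ C : ℝ≥0∞, C ≠ ⊤ ∧ ∀ g : M → W, AEStronglyMeasurable g (riemannianVolume m M) →
      (∀ q ∉ (extChartAt (𝓡 m) x).symm '' K, g q = 0) →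
      eLpNorm g p (riemannianVolume m M) ≤
        C * eLpNorm (fun y ↦ g ((extChartAt (𝓡 m) x).symm y)) p (volume.restrict K) := by
  obtain ⟨c, hc, hle⟩ := exists_chartMeasure_restrict_le x hK hKT
  refine ⟨c ^ (1 / p).toReal, ENNReal.rpow_ne_top_of_nonneg ENNReal.toReal_nonneg hc,
    fun g hg hg0 ↦ ?_⟩
  have h1 : Function.support g ⊆ (chartAt 𝔼 x).source := fun q hq ↦
    image_symm_subset_source x hKT (by_contra fun h ↦ hq (hg0 q h))
  rw [← eLpNorm_restrict_eq_of_support_subset h1, eLpNorm_restrict_source x hg.restrict]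
  have h2 : eLpNorm (fun y ↦ g ((extChartAt (𝓡 m) x).symm y)) p (chartMeasure m x) =
      eLpNorm (fun y ↦ g ((extChartAt (𝓡 m) x).symm y)) p ((chartMeasure m x).restrict K) := by
    rw [← eLpNorm_indicator_eq_eLpNorm_restrict hK.measurableSet]
    refine eLpNorm_congr_ae ((chartMeasure_absolutelyContinuous x).ae_le ?_)
    filter_upwards [ae_restrict_mem (measurableSet_target x)] with y hy
    by_cases hyK : y ∈ K
    · rw [indicator_of_mem hyK]
    · rw [indicator_of_notMem hyK]
      refine hg0 _ ?_
      rintro ⟨z, hz, hzy⟩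
      rw [(extChartAt (𝓡 m) x).symm.injOn (hKT hz) hy hzy] at hz
      exact hyK hz
  rw [h2]
  refine (eLpNorm_mono_measure _ hle).trans_eq ?_
  rw [eLpNorm_smul_measure_of_ne_top hp', smul_eq_mul]

variable [T2Space M]

lemma LocallyIntegrable.comp_extChartAt_symm {W : Type*} [NormedAddCommGroup W] {g : M → W}
    [SecondCountableTopology M]
    (hg : LocallyIntegrable g (riemannianVolume m M)) (x : M) :
    LocallyIntegrableOn (fun y ↦ g ((extChartAt (𝓡 m) x).symm y))
      (extChartAt (𝓡 m) x).target volume := by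
  rw [locallyIntegrableOn_iff (isOpen_target x).isLocallyClosed]
  intro K hKT hK
  obtain ⟨C, hC, h⟩ := exists_eLpNorm_comp_symm_le (W := W) x hK hKT ENNReal.one_ne_top
  have hK' := isCompact_image_symm x hK hKT
  have hi := (hg.integrableOn_isCompact hK').integrable_indicator hK'.measurableSet
  have h1 := h _ hi.aestronglyMeasurable
  have hgm : AEStronglyMeasurable (fun y ↦ g ((extChartAt (𝓡 m) x).symm y)) (volume.restrict K) :=
    ((aestronglyMeasurable_restrict_source_iff x).1 hg.aestronglyMeasurable.restrict).mono_set hKT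
  rw [IntegrableOn, ← memLp_one_iff_integrable]
  refine ⟨hgm, lt_of_le_of_lt ((eLpNorm_congr_ae ?_).trans_le h1)
    (ENNReal.mul_lt_top hC.lt_top (memLp_one_iff_integrable.2 hi).2)⟩
  filter_upwards [ae_restrict_mem hK.measurableSet] with y hy
  rw [indicator_of_mem (mem_image_of_mem _ hy)]

end ChartComparison

/-! ### Covectors and their coefficients over compact sets -/

section CovectorComparison

variable {m : ℕ} {M : Type*} [TopologicalSpace M] [ChartedSpace (EuclideanSpace ℝ (Fin m)) M]
  [IsManifold (𝓡 m) ∞ M] [RiemannianBundle (fun x : M ↦ TangentSpace (𝓡 m) x)]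
  [IsContMDiffRiemannianBundle (𝓡 m) ∞ (EuclideanSpace ℝ (Fin m))
    (fun x : M ↦ TangentSpace (𝓡 m) x)]

local notation "𝔼" => EuclideanSpace ℝ (Fin m)

/-- Over a compact subset of a chart, covectors are controlled by their coefficients. -/
lemma exists_covectorNorm_le_sum (x : M) {K : Set 𝔼} (hK : IsCompact K)
    (hKT : K ⊆ (extChartAt (𝓡 m) x).target) :
    ∃ C : ℝ, 0 ≤ C ∧ ∀ y ∈ K, ∀ β : Covector m ((extChartAt (𝓡 m) x).symm y),
      covectorNorm β ≤ C * ∑ i, ‖β (chartFrame m x y (EuclideanSpace.single i 1))‖ := by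
  have hb : ∀ j k : Fin m, ∃ C, ∀ y ∈ K, ‖(chartGram m x y)⁻¹ j k‖ ≤ C := fun j k ↦
    hK.exists_bound_of_continuousOn ((continuousOn_chartGram_inv x j k).mono hKT)
  choose C hC using hb
  -- A crude common bound for all entries of the inverse Gram matrix on `K`.
  set D := ∑ j, ∑ k, |C j k| with hD
  have hDC : ∀ j k, |C j k| ≤ D := fun j k ↦
    (Finset.single_le_sum (f := fun k ↦ |C j k|) (fun _ _ ↦ abs_nonneg _)
      (Finset.mem_univ k)).trans
    (Finset.single_le_sum (f := fun j ↦ ∑ k, |C j k|)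
      (fun _ _ ↦ Finset.sum_nonneg fun _ _ ↦ abs_nonneg _) (Finset.mem_univ j))
  have hD0 : 0 ≤ D := Finset.sum_nonneg fun _ _ ↦ Finset.sum_nonneg fun _ _ ↦ abs_nonneg _
  refine ⟨√D, Real.sqrt_nonneg _, fun y hy β ↦ ?_⟩
  set b : Fin m → ℝ := fun i ↦ ‖β (chartFrame m x y (EuclideanSpace.single i 1))‖ with hb
  have hs : 0 ≤ ∑ i, b i := Finset.sum_nonneg fun _ _ ↦ norm_nonneg _
  rw [covectorNorm_eq_sqrt_inner, ← Real.sqrt_sq hs, ← Real.sqrt_mul hD0]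
  refine Real.sqrt_le_sqrt ((Complex.re_le_norm _).trans ?_)
  rw [covectorInner_chart x (hKT hy), sq, Finset.sum_mul_sum, Finset.mul_sum]
  refine (norm_sum_le _ _).trans (Finset.sum_le_sum fun j _ ↦ ?_)
  rw [Finset.mul_sum]
  refine (norm_sum_le _ _).trans (Finset.sum_le_sum fun k _ ↦ ?_)
  rw [norm_mul, norm_mul, RCLike.norm_conj, Complex.norm_real]
  gcongr
  exact ((hC j k y hy).trans (le_abs_self _)).trans (hDC j k)

lemma exists_norm_chartFrame_le (x : M) {K : Set 𝔼} (hK : IsCompact K)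
    (hKT : K ⊆ (extChartAt (𝓡 m) x).target) (v : 𝔼) :
    ∃ C : ℝ, 0 ≤ C ∧ ∀ y ∈ K, ‖chartFrame m x y v‖ ≤ C := by
  obtain ⟨C, hC⟩ := hK.exists_bound_of_continuousOn
    ((contDiffOn_chartMetric x v v).continuousOn.sqrt.mono hKT)
  refine ⟨|C|, abs_nonneg _, fun y hy ↦ ?_⟩
  have := (le_abs_self _).trans ((hC y hy).trans (le_abs_self _))
  rwa [chartMetric_self_eq_norm, Real.sqrt_sq (norm_nonneg _)] at this

/-- Over a compact subset of a chart, the coefficients of covectors are controlled by the norm. -/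
lemma exists_norm_apply_chartFrame_le (x : M) {K : Set 𝔼} (hK : IsCompact K)
    (hKT : K ⊆ (extChartAt (𝓡 m) x).target) (v : 𝔼) :
    ∃ C : ℝ, 0 ≤ C ∧ ∀ y ∈ K, ∀ β : Covector m ((extChartAt (𝓡 m) x).symm y),
      ‖β (chartFrame m x y v)‖ ≤ C * covectorNorm β := by
  obtain ⟨C, hC0, hC⟩ := exists_norm_chartFrame_le x hK hKT v
  refine ⟨C, hC0, fun y hy β ↦ (norm_apply_le_covectorNorm _ _).trans ?_⟩
  rw [mul_comm]
  exact mul_le_mul_of_nonneg_right (hC y hy) (covectorNorm_nonneg _)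

variable [MeasurableSpace M] [BorelSpace M] [T2Space M] [SecondCountableTopology M]

lemma locallyIntegrableOn_apply_chartFrame {β : (x : M) → Covector m x} (hβm : AEMeasurableForm β)
    (hβ : LocallyIntegrable (fun x ↦ covectorNorm (β x)) (riemannianVolume m M)) (x : M) (v : 𝔼) :
    LocallyIntegrableOn (fun y ↦ β ((extChartAt (𝓡 m) x).symm y) (chartFrame m x y v))
      (extChartAt (𝓡 m) x).target volume := by
  have h := LocallyIntegrable.comp_extChartAt_symm hβ x
  rw [locallyIntegrableOn_iff (isOpen_target x).isLocallyClosed] at h ⊢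
  intro K hKT hK
  obtain ⟨C, hC0, hC⟩ := exists_norm_apply_chartFrame_le x hK hKT v
  refine ((h K hKT hK).const_mul C).mono' ((hβm x v).mono_set hKT) ?_
  filter_upwards [ae_restrict_mem hK.measurableSet] with y hy
  exact hC y hy _

lemma MemLpForm.memLp_apply_chartFrame {β : (x : M) → Covector m x} {p : ℝ≥0∞}
    (hp' : p ≠ ⊤) (hβ : MemLpForm β p) (x : M) {K : Set 𝔼} (hK : IsCompact K)
    (hKT : K ⊆ (extChartAt (𝓡 m) x).target) (v : 𝔼) :
    MemLp (fun y ↦ β ((extChartAt (𝓡 m) x).symm y) (chartFrame m x y v)) p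
      (volume.restrict K) := by
  obtain ⟨C, hC0, hC⟩ := exists_norm_apply_chartFrame_le x hK hKT v
  obtain ⟨D, hD, h⟩ := exists_eLpNorm_comp_symm_le (W := ℝ) x hK hKT hp'
  have hm := hβ.1.aestronglyMeasurable_covectorNorm
  have h2 : MemLp (fun y ↦ covectorNorm (β ((extChartAt (𝓡 m) x).symm y))) p
      (volume.restrict K) :=
    ⟨((aestronglyMeasurable_restrict_source_iff x).1 hm.restrict).mono_set hKT,
      (h _ hm).trans_lt (ENNReal.mul_lt_top hD.lt_top hβ.2)⟩
  refine (h2.const_mul C).mono' ((hβ.1 x v).mono_set hKT) ?_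
  filter_upwards [ae_restrict_mem hK.measurableSet] with y hy
  exact hC y hy _

end CovectorComparison

/-! ### Differentials of nonsmooth functions -/

section FormAlgebra

variable {m : ℕ} {M : Type*} [TopologicalSpace M] [ChartedSpace (EuclideanSpace ℝ (Fin m)) M]
  [IsManifold (𝓡 m) ∞ M]

local notation "𝔼" => EuclideanSpace ℝ (Fin m)

/-- The differential in a chart, also at points where the function is not differentiable. -/
lemma differential_chartFrame' (φ : M → ℂ) (x : M) {y : 𝔼} (hy : y ∈ (extChartAt (𝓡 m) x).target)
    (v : 𝔼) : differential m φ ((extChartAt (𝓡 m) x).symm y) (chartFrame m x y v) =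
      fderiv ℝ (fun y ↦ φ ((extChartAt (𝓡 m) x).symm y)) y v := by
  by_cases h : MDifferentiableAt (𝓡 m) 𝓘(ℝ, ℂ) φ ((extChartAt (𝓡 m) x).symm y)
  · exact differential_chartFrame x hy h v
  -- Differentiability in the chart and on the manifold are equivalent, so here both derivatives
  -- take the default value zero.
  · have h1 : ¬ DifferentiableAt ℝ (fun y ↦ φ ((extChartAt (𝓡 m) x).symm y)) y := by
      intro hd
      refine h ?_
      have hs := symm_mem_source x hy
      rw [← (extChartAt (𝓡 m) x).right_inv hy] at hd
      have h2 := hd.mdifferentiableAt.comp ((extChartAt (𝓡 m) x).symm y)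
        (mdifferentiableAt_extChartAt (I := 𝓡 m) hs)
      refine h2.congr_of_eventuallyEq ?_
      filter_upwards [(chartAt 𝔼 x).open_source.mem_nhds hs] with q hq
      simp only [Function.comp_apply]
      rw [symm_extChartAt x hq]
    rw [fderiv_zero_of_not_differentiableAt h1, differential, mvfderiv,
      mfderiv_zero_of_not_mdifferentiableAt h]
    rfl

lemma zero_smul_add_smul_zero_sub_zero {V : Type*} [NormedAddCommGroup V] [NormedSpace ℝ V]
    (β : V →L[ℝ] ℂ) (c : ℂ) : (0 : ℂ) • β + c • (0 : V →L[ℝ] ℂ) - 0 = 0 := by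
  ext v; simp

lemma fderiv_ofReal_comp {E : Type*} [NormedAddCommGroup E] [NormedSpace ℝ E] (g : E → ℝ) (y : E) :
    fderiv ℝ (fun y ↦ (g y : ℂ)) y = Complex.ofRealCLM ∘L fderiv ℝ g y := by
  by_cases h : DifferentiableAt ℝ g y
  · exact (Complex.ofRealCLM.hasFDerivAt.comp y h.hasFDerivAt).fderiv
  · rw [fderiv_zero_of_not_differentiableAt h, fderiv_zero_of_not_differentiableAt,
      ContinuousLinearMap.comp_zero]
    exact fun h' ↦ h (Complex.reCLM.differentiableAt.comp y h')

lemma differential_ofReal_chartFrame (θ : M → ℝ) (x : M) {y : 𝔼}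
    (hy : y ∈ (extChartAt (𝓡 m) x).target) (v : 𝔼) :
    differential m (fun q ↦ (θ q : ℂ)) ((extChartAt (𝓡 m) x).symm y) (chartFrame m x y v) =
      (fderiv ℝ (fun y ↦ θ ((extChartAt (𝓡 m) x).symm y)) y v : ℝ) := by
  rw [differential_chartFrame' _ x hy, fderiv_ofReal_comp]; rfl

variable [RiemannianBundle (fun x : M ↦ TangentSpace (𝓡 m) x)]

/-- The derivative of an arbitrary map into a complete space is measurable, with value zero where it
does not exist. This covers the Lipschitz cutoffs. -/
lemma aemeasurableForm_differential (φ : M → ℂ) : AEMeasurableForm (differential m φ) := by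
  intro x v
  refine (measurable_fderiv_apply_const ℝ (fun y ↦ φ ((extChartAt (𝓡 m) x).symm y))
    v).aestronglyMeasurable.congr ?_
  filter_upwards [ae_restrict_mem (isOpen_target x).measurableSet] with y hy
  exact (differential_chartFrame' φ x hy v).symm

omit [IsManifold (𝓡 m) ∞ M] in
lemma AEMeasurableForm.add {β α : (x : M) → Covector m x} (hβ : AEMeasurableForm β)
    (hα : AEMeasurableForm α) : AEMeasurableForm fun x ↦ β x + α x := fun x v ↦
  (hβ x v).add (hα x v)

end FormAlgebra

/-! ### Approximation inside one chart -/

section LocalApproximation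

lemma MemLp.smul_of_support {E : Type*} [MeasurableSpace E] {μ : Measure E} {K : Set E}
    (hK : MeasurableSet K) {F : E → ℂ} {p : ℝ≥0∞} (hF : MemLp F p (μ.restrict K)) {s : E → ℝ}
    (hs : AEStronglyMeasurable s μ) {C : ℝ} (hC : ∀ y, ‖s y‖ ≤ C) (h0 : ∀ y ∉ K, s y = 0) :
    MemLp (fun y ↦ s y • F y) p μ := by
  have h : (fun y ↦ s y • F y) = K.indicator fun y ↦ s y • F y := by
    funext y
    by_cases hy : y ∈ K
    · rw [indicator_of_mem hy]
    · rw [indicator_of_notMem hy, h0 y hy, zero_smul]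
  rw [h, memLp_indicator_iff_restrict hK]
  refine hF.of_le_mul (c := C) (hs.restrict.smul hF.1) (Eventually.of_forall fun y ↦ ?_)
  rw [norm_smul]
  exact mul_le_mul_of_nonneg_right (hC y) (norm_nonneg _)

variable {m : ℕ} {M : Type*} [TopologicalSpace M] [ChartedSpace (EuclideanSpace ℝ (Fin m)) M]
  [IsManifold (𝓡 m) ∞ M] [RiemannianBundle (fun x : M ↦ TangentSpace (𝓡 m) x)]
  [IsContMDiffRiemannianBundle (𝓡 m) ∞ (EuclideanSpace ℝ (Fin m))
    (fun x : M ↦ TangentSpace (𝓡 m) x)]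
  [MeasurableSpace M] [BorelSpace M] [T2Space M] [SecondCountableTopology M]

local notation "𝔼" => EuclideanSpace ℝ (Fin m)

lemma AEMeasurableForm.smul {f : M → ℂ} {β : (x : M) → Covector m x}
    (hf : AEStronglyMeasurable f (riemannianVolume m M)) (hβ : AEMeasurableForm β) :
    AEMeasurableForm fun x ↦ f x • β x := fun x v ↦
  ((aestronglyMeasurable_restrict_source_iff x).1 hf.restrict).mul (hβ x v)

/-- The product of a Sobolev function and a Lipschitz function supported in a chart can be
approximated by test functions. -/
theorem IsWeakDifferential.exists_isTestFunction_approx {f : M → ℂ} {β : (x : M) → Covector m x}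
    (hw : IsWeakDifferential f β) {p : ℝ≥0∞} (hp : 1 ≤ p) (hp' : p ≠ ⊤)
    (hf : MemLp f p (riemannianVolume m M)) (hβ : MemLpForm β p) (x : M) {θ : M → ℝ}
    (hθm : AEStronglyMeasurable θ (riemannianVolume m M))
    (hθ : LocallyLipschitzOn (extChartAt (𝓡 m) x).target
      fun y ↦ θ ((extChartAt (𝓡 m) x).symm y)) {K : Set 𝔼} (hK : IsCompact K)
    (hKT : K ⊆ (extChartAt (𝓡 m) x).target)
    (h0 : ∀ q ∉ (extChartAt (𝓡 m) x).symm '' K, θ q = 0) {ε : ℝ≥0∞} (hε : 0 < ε) :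
    ∃ φ, IsTestFunction m φ ∧
      eLpNorm (fun q ↦ (θ q : ℂ) * f q - φ q) p (riemannianVolume m M) ≤ ε ∧
      formENorm (fun q ↦ (θ q : ℂ) • β q + f q • differential m (fun q ↦ (θ q : ℂ)) q -
        differential m φ q) p ≤ ε := by
  set T := (extChartAt (𝓡 m) x).target with hT
  have hTo : IsOpen T := isOpen_target x
  set ψ := (extChartAt (𝓡 m) x).symm with hψ
  -- The inverse chart has no meaning off the target, so `θ` is transported with the value zero
  -- there; the compact support makes the result globally Lipschitz.
  set h : 𝔼 → ℝ := T.indicator fun y ↦ θ (ψ y) with hh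
  have hhT : ∀ y ∈ T, h y = θ (ψ y) := fun y hy ↦ indicator_of_mem hy _
  have hh0 : ∀ y ∉ K, h y = 0 := by
    intro y hy
    by_cases hyT : y ∈ T
    · rw [hhT y hyT]
      refine h0 _ ?_
      rintro ⟨z, hz, hzy⟩
      exact hy ((extChartAt (𝓡 m) x).symm.injOn (hKT hz) hyT hzy ▸ hz)
    · exact indicator_of_notMem hyT _
  have hhl : LocallyLipschitzOn T h := by
    intro y hy
    obtain ⟨C, t, ht, hC⟩ := hθ hy
    refine ⟨C, t ∩ T, inter_mem ht self_mem_nhdsWithin, fun a ha b hb ↦ ?_⟩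
    rw [hhT a ha.2, hhT b hb.2]
    exact hC ha.1 hb.1
  obtain ⟨L, hL⟩ := exists_lipschitzWith_of_locallyLipschitzOn hTo hK hKT hhl hh0
  set e : Fin m → 𝔼 := fun i ↦ EuclideanSpace.single i 1 with he
  set F : 𝔼 → ℂ := fun y ↦ f (ψ y) with hF
  set G : Fin m → 𝔼 → ℂ := fun i y ↦ β (ψ y) (chartFrame m x y (e i)) with hG
  set H : 𝔼 → ℂ := fun y ↦ h y • F y with hH
  set H' : Fin m → 𝔼 → ℂ := fun i y ↦ h y • G i y + lineDeriv ℝ h y (e i) • F y with hH'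
  have hwd : ∀ i, HasWeakDeriv univ H (H' i) (e i) := fun i ↦
    (hw.hasWeakDeriv x (e i)).lipschitz_smul hTo (LocallyIntegrable.comp_extChartAt_symm hw.1 x)
      (locallyIntegrableOn_apply_chartFrame hw.2.1 hw.2.2.1 x (e i)) hL hK hKT hh0
  have hFm : MemLp F p (volume.restrict K) := by
    obtain ⟨C, hC, hle⟩ := exists_eLpNorm_comp_symm_le (W := ℂ) x hK hKT hp'
    exact ⟨((aestronglyMeasurable_restrict_source_iff x).1 hf.1.restrict).mono_set hKT,
      (hle _ hf.1).trans_lt (ENNReal.mul_lt_top hC.lt_top hf.2)⟩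
  obtain ⟨B, hB⟩ := hL.continuous.bounded_above_of_compact_support
    (HasCompactSupport.intro hK hh0)
  have hHm : MemLp H p := MemLp.smul_of_support hK.measurableSet hFm
    hL.continuous.aestronglyMeasurable hB hh0
  have hH'm : ∀ i, MemLp (H' i) p := fun i ↦ by
    refine MemLp.add (MemLp.smul_of_support hK.measurableSet
      (hβ.memLp_apply_chartFrame hp' x hK hKT (e i)) hL.continuous.aestronglyMeasurable hB hh0)
      (MemLp.smul_of_support hK.measurableSet hFm
        (measurable_lineDeriv hL.continuous).aestronglyMeasurable
        (fun y ↦ norm_lineDeriv_le_of_lipschitz ℝ hL) fun y hy ↦ ?_)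
    have : h =ᶠ[𝓝 y] fun _ ↦ 0 := by
      filter_upwards [hK.isClosed.isOpen_compl.mem_nhds hy] with z hz
      exact hh0 z hz
    rw [this.lineDeriv_eq, lineDeriv, deriv_const]
  obtain ⟨δ, hδ, hδT⟩ := hK.exists_cthickening_subset_open hTo hKT
  set K' := Metric.cthickening δ K with hK'
  have hK'c : IsCompact K' := hK.cthickening
  have hKK' : K ⊆ K' := Metric.self_subset_cthickening K
  obtain ⟨C₁, hC₁, hle₁⟩ := exists_eLpNorm_le_of_support (W := ℂ) x hK'c hδT hp'
  obtain ⟨C₂, hC₂, hle₂⟩ := exists_eLpNorm_le_of_support (W := ℝ) x hK'c hδT hp'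
  obtain ⟨C₃, hC₃, hle₃⟩ := exists_covectorNorm_le_sum x hK'c hδT
  -- The total loss in passing from the Euclidean $L^p$-norms of a function and its `m` partial
  -- derivatives to the norms on the manifold. Mollifying to accuracy `ε / D` compensates it.
  set D : ℝ≥0∞ := C₁ + C₂ * (ENNReal.ofReal C₃ * m) with hD
  have hDt : D ≠ ⊤ := ENNReal.add_ne_top.2 ⟨hC₁, ENNReal.mul_ne_top hC₂
    (ENNReal.mul_ne_top ENNReal.ofReal_ne_top (ENNReal.natCast_ne_top m))⟩
  have hDε : D * (ε / D) ≤ ε := ENNReal.mul_div_le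
  obtain ⟨φ₀, hφ₀, hφ₀s, hφ₀H, hφ₀H'⟩ := exists_contDiff_eLpNorm_sub_le hδ hp hp' hHm hH'm
    (fun y hy ↦ by rw [hH]; simp only [hh0 y hy, zero_smul]) hwd
    (ENNReal.div_pos hε.ne' hDt : 0 < ε / D)
  have hφ₀0 : ∀ y ∉ K', φ₀ y = 0 := fun y hy ↦
    image_eq_zero_of_notMem_tsupport fun h ↦ hy (hφ₀s h)
  have hφ : IsTestFunction m (chartExtension m x φ₀) :=
    isTestFunction_chartExtension x hK'c hδT hφ₀0 hφ₀.contDiffOn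
  set φ := chartExtension m x φ₀ with hφdef
  have hφψ : ∀ y ∈ T, φ (ψ y) = φ₀ y := fun y hy ↦ chartExtension_symm x φ₀ hy
  have hoff : ∀ q ∉ ψ '' K', q ∉ ψ '' K := fun q hq h ↦ hq (image_mono hKK' h)
  have hcl := (isCompact_image_symm x hK'c hδT).isClosed
  refine ⟨φ, hφ, ?_, ?_⟩
  · have hgm : AEStronglyMeasurable (fun q ↦ (θ q : ℂ) * f q - φ q) (riemannianVolume m M) :=
      ((Complex.continuous_ofReal.comp_aestronglyMeasurable hθm).mul hf.1).sub
        hφ.1.continuous.aestronglyMeasurable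
    refine (hle₁ _ hgm fun q hq ↦ ?_).trans ?_
    · rw [h0 q (hoff q hq), hφdef, chartExtension_eq_zero x hφ₀0 hq]; simp
    · have h1 : eLpNorm (fun y ↦ (θ (ψ y) : ℂ) * f (ψ y) - φ (ψ y)) p (volume.restrict K') ≤
          ε / D := by
        refine le_trans (le_of_eq ?_) 
          ((eLpNorm_mono_measure _ (Measure.restrict_le_self (s := K'))).trans hφ₀H)
        rw [← eLpNorm_neg]
        refine eLpNorm_congr_ae ?_
        filter_upwards [ae_restrict_mem hK'c.measurableSet] with y hy
        simp only [Pi.neg_apply, Pi.sub_apply, hH, hF]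
        rw [hφψ y (hδT hy), hhT y (hδT hy), Complex.real_smul, neg_sub]
      refine le_trans ?_ hDε
      gcongr
      exact le_self_add
  · have hγm : AEMeasurableForm fun q ↦ (θ q : ℂ) • β q +
        f q • differential m (fun q ↦ (θ q : ℂ)) q - differential m φ q :=
      ((AEMeasurableForm.smul (Complex.continuous_ofReal.comp_aestronglyMeasurable hθm) hβ.1).add
        (AEMeasurableForm.smul hf.1 (aemeasurableForm_differential _))).sub
        (aemeasurableForm_differential _)
    refine (hle₂ _ hγm.aestronglyMeasurable_covectorNorm fun q hq ↦ ?_).trans ?_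
    · have e1 : differential m (fun q ↦ (θ q : ℂ)) q = 0 := by
        refine differential_eq_zero_of_notMem_tsupport fun hq' ↦ hq ?_
        refine closure_minimal (fun z hz ↦ ?_) hcl hq'
        by_contra hz'
        exact hz (by simp only [h0 z (hoff z hz'), Complex.ofReal_zero])
      have e2 : differential m φ q = 0 := by
        refine differential_eq_zero_of_notMem_tsupport fun hq' ↦ hq ?_
        refine closure_minimal (fun z hz ↦ ?_) hcl hq'
        by_contra hz'
        exact hz (chartExtension_eq_zero x hφ₀0 hz')
      have e3 : ((θ q : ℝ) : ℂ) = 0 := by rw [h0 q (hoff q hq), Complex.ofReal_zero]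
      rw [e1, e2, e3]
      have : (0 : ℂ) • β q + f q • (0 : Covector m q) - 0 = 0 :=
        zero_smul_add_smul_zero_sub_zero _ _
      rw [this, covectorNorm_zero]
    · have h1 : eLpNorm (fun y ↦ covectorNorm ((θ (ψ y) : ℂ) • β (ψ y) +
          f (ψ y) • differential m (fun q ↦ (θ q : ℂ)) (ψ y) - differential m φ (ψ y))) p
          (volume.restrict K') ≤ ENNReal.ofReal C₃ * (m * (ε / D)) := by
        have h2 : eLpNorm (∑ i, fun y ↦ ‖fderiv ℝ φ₀ y (e i) - H' i y‖) p
            (volume.restrict K') ≤ m * (ε / D) := by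
          refine (eLpNorm_sum_le (fun i _ ↦ ?_) hp).trans ?_
          · exact (((hφ₀.continuous_fderiv (by simp)).clm_apply
              continuous_const).aestronglyMeasurable.sub (hH'm i).1).restrict.norm
          · refine (Finset.sum_le_card_nsmul _ _ (ε / D) fun i _ ↦ ?_).trans (by simp)
            rw [eLpNorm_norm]
            exact (eLpNorm_mono_measure _ Measure.restrict_le_self).trans (hφ₀H' i)
        refine le_trans ?_ (mul_le_mul_right h2 _)
        refine eLpNorm_le_mul_eLpNorm_of_ae_le_mul ?_ p
        filter_upwards [ae_restrict_mem hK'c.measurableSet,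
          ae_restrict_of_ae hL.ae_differentiableAt] with y hy hd
        have hyT : y ∈ T := hδT hy
        rw [Real.norm_of_nonneg (covectorNorm_nonneg _), Finset.sum_apply,
          Real.norm_of_nonneg (Finset.sum_nonneg fun _ _ ↦ norm_nonneg _)]
        refine (hle₃ y hy _).trans (mul_le_mul_of_nonneg_left (Finset.sum_le_sum fun i _ ↦ ?_) hC₃)
        -- At points of differentiability, which are almost all by Rademacher, the line derivative
        -- in the product rule is the coefficient of the pointwise differential of `θ`.
        have e1 : differential m (fun q ↦ (θ q : ℂ)) (ψ y) (chartFrame m x y (e i)) =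
            (lineDeriv ℝ h y (e i) : ℝ) := by
          rw [differential_ofReal_chartFrame θ x hyT, hd.lineDeriv_eq_fderiv]
          have : (fun y ↦ θ (ψ y)) =ᶠ[𝓝 y] h := by
            filter_upwards [hTo.mem_nhds hyT] with z hz
            exact (hhT z hz).symm
          rw [this.fderiv_eq]
        have e2 : differential m φ (ψ y) (chartFrame m x y (e i)) = fderiv ℝ φ₀ y (e i) := by
          rw [differential_chartFrame' φ x hyT]
          have : (fun y ↦ φ (ψ y)) =ᶠ[𝓝 y] φ₀ := by
            filter_upwards [hTo.mem_nhds hyT] with z hz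
            exact hφψ z hz
          rw [this.fderiv_eq]
        have e3 : ((θ (ψ y) : ℂ) • β (ψ y) + f (ψ y) • differential m (fun q ↦ (θ q : ℂ)) (ψ y) -
            differential m φ (ψ y)) (chartFrame m x y (e i)) =
            (θ (ψ y) : ℂ) * G i y + F y *
              differential m (fun q ↦ (θ q : ℂ)) (ψ y) (chartFrame m x y (e i)) -
              differential m φ (ψ y) (chartFrame m x y (e i)) := rfl
        refine le_of_eq ?_
        change ‖((θ (ψ y) : ℂ) • β (ψ y) + f (ψ y) • differential m (fun q ↦ (θ q : ℂ)) (ψ y) -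
            differential m φ (ψ y)) (chartFrame m x y (e i))‖ = _
        rw [e3, e1, e2, ← norm_neg]
        congr 1
        simp only [hH', hhT y hyT, Complex.real_smul]
        ring
      refine le_trans (mul_le_mul_right h1 _) (le_trans ?_ hDε)
      rw [← mul_assoc (ENNReal.ofReal C₃), ← mul_assoc C₂]
      gcongr
      exact le_add_self

end LocalApproximation

/-! ### Lipschitz functions on the manifold -/

section LipschitzFunctions

lemma LocallyLipschitzOn.real_mul {X : Type*} [PseudoEMetricSpace X] {s : Set X} {f g : X → ℝ}
    (hf : LocallyLipschitzOn s f) (hg : LocallyLipschitzOn s g) :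
    LocallyLipschitzOn s fun x ↦ f x * g x := by
  rw [locallyLipschitzOn_iff_restrict] at hf hg ⊢
  exact hf.real_mul hg

lemma covectorNorm_sum_le {V : Type*} [NormedAddCommGroup V] [InnerProductSpace ℝ V]
    [FiniteDimensional ℝ V] {ι : Type*} (s : Finset ι) (β : ι → V →L[ℝ] ℂ) :
    covectorNorm (∑ i ∈ s, β i) ≤ ∑ i ∈ s, covectorNorm (β i) :=
  Finset.le_sum_of_subadditive covectorNorm covectorNorm_zero.le covectorNorm_add_le s β

/-- Rademacher's theorem for locally Lipschitz functions on open sets. -/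
lemma ae_differentiableAt_of_locallyLipschitzOn {E : Type*} [NormedAddCommGroup E]
    [NormedSpace ℝ E] [FiniteDimensional ℝ E] [MeasurableSpace E] [BorelSpace E] (μ : Measure E)
    [μ.IsAddHaarMeasure] {U : Set E} (hU : IsOpen U) {h : E → ℝ} (hh : LocallyLipschitzOn U h) :
    ∀ᵐ y ∂μ.restrict U, DifferentiableAt ℝ h y := by
  rw [ae_restrict_iff' hU.measurableSet, ae_iff]
  have : SecondCountableTopology E := inferInstance
  refine measure_null_of_locally_null _ fun y hy ↦ ?_
  simp only [mem_ofPred_eq, Classical.not_imp] at hy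
  obtain ⟨C, t, ht, hC⟩ := hh hy.1
  rw [hU.nhdsWithin_eq hy.1] at ht
  obtain ⟨t', htt', ht'o, hyt'⟩ := mem_nhds_iff.1 ht
  refine ⟨t' ∩ {a | ¬(a ∈ U → DifferentiableAt ℝ h a)},
    inter_mem (mem_nhdsWithin_of_mem_nhds (ht'o.mem_nhds hyt')) self_mem_nhdsWithin, ?_⟩
  have := (hC.mono htt').ae_differentiableWithinAt_of_mem (μ := μ)
  rw [ae_iff] at this
  refine measure_mono_null ?_ this
  rintro a ⟨hat, ha⟩ h'
  exact ha fun _ ↦ (h' hat).differentiableAt (ht'o.mem_nhds hat)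

variable {m : ℕ} {M : Type*} [MetricSpace M] [ChartedSpace (EuclideanSpace ℝ (Fin m)) M]
  [IsManifold (𝓡 m) ∞ M] [RiemannianBundle (fun x : M ↦ TangentSpace (𝓡 m) x)]
  [IsContMDiffRiemannianBundle (𝓡 m) ∞ (EuclideanSpace ℝ (Fin m))
    (fun x : M ↦ TangentSpace (𝓡 m) x)]
  [IsRiemannianManifold (𝓡 m) M]

local notation "𝔼" => EuclideanSpace ℝ (Fin m)

lemma covector_ext (x : M) {y : 𝔼} (hy : y ∈ (extChartAt (𝓡 m) x).target)
    {β α : Covector m ((extChartAt (𝓡 m) x).symm y)}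
    (h : ∀ v, β (chartFrame m x y v) = α (chartFrame m x y v)) : β = α := by
  ext w
  rw [← chartFrame_mfderiv_extChartAt x hy w]
  exact h _

lemma _root_.LipschitzWith.locallyLipschitzOn_comp_extChartAt_symm {u : M → ℝ} {C : NNReal}
    (hu : LipschitzWith C u) (x : M) : LocallyLipschitzOn (extChartAt (𝓡 m) x).target
      fun y ↦ u ((extChartAt (𝓡 m) x).symm y) := by
  intro y hy
  obtain ⟨D, t, ht, hD⟩ := (isMetricChart_extChartAt (m := m) x).locallyLipschitzOn hy
  exact ⟨C * D, t, ht, hu.comp_lipschitzOnWith hD⟩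

/-- The derivative of a Lipschitz function in a chart is bounded by the Lipschitz constant. -/
lemma abs_fderiv_comp_extChartAt_symm_le {u : M → ℝ} {C : NNReal} (hu : LipschitzWith C u) (x : M)
    {y : 𝔼} (hy : y ∈ (extChartAt (𝓡 m) x).target) (v : 𝔼) :
    |fderiv ℝ (fun y ↦ u ((extChartAt (𝓡 m) x).symm y)) y v| ≤ C * ‖chartFrame m x y v‖ := by
  by_cases hd : DifferentiableAt ℝ (fun y ↦ u ((extChartAt (𝓡 m) x).symm y)) y
  swap
  · rw [fderiv_zero_of_not_differentiableAt hd]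
    rw [_root_.zero_apply, abs_zero]
    exact mul_nonneg C.coe_nonneg (norm_nonneg _)
  have hσ : HasDerivAt (fun t : ℝ ↦ y + t • v) v 0 := by
    simpa using ((hasDerivAt_id (0 : ℝ)).smul_const v).const_add y
  -- Along a coordinate line the metric difference quotients tend to the Riemannian norm of the
  -- velocity, while those of `u` are at most `C` times them.
  have h1 := (isMetricChart_extChartAt (m := m) x).tendsto_dist_div hσ (by simpa using hy)
  simp only [zero_smul, add_zero, sub_zero] at h1
  rw [sqrt_chartForm_eq_norm] at h1
  have h2 : HasDerivAt (fun t : ℝ ↦ u ((extChartAt (𝓡 m) x).symm (y + t • v)))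
      (fderiv ℝ (fun y ↦ u ((extChartAt (𝓡 m) x).symm y)) y v) 0 := by
    have h : HasFDerivAt (fun y ↦ u ((extChartAt (𝓡 m) x).symm y))
        (fderiv ℝ (fun y ↦ u ((extChartAt (𝓡 m) x).symm y)) y)
        ((fun t : ℝ ↦ y + t • v) 0) := by
      rw [show (fun t : ℝ ↦ y + t • v) 0 = y by simp]
      exact hd.hasFDerivAt
    exact h.comp_hasDerivAt (0 : ℝ) hσ
  have h3 := (hasDerivAt_iff_tendsto_slope.1 h2).abs
  refine le_of_tendsto_of_tendsto h3 (h1.const_mul (C : ℝ)) ?_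
  filter_upwards [self_mem_nhdsWithin] with t ht
  rw [slope_def_field, abs_div, sub_zero, ← mul_div_assoc]
  refine div_le_div_of_nonneg_right ?_ (abs_nonneg t)
  have := hu.dist_le_mul ((extChartAt (𝓡 m) x).symm (y + t • v)) ((extChartAt (𝓡 m) x).symm y)
  simpa [Real.dist_eq] using this

/-- The differential of a Lipschitz function is bounded by the Lipschitz constant. -/
lemma covectorNorm_differential_le {u : M → ℝ} {C : NNReal} (hu : LipschitzWith C u) (q : M) :
    covectorNorm (differential m (fun q ↦ (u q : ℂ)) q) ≤ C := by
  have key : ∀ (x : M) (y : 𝔼), y ∈ (extChartAt (𝓡 m) x).target →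
      covectorNorm (differential m (fun q ↦ (u q : ℂ)) ((extChartAt (𝓡 m) x).symm y)) ≤ C := by
    intro x y hy
    set D := differential m (fun q ↦ (u q : ℂ)) ((extChartAt (𝓡 m) x).symm y) with hD
    -- The differential is a real covector, so its Hermitian norm is the operator norm, with no loss
    -- from the complexification.
    have h1 : D = Complex.ofRealCLM ∘L (Complex.reCLM ∘L D) := covector_ext x hy fun v ↦ by
      have := differential_ofReal_chartFrame u x hy v
      change D (chartFrame m x y v) = ((D (chartFrame m x y v)).re : ℂ)
      rw [hD, this, Complex.ofReal_re]
    rw [h1]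
    refine covectorNorm_ofReal_le C.coe_nonneg _ fun w ↦ ?_
    rw [← chartFrame_mfderiv_extChartAt x hy w]
    refine le_trans (le_of_eq ?_) (abs_fderiv_comp_extChartAt_symm_le hu x hy _)
    have := differential_ofReal_chartFrame u x hy
      (mfderiv (𝓡 m) (𝓡 m) (extChartAt (𝓡 m) x) ((extChartAt (𝓡 m) x).symm y) w)
    change |(D (chartFrame m x y _)).re| = _
    rw [hD, this, Complex.ofReal_re]
  have h := key q (extChartAt (𝓡 m) q q) (mem_extChartAt_target q)
  rwa [extChartAt_to_inv] at h

variable (m) in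
lemma ae_differentiableAt_comp_extChartAt_symm {u : M → ℝ} {C : NNReal} (hu : LipschitzWith C u)
    (x : M) : ∀ᵐ y ∂volume.restrict (extChartAt (𝓡 m) x).target,
      DifferentiableAt ℝ (fun y ↦ u ((extChartAt (𝓡 m) x).symm y)) y :=
  ae_differentiableAt_of_locallyLipschitzOn volume (isOpen_target x)
    (hu.locallyLipschitzOn_comp_extChartAt_symm x)

lemma contDiffOn_real_comp_extChartAt_symm {ρ : M → ℝ} (hρ : ContMDiff (𝓡 m) 𝓘(ℝ, ℝ) ∞ ρ) (x : M) :
    ContDiffOn ℝ ∞ (fun y ↦ ρ ((extChartAt (𝓡 m) x).symm y)) (extChartAt (𝓡 m) x).target := by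
  rw [← contMDiffOn_iff_contDiffOn]
  exact hρ.comp_contMDiffOn (contMDiffOn_extChartAt_symm x)

lemma locallyLipschitzOn_of_contMDiff {ρ : M → ℝ} (hρ : ContMDiff (𝓡 m) 𝓘(ℝ, ℝ) ∞ ρ) (x : M) :
    LocallyLipschitzOn (extChartAt (𝓡 m) x).target fun y ↦ ρ ((extChartAt (𝓡 m) x).symm y) := by
  intro y hy
  obtain ⟨C, t, ht, hC⟩ := (((contDiffOn_real_comp_extChartAt_symm hρ x).contDiffAt
    ((isOpen_target x).mem_nhds hy)).of_le (m := 1) (by simp)).exists_lipschitzOnWith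
  exact ⟨C, t, mem_nhdsWithin_of_mem_nhds ht, hC⟩

end LipschitzFunctions

/-! ### Gluing the local approximations -/

section CutoffApproximation

lemma IsTestFunction.sum {m : ℕ} {M : Type*} [TopologicalSpace M]
    [ChartedSpace (EuclideanSpace ℝ (Fin m)) M] {ι : Type*} {φ : ι → M → ℂ} (s : Finset ι)
    (h : ∀ i, IsTestFunction m (φ i)) : IsTestFunction m fun q ↦ ∑ i ∈ s, φ i q := by
  classical
  induction s using Finset.induction_on with
  | empty =>
    simp only [Finset.sum_empty]
    exact ⟨contMDiff_const, HasCompactSupport.zero⟩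
  | insert a s ha ih =>
    simp only [Finset.sum_insert ha]
    exact ⟨(h a).1.add ih.1, (h a).2.add ih.2⟩

variable {m : ℕ} {M : Type*} [MetricSpace M] [ChartedSpace (EuclideanSpace ℝ (Fin m)) M]
  [IsManifold (𝓡 m) ∞ M] [RiemannianBundle (fun x : M ↦ TangentSpace (𝓡 m) x)]
  [IsContMDiffRiemannianBundle (𝓡 m) ∞ (EuclideanSpace ℝ (Fin m))
    (fun x : M ↦ TangentSpace (𝓡 m) x)]
  [IsRiemannianManifold (𝓡 m) M] [MeasurableSpace M] [BorelSpace M] [SecondCountableTopology M]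

local notation "𝔼" => EuclideanSpace ℝ (Fin m)

/-- The product of a Sobolev function and a compactly supported Lipschitz function can be
approximated by test functions. -/
theorem IsWeakDifferential.exists_isTestFunction_lipschitz_mul_approx {f : M → ℂ}
    {β : (x : M) → Covector m x} (hw : IsWeakDifferential f β) {p : ℝ≥0∞} (hp : 1 ≤ p)
    (hp' : p ≠ ⊤) (hf : MemLp f p (riemannianVolume m M)) (hβ : MemLpForm β p) {u : M → ℝ}
    {C : NNReal} (hu : LipschitzWith C u) (huc : HasCompactSupport u) {ε : ℝ≥0∞} (hε : 0 < ε) :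
    ∃ φ, IsTestFunction m φ ∧
      eLpNorm (fun q ↦ (u q : ℂ) * f q - φ q) p (riemannianVolume m M) ≤ ε ∧
      formENorm (fun q ↦ (u q : ℂ) • β q + f q • differential m (fun q ↦ (u q : ℂ)) q -
        differential m φ q) p ≤ ε := by
  have := sigmaCompactSpace_of_manifold m M
  set S := tsupport u with hS
  obtain ⟨t, ht⟩ := huc.isCompact.elim_finite_subcover (fun x : M ↦ (chartAt 𝔼 x).source)
    (fun x ↦ (chartAt 𝔼 x).open_source) fun x _ ↦ mem_iUnion.2 ⟨x, mem_chart_source 𝔼 x⟩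
  -- Only finitely many charts meet the argument, by compactness of the support of `u`. The
  -- functions sum to `1` on that support, which suffices because `u` vanishes elsewhere.
  obtain ⟨ρ, hρ⟩ := SmoothPartitionOfUnity.exists_isSubordinate (𝓡 m) (isClosed_tsupport u)
    (fun i : t ↦ (chartAt 𝔼 (i : M)).source) (fun i ↦ (chartAt 𝔼 (i : M)).open_source)
    (by simpa [iUnion_subtype] using ht)
  set θ : t → M → ℝ := fun i q ↦ ρ i q * u q with hθ
  have hθsum : ∀ q, ∑ i, θ i q = u q := fun q ↦ by
    rw [hθ, ← Finset.sum_mul]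
    by_cases hq : q ∈ S
    · have := ρ.sum_eq_one hq
      rw [finsum_eq_sum_of_fintype] at this
      rw [this, one_mul]
    · rw [image_eq_zero_of_notMem_tsupport hq, mul_zero]
  have hρs : ∀ i, ContMDiff (𝓡 m) 𝓘(ℝ, ℝ) ∞ (ρ i) := fun i ↦ (ρ i).contMDiff
  have hθc : ∀ i, Continuous (θ i) := fun i ↦ (hρs i).continuous.mul hu.continuous
  set N : ℝ≥0∞ := ((Fintype.card t + 1 : ℕ) : ℝ≥0∞) with hN
  have hNε : 0 < ε / N := ENNReal.div_pos hε.ne' (ENNReal.natCast_ne_top _)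
  have hcardε : (Fintype.card t : ℝ≥0∞) * (ε / N) ≤ ε := by
    refine le_trans ?_ (ENNReal.mul_div_le (a := N))
    gcongr
    exact Nat.cast_le.2 (Nat.le_succ _)
  have happ : ∀ i : t, ∃ φ, IsTestFunction m φ ∧
      eLpNorm (fun q ↦ (θ i q : ℂ) * f q - φ q) p (riemannianVolume m M) ≤ ε / N ∧
      formENorm (fun q ↦ (θ i q : ℂ) • β q + f q • differential m (fun q ↦ (θ i q : ℂ)) q -
        differential m φ q) p ≤ ε / N := by
    intro i
    have hcomp : IsCompact (tsupport (ρ i) ∩ S) := huc.isCompact.inter_left (isClosed_tsupport _)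
    have hsub : tsupport (ρ i) ∩ S ⊆ (extChartAt (𝓡 m) (i : M)).source := by
      rw [extChartAt_source]
      exact inter_subset_left.trans (hρ i)
    refine hw.exists_isTestFunction_approx hp hp' hf hβ (i : M)
      (hθc i).aestronglyMeasurable
      (LocallyLipschitzOn.real_mul (locallyLipschitzOn_of_contMDiff (hρs i) _)
        (hu.locallyLipschitzOn_comp_extChartAt_symm _))
      (hcomp.image_of_continuousOn ((continuousOn_extChartAt (i : M)).mono hsub)) ?_ ?_ hNε
    · rintro _ ⟨q, hq, rfl⟩
      exact (extChartAt (𝓡 m) (i : M)).map_source (hsub hq)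
    · intro q hq
      by_contra h
      refine hq ⟨_, ⟨q, ⟨?_, ?_⟩, rfl⟩, ?_⟩
      · exact subset_tsupport _ (left_ne_zero_of_mul h)
      · exact subset_tsupport _ (right_ne_zero_of_mul h)
      · exact (extChartAt (𝓡 m) (i : M)).left_inv
          (hsub ⟨subset_tsupport _ (left_ne_zero_of_mul h),
            subset_tsupport _ (right_ne_zero_of_mul h)⟩)
  choose φ hφ hφ1 hφ2 using happ
  have hsum := IsTestFunction.sum Finset.univ hφ
  refine ⟨fun q ↦ ∑ i, φ i q, hsum, ?_, ?_⟩
  · have h1 : (fun q ↦ (u q : ℂ) * f q - ∑ i, φ i q) =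
        ∑ i, fun q ↦ (θ i q : ℂ) * f q - φ i q := by
      funext q
      rw [Finset.sum_apply, Finset.sum_sub_distrib, ← Finset.sum_mul, ← Complex.ofReal_sum, hθsum]
    rw [h1]
    refine (eLpNorm_sum_le (fun i _ ↦ ?_) hp).trans ?_
    · exact ((Complex.continuous_ofReal.comp (hθc i)).aestronglyMeasurable.mul hf.1).sub
        (hφ i).1.continuous.aestronglyMeasurable
    · exact (Finset.sum_le_card_nsmul _ _ _ fun i _ ↦ hφ1 i).trans (by simpa using hcardε)
  · set γ : t → (q : M) → Covector m q := fun i q ↦ (θ i q : ℂ) • β q +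
      f q • differential m (fun q ↦ (θ i q : ℂ)) q - differential m (φ i) q with hγ
    have hγm : ∀ i, AEMeasurableForm (γ i) := fun i ↦
      ((AEMeasurableForm.smul (Complex.continuous_ofReal.comp (hθc i)).aestronglyMeasurable
        hβ.1).add (AEMeasurableForm.smul hf.1 (aemeasurableForm_differential _))).sub
        (aemeasurableForm_differential _)
    -- Additivity of the differential is used where `u` is differentiable in a chart; then so are
    -- all products `ρ i * u`.
    have hae : ∀ᵐ q ∂riemannianVolume m M, (u q : ℂ) • β q +
        f q • differential m (fun q ↦ (u q : ℂ)) q - differential m (fun q ↦ ∑ i, φ i q) q =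
        ∑ i, γ i q := by
      refine ae_of_charts (m := m) fun x ↦ ?_
      filter_upwards [ae_differentiableAt_comp_extChartAt_symm m hu x,
        ae_restrict_mem (measurableSet_target x)] with y hd hy
      set ψ := (extChartAt (𝓡 m) x).symm with hψ
      have hTn := (isOpen_target (m := m) x).mem_nhds hy
      have hdθ : ∀ i, DifferentiableAt ℝ (fun y ↦ θ i (ψ y)) y := fun i ↦
        (((contDiffOn_real_comp_extChartAt_symm (hρs i) x).contDiffAt hTn).differentiableAt
          (by simp)).mul hd
      have hdφ : ∀ i, DifferentiableAt ℝ (fun y ↦ φ i (ψ y)) y := fun i ↦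
        (((contDiffOn_comp_extChartAt_symm (hφ i).1 x).contDiffAt hTn).differentiableAt (by simp))
      refine covector_ext x hy fun v ↦ ?_
      have e1 : fderiv ℝ (fun y ↦ u (ψ y)) y v = ∑ i, fderiv ℝ (fun y ↦ θ i (ψ y)) y v := by
        have : (fun y ↦ u (ψ y)) = fun y ↦ ∑ i, θ i (ψ y) := funext fun y ↦ (hθsum _).symm
        rw [this, fderiv_fun_sum fun i _ ↦ hdθ i, sum_apply]
      have e2 : fderiv ℝ (fun y ↦ ∑ i, φ i (ψ y)) y v =
          ∑ i, fderiv ℝ (fun y ↦ φ i (ψ y)) y v := by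
        rw [fderiv_fun_sum fun i _ ↦ hdφ i, sum_apply]
      have e3 : (∑ i, γ i (ψ y)) (chartFrame m x y v) = ∑ i, γ i (ψ y) (chartFrame m x y v) :=
        sum_apply _ _ _
      have e4 : ∀ i, γ i (ψ y) (chartFrame m x y v) = (θ i (ψ y) : ℂ) *
          β (ψ y) (chartFrame m x y v) + f (ψ y) *
          (fderiv ℝ (fun y ↦ θ i (ψ y)) y v : ℝ) - fderiv ℝ (fun y ↦ φ i (ψ y)) y v := fun i ↦ by
        rw [← differential_ofReal_chartFrame (θ i) x hy, ← differential_chartFrame' (φ i) x hy]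
        rfl
      have e5 : ((u (ψ y) : ℂ) • β (ψ y) + f (ψ y) • differential m (fun q ↦ (u q : ℂ)) (ψ y) -
          differential m (fun q ↦ ∑ i, φ i q) (ψ y)) (chartFrame m x y v) =
          (u (ψ y) : ℂ) * β (ψ y) (chartFrame m x y v) + f (ψ y) *
          (fderiv ℝ (fun y ↦ u (ψ y)) y v : ℝ) - fderiv ℝ (fun y ↦ ∑ i, φ i (ψ y)) y v := by
        rw [← differential_ofReal_chartFrame u x hy,
          ← differential_chartFrame' (fun q ↦ ∑ i, φ i q) x hy]
        rfl
      rw [e5, e3, e1, e2, ← hθsum]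
      simp only [e4, Finset.sum_sub_distrib, Finset.sum_add_distrib, ← Finset.sum_mul,
        ← Finset.mul_sum, Complex.ofReal_sum]
    have hle : formENorm (fun q ↦ (u q : ℂ) • β q + f q • differential m (fun q ↦ (u q : ℂ)) q -
        differential m (fun q ↦ ∑ i, φ i q) q) p ≤
        eLpNorm (∑ i, fun q ↦ covectorNorm (γ i q)) p (riemannianVolume m M) := by
      refine eLpNorm_mono_ae_real ?_
      filter_upwards [hae] with q hq
      rw [hq, Real.norm_of_nonneg (covectorNorm_nonneg _), Finset.sum_apply]
      exact covectorNorm_sum_le _ _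
    refine hle.trans ((eLpNorm_sum_le (fun i _ ↦
      (hγm i).aestronglyMeasurable_covectorNorm) hp).trans ?_)
    exact (Finset.sum_le_card_nsmul _ _ _ fun i _ ↦ hφ2 i).trans (by simpa using hcardε)

end CutoffApproximation

/-! ### Small-gradient cutoffs and density -/

section Density

/-- Cutoff functions with small Lipschitz constant on proper metric spaces. -/
lemma exists_lipschitzWith_cutoff {X : Type*} [PseudoMetricSpace X] [ProperSpace X] [Nonempty X]
    {S : Set X} (hS : IsCompact S) {c : NNReal} (hc : 0 < c) :
    ∃ u : X → ℝ, LipschitzWith c u ∧ HasCompactSupport u ∧ (∀ q, 0 ≤ u q) ∧ (∀ q, u q ≤ 1) ∧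
      ∀ q ∈ S, u q = 1 := by
  set o : X := Classical.arbitrary X
  obtain ⟨R, hR⟩ := hS.isBounded.subset_closedBall o
  have hc' : (0 : ℝ) < c := hc
  -- Equal to `1` on the ball of radius `R`, decreasing with slope `c` in the distance and zero
  -- beyond `R + 1 / c`, where properness gives compactness.
  refine ⟨fun q ↦ max 0 (min 1 (1 + c * (R - dist q o))), ?_, ?_, fun q ↦ le_max_left _ _,
    fun q ↦ max_le zero_le_one (min_le_left _ _), fun q hq ↦ ?_⟩
  · have h1 : LipschitzWith 1 fun a : ℝ ↦ max 0 (min 1 a) :=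
      (LipschitzWith.id.const_min 1).const_max 0
    have h2 : LipschitzWith c fun q ↦ 1 + c * (R - dist q o) := by
      refine LipschitzWith.of_dist_le_mul fun q q' ↦ ?_
      rw [Real.dist_eq, show 1 + c * (R - dist q o) - (1 + c * (R - dist q' o)) =
        c * (dist q' o - dist q o) by ring, abs_mul, abs_of_pos hc']
      refine mul_le_mul_of_nonneg_left ?_ hc'.le
      rw [dist_comm q q']
      exact abs_dist_sub_le _ _ _
    have h3 := h1.comp h2
    rwa [one_mul] at h3
  · refine HasCompactSupport.intro (isCompact_closedBall o (R + 1 / c)) fun q hq ↦ ?_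
    rw [Metric.mem_closedBall, not_le] at hq
    refine max_eq_left ((min_le_right _ _).trans ?_)
    have h : c * (R + 1 / c) ≤ c * dist q o := mul_le_mul_of_nonneg_left hq.le hc'.le
    rw [mul_add, mul_one_div_cancel hc'.ne'] at h
    linarith
  · have h : dist q o ≤ R := hR hq
    have h2 : 0 ≤ c * (R - dist q o) := mul_nonneg hc'.le (sub_nonneg.2 h)
    simp only
    rw [min_eq_left (by linarith), max_eq_right zero_le_one]

/-- Where `u ≠ 1` the approximant `h` vanishes. Thus the part of `g` removed by the cutoff is
bounded by the error of a compactly supported approximation, and no sequence of cutoffs is needed.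
-/
lemma eLpNorm_one_sub_smul_le {X W : Type*} [TopologicalSpace X] [MeasurableSpace X]
    {μ : Measure X} [NormedAddCommGroup W] [NormedSpace ℝ W] {p : ℝ≥0∞} {g h : X → W} {u : X → ℝ}
    (h0 : ∀ q, 0 ≤ u q) (h1 : ∀ q, u q ≤ 1) (hu : ∀ q ∈ tsupport h, u q = 1) :
    eLpNorm (fun q ↦ (1 - u q) • g q) p μ ≤ eLpNorm (g - h) p μ := by
  refine eLpNorm_mono fun q ↦ ?_
  by_cases hq : q ∈ tsupport h
  · simp [hu q hq]
  · rw [Pi.sub_apply, image_eq_zero_of_notMem_tsupport hq, sub_zero, norm_smul]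
    refine mul_le_of_le_one_left (norm_nonneg _) ?_
    rw [Real.norm_of_nonneg (sub_nonneg.2 (h1 q))]
    linarith [h0 q]

/-- The product rule for the cutoff as a pointwise identity: the error splits into the part of `β`
cut away, the gradient term `z • D`, and the error in approximating the cut-off function. -/
lemma covectorNorm_sub_le_of_cutoff {V : Type*} [NormedAddCommGroup V] [InnerProductSpace ℝ V]
    [FiniteDimensional ℝ V] {u : ℝ} (hu : u ≤ 1) (z : ℂ) (β D δ : V →L[ℝ] ℂ) :
    covectorNorm (β - δ) ≤ (1 - u) • covectorNorm β + ‖z‖ * covectorNorm D +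
      covectorNorm ((u : ℂ) • β + z • D - δ) := by
  have h : β - δ = ((1 - u : ℝ) : ℂ) • β + (-z) • D + ((u : ℂ) • β + z • D - δ) := by
    ext v
    simp
    ring
  rw [h]
  refine (covectorNorm_add_le _ _).trans (add_le_add_left ((covectorNorm_add_le _ _).trans ?_) _)
  rw [covectorNorm_smul, covectorNorm_smul, Complex.norm_real, norm_neg,
    Real.norm_of_nonneg (sub_nonneg.2 hu), smul_eq_mul]

variable {m : ℕ} {M : Type*} [MetricSpace M] [ChartedSpace (EuclideanSpace ℝ (Fin m)) M]
  [IsManifold (𝓡 m) ∞ M] [RiemannianBundle (fun x : M ↦ TangentSpace (𝓡 m) x)]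
  [IsContMDiffRiemannianBundle (𝓡 m) ∞ (EuclideanSpace ℝ (Fin m))
    (fun x : M ↦ TangentSpace (𝓡 m) x)]
  [IsRiemannianManifold (𝓡 m) M] [MeasurableSpace M] [BorelSpace M] [ProperSpace M] [Nonempty M]

/-- On a complete Riemannian manifold, test functions are dense in the Sobolev spaces. -/
theorem IsWeakDifferential.exists_isTestFunction_sub_le {f : M → ℂ}
    {β : (x : M) → Covector m x} (hw : IsWeakDifferential f β) {p : ℝ≥0∞} (hp : 1 ≤ p)
    (hp' : p ≠ ⊤) (hf : MemLp f p (riemannianVolume m M)) (hβ : MemLpForm β p) {ε : ℝ≥0∞}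
    (hε : 0 < ε) : ∃ φ, IsTestFunction m φ ∧ eLpNorm (f - φ) p (riemannianVolume m M) ≤ ε ∧
      formENorm (fun q ↦ β q - differential m φ q) p ≤ ε := by
  set μ := riemannianVolume m M with hμ
  set η := ε / 3 with hη
  have hη0 : 0 < η := ENNReal.div_pos hε.ne' (by simp)
  have hηε : η + η + η ≤ ε := by
    refine le_trans (le_of_eq ?_) (ENNReal.mul_div_le (a := 3))
    rw [hη]; ring
  have hβm := hβ.1.aestronglyMeasurable_covectorNorm
  have hβL : MemLp (fun q ↦ covectorNorm (β q)) p μ := ⟨hβm, hβ.2⟩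
  obtain ⟨g₁, hg₁, hg₁f, -⟩ := hf.exists_hasCompactSupport_eLpNorm_sub_le hp' hη0.ne'
  obtain ⟨g₂, hg₂, hg₂β, -⟩ := hβL.exists_hasCompactSupport_eLpNorm_sub_le hp' hη0.ne'
  -- The gradient term has norm at most $c\,\|f\|_p$. Completeness allows `c` to be chosen
  -- independently of the set on which the cutoff is `1`.
  obtain ⟨c, hc, hcη⟩ := ENNReal.exists_nnreal_pos_mul_lt hf.2.ne hη0.ne'
  obtain ⟨u, hu, huc, hu0, hu1, huS⟩ :=
    exists_lipschitzWith_cutoff (hg₁.isCompact.union hg₂.isCompact) hc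
  obtain ⟨φ, hφ, hφ1, hφ2⟩ :=
    hw.exists_isTestFunction_lipschitz_mul_approx hp hp' hf hβ hu huc hη0
  refine ⟨φ, hφ, ?_, ?_⟩
  · have h1 : f - φ = (fun q ↦ (1 - u q) • f q) + fun q ↦ (u q : ℂ) * f q - φ q := by
      funext q
      simp only [Pi.sub_apply, Pi.add_apply, Complex.real_smul]
      push_cast
      ring
    rw [h1]
    have hm1 : AEStronglyMeasurable (fun q ↦ (1 - u q) • f q) μ :=
      (continuous_const.sub hu.continuous).aestronglyMeasurable.smul hf.1
    have hm2 : AEStronglyMeasurable (fun q ↦ (u q : ℂ) * f q - φ q) μ :=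
      ((Complex.continuous_ofReal.comp hu.continuous).aestronglyMeasurable.mul hf.1).sub
        hφ.1.continuous.aestronglyMeasurable
    refine (eLpNorm_add_le hm1 hm2 hp).trans ((add_le_add ?_ hφ1).trans (le_self_add.trans hηε))
    exact (eLpNorm_one_sub_smul_le hu0 hu1 fun q hq ↦ huS q (Or.inl hq)).trans hg₁f
  · set w : M → ℝ := fun q ↦ covectorNorm ((u q : ℂ) • β q +
      f q • differential m (fun q ↦ (u q : ℂ)) q - differential m φ q) with hw'
    have hwm : AEStronglyMeasurable w μ :=
      (((AEMeasurableForm.smul (Complex.continuous_ofReal.comp hu.continuous).aestronglyMeasurable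
        hβ.1).add (AEMeasurableForm.smul hf.1 (aemeasurableForm_differential _))).sub
        (aemeasurableForm_differential _)).aestronglyMeasurable_covectorNorm
    have hm1 : AEStronglyMeasurable (fun q ↦ (1 - u q) • covectorNorm (β q)) μ :=
      (continuous_const.sub hu.continuous).aestronglyMeasurable.smul hβm
    have hm2 : AEStronglyMeasurable (fun q ↦ (c : ℝ) * ‖f q‖) μ := hf.1.norm.const_mul _
    have hle : formENorm (fun q ↦ β q - differential m φ q) p ≤
        eLpNorm ((fun q ↦ (1 - u q) • covectorNorm (β q)) + (fun q ↦ (c : ℝ) * ‖f q‖) + w) p μ := by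
      refine eLpNorm_mono_real fun q ↦ ?_
      rw [Real.norm_of_nonneg (covectorNorm_nonneg _)]
      refine (covectorNorm_sub_le_of_cutoff (hu1 q) (f q) (β q)
        (differential m (fun q ↦ (u q : ℂ)) q) (differential m φ q)).trans ?_
      simp only [Pi.add_apply]
      gcongr ?_ + ?_ + ?_
      · exact le_rfl
      · rw [mul_comm]
        exact mul_le_mul_of_nonneg_right (covectorNorm_differential_le hu q) (norm_nonneg _)
      · exact le_rfl
    refine hle.trans ((eLpNorm_add_le (hm1.add hm2) hwm hp).trans ((add_le_add
      ((eLpNorm_add_le hm1 hm2 hp).trans (add_le_add ?_ ?_)) hφ2).trans hηε))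
    · exact (eLpNorm_one_sub_smul_le hu0 hu1 fun q hq ↦ huS q (Or.inr hq)).trans hg₂β
    · refine le_trans ?_ hcη.le
      have := eLpNorm_le_mul_eLpNorm_of_ae_le_mul (f := fun q ↦ (c : ℝ) * ‖f q‖) (g := f) (c := c)
        (μ := μ) (Eventually.of_forall fun q ↦ by
          rw [Real.norm_of_nonneg (mul_nonneg c.coe_nonneg (norm_nonneg _))]) p
      rwa [ENNReal.ofReal_coe_nnreal] at this

theorem exists_sobolevENorm_sub_lt {f : M → ℂ} {p : ℝ≥0∞} (hp : 1 ≤ p) (hp' : p ≠ ⊤)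
    (hf : f ∈ sobolevW m M p) {ε : ℝ≥0∞} (hε : 0 < ε) :
    ∃ φ, IsTestFunction m φ ∧ sobolevENorm m (f - φ) p < ε := by
  obtain ⟨hfp, β, hβ, hw⟩ := hf
  -- The approximation gives non-strict bounds, so a smaller tolerance is split between the function
  -- and its differential.
  obtain ⟨δ, hδ0, hδε⟩ := exists_between hε
  obtain ⟨φ, hφ, h1, h2⟩ := hw.exists_isTestFunction_sub_le hp hp' hfp hβ (ENNReal.half_pos hδ0.ne')
  refine ⟨φ, hφ, lt_of_le_of_lt ?_ hδε⟩
  rw [← ENNReal.add_halves δ]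
  exact add_le_add h1 ((iInf₂_le _ (hw.sub_differential hφ)).trans h2)

end Density

end RiemannianSobolev

end

open RiemannianSobolev in
/-- On a geodesically complete Riemannian manifold, `C_c^∞(M)` is (contained and) dense in
`W^{1,p}(M)` for `p ∈ [1, ∞)`, and `W^{1,p}(M) = H^{1,p}(M)`. -/
theorem proposition2p8 {m : ℕ} {M : Type*} [TopologicalSpace M] [T2Space M]
    [SecondCountableTopology M] [ConnectedSpace M]
    [ChartedSpace (EuclideanSpace ℝ (Fin m)) M] [IsManifold (𝓡 m) ∞ M]
    [RiemannianBundle (fun x : M ↦ TangentSpace (𝓡 m) x)]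
    [IsContMDiffRiemannianBundle (𝓡 m) ∞ (EuclideanSpace ℝ (Fin m))
      (fun x : M ↦ TangentSpace (𝓡 m) x)]
    [MeasurableSpace M] [BorelSpace M]
    (hM : GeodesicallyComplete m M) (p : ℝ≥0∞) (hp : 1 ≤ p) (hp' : p ≠ ⊤) :
    ({φ : M → ℂ | IsTestFunction m φ} ⊆ sobolevW m M p ∧
      sobolevClosure m p {φ : M → ℂ | IsTestFunction m φ} = sobolevW m M p) ∧
    sobolevW m M p = sobolevH m M p := by
  have key : ∀ f ∈ sobolevW m M p, ∀ ε : ℝ≥0∞, 0 < ε →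
      ∃ φ, IsTestFunction m φ ∧ sobolevENorm m (f - φ) p < ε := by
    -- Replacing the given topology by that of the Riemannian distance makes the metric results
    -- applicable to the same manifold structure.
    obtain ⟨d, rfl, h⟩ := exists_metricSpace_isRiemannianManifold m M
    have : IsRiemannianManifold (𝓡 m) M := ⟨h⟩
    have : ProperSpace M := properSpace_of_geodesicallyComplete hM
    exact fun f hf ε hε ↦ exists_sobolevENorm_sub_lt hp hp' hf hε
  refine ⟨⟨fun φ hφ ↦ IsTestFunction.mem_sobolevW hφ p, ?_⟩, ?_⟩
  · exact Subset.antisymm (fun f hf ↦ hf.1) fun f hf ↦ ⟨hf, fun ε hε ↦ key f hf ε hε⟩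
  -- The approximating test functions are themselves smooth elements of $L^p$ with differential in
  -- $L^p$.
  · refine Subset.antisymm (fun f hf ↦ ⟨hf, fun ε hε ↦ ?_⟩) fun f hf ↦ hf.1
    obtain ⟨φ, hφ, h⟩ := key f hf ε hε
    exact ⟨φ, ⟨hφ.1, hφ.memLp p⟩, h⟩
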